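/- **Lemma (Finite dimensional semiclassics).** Let $\mathbb T^2=\mathbb R^2/\mathbb Z^2$, $e_k(x)=e^{ik\cdot x}$ for $k\in 2\pi\mathbb Z^2$, $h=-\Delta+1$ on $\mathfrak H=L^2(\mathbb T^2)$, with eigenvalues $\lambda_k=|k|^2+1$. Let $w\in L^1(\mathbb T^2)$ be real-valued, regarded as a function on $[-\frac12,\frac12]^2$ extended by zero to $\mathbb R^2$, and let $\widehat w(\xi)=\int_{\mathbb R^2} w(x)e^{-i\xi\cdot x}\,dx$. Assume $\widehat w(0)=1$, $\widehat w\ge 0$ on $\mathbb R^2$ and $\sum_{k\in2\pi\mathbb Z^2}\widehat w(k)(1+|k|^2)<\infty$. For $0<\varepsilon\le 1$ put $w^\varepsilon(x)=\sum_{k\in 2\pi\mathbb Z^2}\widehat w(\varepsilon k)e^{ik\cdot x}$, $G=\sum_k\lambda_k^{-1}e_k$ (in $L^2$), $\tau^\varepsilon=\int_{\mathbb T^2} w^\varepsilon G$, $E^\varepsilon=\int_{\mathbb T^2} w^\varepsilon G^2$. For $\Lambda\ge 1$ let $P=\mathbf 1_{h\le\Lambda}$, $K=\operatorname{Tr}P$,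 and on $P\mathfrak H\simeq\mathbb C^K$, with coordinates $\alpha_k=\langle e_k,u\rangle$, let $$d\mu_{0,K}(u)=\prod_{\lambda_k\le\Lambda}\frac{\lambda_k}{\pi}e^{-\lambda_k|\alpha_k|^2}d\alpha_k,\qquad {:}|u(x)|^2{:}=|u(x)|^2-\int|v(x)|^2d\mu_{0,K}(v),$$ $$W^\varepsilon_K[u]=\tfrac12\iint w^\varepsilon(x-y)\,{:}|u(x)|^2{:}\,{:}|u(y)|^2{:}\,dx\,dy-\tau^\varepsilon\int{:}|u(x)|^2{:}\,dx-E^\varepsilon,\qquad \mathcal Z^\varepsilon_K=\int_{P\mathfrak H}e^{-W^\varepsilon_K}d\mu_{0,K}.$$ For $\lambda>0$ let $\langle\cdot\rangle_0$ be the expectation in the free Gibbs state $e^{-\lambda d\Gamma(h)}/\operatorname{Tr}e^{-\lambda d\Gamma(h)}$ on the bosonic Fock space $\mathfrak F(\mathfrak H)$, let $e_k^-=Pe_kP$ ($e_k$ acting by multiplication), and on $\mathfrak F(P\mathfrak H)$ let $$\mathbb H_{\lambda,P}^\varepsilon=d\Gamma(Ph)+\lambda\Big(\tfrac12\sum_{k\in2\pi\mathbb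 Z^2}\widehat w(\varepsilon k)\big|d\Gamma(e_k^-)-\langle d\Gamma(e_k^-)\rangle_0\big|^2-\lambda^{-1}\tau^\varepsilon\big(d\Gamma(P)-\langle d\Gamma(P)\rangle_0\big)-\lambda^{-2}E^\varepsilon\Big),$$ $$Z_P(\lambda)=\operatorname{Tr}_{\mathfrak F(P\mathfrak H)}e^{-\lambda\mathbb H^\varepsilon_{\lambda,P}},\qquad Z_{0,P}(\lambda)=\operatorname{Tr}_{\mathfrak F(P\mathfrak H)}e^{-\lambda d\Gamma(Ph)}.$$ Let $\eta,\nu>0$, and set $\varepsilon=\lambda^\eta$, $\Lambda=\lambda^{-\nu}$. Then for every $\lambda\in(0,1]$ the quantities $Z_P(\lambda)$, $Z_{0,P}(\lambda)$, $\mathcal Z^\varepsilon_K$ are finite and positive and $\int\|u\|^2e^{-W^\varepsilon_K}d\mu_{0,K}<\infty$. Moreover, for every $\delta>0$ there is a constant $C>0$, depending only on $w,\eta,\nu,\delta$, such that for all $\lambda\in(0,1]$ $$-\log\frac{Z_P(\lambda)}{Z_{0,P}(\lambda)}\le-\log\int_{P\mathfrak H}e^{-W^\varepsilon_K[u]}d\mu_{0,K}(u)+C\,\mathcal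 R_\delta(\lambda),$$ $$\mathcal R_\delta(\lambda)=\frac{\lambda\varepsilon^{-2}\Lambda^{1+\delta}}{\mathcal Z^\varepsilon_K}\int_{P\mathfrak H}\|u\|^2e^{-W^\varepsilon_K[u]}d\mu_{0,K}(u)+\lambda\varepsilon^{-2}\Lambda^{2+\delta}-\lambda\Lambda^{1+\delta}|\log\varepsilon|+\lambda\Lambda^{2+\delta},$$ and there is $\lambda_0>0$ such that the same inequality holds with $C=1$ for all $0<\lambda\le\lambda_0$. -/

import Mathlib

open MeasureTheory Filter Topology
open scoped Matrix

noncomputable section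

namespace Phi42

/-! ### The torus, its Fourier modes and the one-body operator -/

/-- The unit torus `ℝ²/ℤ²`.  Its characters are the functions `e_k(x) = exp(i k·x)` with
`k ∈ 2πℤ²`; they form an orthonormal basis of `L²`. -/
abbrev Torus : Type := UnitAddTorus (Fin 2)

/-- Lebesgue measure on the unit torus, that is, its Haar probability measure. -/
abbrev dx : Measure Torus := Measure.pi fun _ : Fin 2 => AddCircle.haarAddCircle

/-- Label `n ∈ ℤ²` of the momentum `k = 2πn ∈ 2πℤ²`. -/
abbrev Mode : Type := Fin 2 → ℤ

/-- The momentum `k = 2πn` as a vector of Euclidean `ℝ²`. -/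
def momentum (n : Mode) : EuclideanSpace ℝ (Fin 2) :=
  WithLp.toLp 2 fun i => 2 * Real.pi * (n i : ℝ)

/-- The plane wave `e_k(x) = exp(i k·x)`, `k = 2πn`. -/
def planeWave (n : Mode) (x : Torus) : ℂ := UnitAddTorus.mFourier n x

/-- The eigenvalue `|k|² + 1` of `h = -Δ + 1` on `e_k`. -/
def eigen (n : Mode) : ℝ := ‖momentum n‖ ^ 2 + 1

lemma eigen_eq (n : Mode) :
    eigen n = (2 * Real.pi) ^ 2 * ((n 0 : ℝ) ^ 2 + (n 1 : ℝ) ^ 2) + 1 := by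
  simp only [eigen, momentum, EuclideanSpace.norm_sq_eq, Fin.sum_univ_two, Real.norm_eq_abs,
    sq_abs]
  ring

lemma finite_modes (Λ : ℝ) : {n : Mode | eigen n ≤ Λ}.Finite := by
  have hπ : (1 : ℝ) ≤ (2 * Real.pi) ^ 2 := by nlinarith [Real.pi_gt_three]
  refine (Set.finite_Icc (fun _ => -⌈Λ⌉ : Mode) (fun _ => ⌈Λ⌉)).subset ?_
  intro n hn
  have h := eigen_eq n ▸ (show eigen n ≤ Λ from hn)
  have hb : ∀ i, |n i| ≤ ⌈Λ⌉ := by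
    intro i
    have h1 : ((n i : ℝ)) ^ 2 ≤ (n 0 : ℝ) ^ 2 + (n 1 : ℝ) ^ 2 := by
      fin_cases i
      · simpa using sq_nonneg (n 1 : ℝ)
      · simpa using sq_nonneg (n 0 : ℝ)
    have h2 : |(n i : ℝ)| ≤ Λ := by
      nlinarith [sq_abs (n i : ℝ), sq_nonneg (|(n i : ℝ)| - 1), sq_nonneg (n 0 : ℝ),
        sq_nonneg (n 1 : ℝ)]
    have h3 : ((|n i| : ℤ) : ℝ) ≤ (⌈Λ⌉ : ℤ) := by
      push_cast
      exact h2.trans (Int.le_ceil Λ)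
    exact_mod_cast h3
  exact ⟨fun i => (abs_le.mp (hb i)).1, fun i => (abs_le.mp (hb i)).2⟩

/-- The modes spanning the range of the spectral projection `P = 1_{h ≤ Λ}`. -/
def modes (Λ : ℝ) : Finset Mode := (finite_modes Λ).toFinset

/-- Matrix element `⟨e_p, e_k e_q⟩` of multiplication by the plane wave `e_k` in `L²` of the
torus.  Restricted to `p, q ∈ modes Λ`, it is the matrix of `e_k⁻ = P e_k P`. -/
def mulEntry (k p q : Mode) : ℂ :=
  ∫ x : Torus, (starRingEnd ℂ) (planeWave p x) * (planeWave k x * planeWave q x) ∂dx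

/-! ### The interaction potential and the counterterms -/

/-- Fourier transform `ŵ(ξ) = ∫ w(x) exp(-i ξ·x) dx` on `ℝ²`. -/
def hatw (w : EuclideanSpace ℝ (Fin 2) → ℝ) (ξ : EuclideanSpace ℝ (Fin 2)) : ℂ :=
  ∫ x, (w x : ℂ) * Complex.exp (-(Complex.I * (inner ℝ ξ x : ℝ)))

/-- Admissible potentials: an `L¹` function on the torus, seen as a function on the cell
`[-1/2,1/2]²` and extended by zero to `ℝ²` (so that it can be rescaled), with
`ŵ(0) = 1`, `ŵ ≥ 0` and `∑_{k ∈ 2πℤ²} ŵ(k) (1 + |k|²) < ∞`. -/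
structure IsPotential (w : EuclideanSpace ℝ (Fin 2) → ℝ) : Prop where
  integrable : Integrable w
  eq_zero_off_cell : ∀ x, (∃ i, 1 / 2 < |x i|) → w x = 0
  hat_zero : hatw w 0 = 1
  hat_im : ∀ ξ, (hatw w ξ).im = 0
  hat_nonneg : ∀ ξ, 0 ≤ (hatw w ξ).re
  summable : Summable fun n : Mode => (hatw w (momentum n)).re * (1 + ‖momentum n‖ ^ 2)

/-- The Fourier coefficient `ŵ(εk)`, `k = 2πn`, of `w^ε`. -/
def coeff (w : EuclideanSpace ℝ (Fin 2) → ℝ) (ε : ℝ) (n : Mode) : ℝ :=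
  (hatw w (ε • momentum n)).re

/-- The periodised rescaled potential `w^ε(x) = ∑_k ŵ(εk) exp(i k·x)` (a real function). -/
def wEps (w : EuclideanSpace ℝ (Fin 2) → ℝ) (ε : ℝ) (x : Torus) : ℝ :=
  (∑' n : Mode, (coeff w ε n : ℂ) * planeWave n x).re

/-- The Green function `G = ∑_k (|k|² + 1)⁻¹ e_k` of `h`; the series converges in `L²`. -/
def green : Lp ℂ 2 dx :=
  ∑' n : Mode, ((eigen n)⁻¹ : ℂ) • UnitAddTorus.mFourierLp 2 n

/-- `τ^ε = ∫ w^ε G`. -/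
def tauEps (w : EuclideanSpace ℝ (Fin 2) → ℝ) (ε : ℝ) : ℝ :=
  ∫ z : Torus, wEps w ε z * (green z).re ∂dx

/-- `E^ε = ∫ w^ε G²`. -/
def energyEps (w : EuclideanSpace ℝ (Fin 2) → ℝ) (ε : ℝ) : ℝ :=
  ∫ z : Torus, wEps w ε z * (green z).re ^ 2 ∂dx

/-! ### The truncated classical model on `P𝔥 ≃ ℂ^K` -/

/-- `P𝔥`, through the coordinates `α_k = ⟨e_k, u⟩`. -/
abbrev Field (Λ : ℝ) : Type := modes Λ → ℂ

/-- The trigonometric polynomial `u = ∑_k α_k e_k`. -/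
def evalField {Λ : ℝ} (u : Field Λ) (x : Torus) : ℂ := ∑ k : modes Λ, u k * planeWave k x

/-- `‖u‖²` in `L²` of the torus. -/
def mass {Λ : ℝ} (u : Field Λ) : ℝ := ∫ x : Torus, ‖evalField u x‖ ^ 2 ∂dx

/-- The Gaussian measure `∏_k (λ_k/π) exp(-λ_k |α_k|²) dα_k`, the cylindrical projection on
`P𝔥` of the Gaussian measure with covariance `h⁻¹`. -/
def gaussian (Λ : ℝ) : Measure (Field Λ) :=
  volume.withDensity fun u => ENNReal.ofReal
    (∏ k : modes Λ, eigen k / Real.pi * Real.exp (-(eigen k * ‖u k‖ ^ 2)))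

/-- The Wick square `:|u(x)|²: = |u(x)|² - ⟨|u(x)|²⟩`. -/
def wick {Λ : ℝ} (u : Field Λ) (x : Torus) : ℝ :=
  ‖evalField u x‖ ^ 2 - ∫ v, ‖evalField v x‖ ^ 2 ∂(gaussian Λ)

/-- The renormalised classical interaction `W^ε_K[u]`. -/
def interaction (w : EuclideanSpace ℝ (Fin 2) → ℝ) (ε : ℝ) {Λ : ℝ} (u : Field Λ) : ℝ :=
  1 / 2 * (∫ x : Torus, ∫ y : Torus, wEps w ε (x - y) * wick u x * wick u y ∂dx ∂dx)
    - tauEps w ε * (∫ x : Torus, wick u x ∂dx) - energyEps w ε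

/-- The classical partition function `𝒵^ε_K`. -/
def classicalZ (w : EuclideanSpace ℝ (Fin 2) → ℝ) (ε Λ : ℝ) : ℝ :=
  ∫ u : Field Λ, Real.exp (-interaction w ε u) ∂(gaussian Λ)

/-- The mean of `‖u‖²` in the truncated Hartree measure `(𝒵^ε_K)⁻¹ e^{-W^ε_K} dμ_{0,K}`. -/
def meanMass (w : EuclideanSpace ℝ (Fin 2) → ℝ) (ε Λ : ℝ) : ℝ :=
  (classicalZ w ε Λ)⁻¹ * ∫ u : Field Λ, mass u * Real.exp (-interaction w ε u) ∂(gaussian Λ)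

/-! ### Bosonic Fock space, in the occupation number basis of the plane waves -/

/-- Occupation numbers; `m` labels the normalised state `|m⟩` with `m k` particles in `e_k`. -/
abbrev Occ : Type := Mode →₀ ℕ

/-- The finite combinations of the states `|m⟩`, a dense subspace of the Fock space of `L²`. -/
abbrev Fock : Type := Occ →₀ ℂ

/-- The state `|m⟩`. -/
def ket (m : Occ) : Fock := Finsupp.single m 1

/-- `a(e_q) |m⟩ = √(m_q) |m - δ_q⟩`. -/
def annihilate (q : Mode) : Fock →ₗ[ℂ] Fock :=
  Finsupp.linearCombination ℂ fun m : Occ =>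
    (Real.sqrt (m q) : ℂ) • ket (m - Finsupp.single q 1)

/-- `a†(e_p) |m⟩ = √(m_p + 1) |m + δ_p⟩`. -/
def create (p : Mode) : Fock →ₗ[ℂ] Fock :=
  Finsupp.linearCombination ℂ fun m : Occ =>
    (Real.sqrt (m p + 1) : ℂ) • ket (m + Finsupp.single p 1)

/-- Second quantisation `dΓ(PAP) = ∑_{p,q} ⟨e_p, A e_q⟩ a†(e_p) a(e_q)`, `p, q ∈ modes Λ`, of
the compression to `P𝔥` of the operator with matrix elements `A p q = ⟨e_p, A e_q⟩`. -/
def dGamma (Λ : ℝ) (A : Mode → Mode → ℂ) : Fock →ₗ[ℂ] Fock :=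
  ∑ p ∈ modes Λ, ∑ q ∈ modes Λ, A p q • (create p ∘ₗ annihilate q)

/-- `dΓ(Ph)`. -/
def dGammaH (Λ : ℝ) : Fock →ₗ[ℂ] Fock := dGamma Λ fun p q => if p = q then (eigen p : ℂ) else 0

/-- `dΓ(P)`. -/
def dGammaP (Λ : ℝ) : Fock →ₗ[ℂ] Fock := dGamma Λ fun p q => if p = q then 1 else 0

/-- `dΓ(e_k⁻)`. -/
def dGammaE (Λ : ℝ) (k : Mode) : Fock →ₗ[ℂ] Fock := dGamma Λ (mulEntry k)

/-- The eigenvalue `∑_k m_k λ_k` of `dΓ(h)` on `|m⟩`. -/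
def freeEnergy (m : Occ) : ℝ := m.sum fun k j => (j : ℝ) * eigen k

/-- The expectation `⟨T⟩₀ = Tr[T e^{-λ dΓ(h)}] / Tr[e^{-λ dΓ(h)}]` in the free Gibbs state on
the Fock space of the whole of `L²`; `e^{-λ dΓ(h)}` is diagonal in the basis `|m⟩`. -/
def freeMean (lam : ℝ) (T : Fock →ₗ[ℂ] Fock) : ℂ :=
  (∑' m : Occ, (Real.exp (-(lam * freeEnergy m)) : ℂ) * T (ket m) m) /
    (∑' m : Occ, (Real.exp (-(lam * freeEnergy m)) : ℂ))

/-- Occupation numbers of the `n`-particle sector of the Fock space of `P𝔥`. -/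
abbrev Sector (Λ : ℝ) (n : ℕ) : Type := {m : Occ // m ∈ (modes Λ).finsuppAntidiag n}

/-- The matrix `⟨m', T m⟩` of an operator on the `n`-particle sector of the Fock space of
`P𝔥`. -/
def sectorMatrix (Λ : ℝ) (n : ℕ) (T : Fock →ₗ[ℂ] Fock) : Matrix (Sector Λ n) (Sector Λ n) ℂ :=
  Matrix.of fun m' m => T (ket m) m'

/-- `|dΓ(e_k⁻) - ⟨dΓ(e_k⁻)⟩₀|²` on the `n`-particle sector, where `|A|² = A* A`. -/
def squareTerm (lam Λ : ℝ) (n : ℕ) (k : Mode) : Matrix (Sector Λ n) (Sector Λ n) ℂ :=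
  (sectorMatrix Λ n (dGammaE Λ k) - freeMean lam (dGammaE Λ k) • 1)ᴴ *
    (sectorMatrix Λ n (dGammaE Λ k) - freeMean lam (dGammaE Λ k) • 1)

/-- The localised interaction on the `n`-particle sector,
`½ ∑_k ŵ(εk) |dΓ(e_k⁻) - ⟨dΓ(e_k⁻)⟩₀|² - λ⁻¹ τ^ε (dΓ(P) - ⟨dΓ(P)⟩₀) - λ⁻² E^ε`. -/
def quantumInteraction (w : EuclideanSpace ℝ (Fin 2) → ℝ) (lam ε Λ : ℝ) (n : ℕ) :
    Matrix (Sector Λ n) (Sector Λ n) ℂ :=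
  (1 / 2 : ℂ) • (∑' k : Mode, (coeff w ε k : ℂ) • squareTerm lam Λ n k)
    - ((lam⁻¹ * tauEps w ε : ℝ) : ℂ) •
        (sectorMatrix Λ n (dGammaP Λ) - freeMean lam (dGammaP Λ) • 1)
    - ((lam⁻¹ ^ 2 * energyEps w ε : ℝ) : ℂ) • 1

/-- The projected Hamiltonian `dΓ(Ph) + λ W̃_{ε,P}` on the `n`-particle sector. -/
def hamiltonian (w : EuclideanSpace ℝ (Fin 2) → ℝ) (lam ε Λ : ℝ) (n : ℕ) :
    Matrix (Sector Λ n) (Sector Λ n) ℂ :=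
  sectorMatrix Λ n (dGammaH Λ) + (lam : ℂ) • quantumInteraction w lam ε Λ n

/-- `Tr e^{-λ H}` over the `n`-particle sector, for the interacting Hamiltonian. -/
def sectorZ (w : EuclideanSpace ℝ (Fin 2) → ℝ) (lam ε Λ : ℝ) (n : ℕ) : ℝ :=
  (NormedSpace.exp (-((lam : ℂ) • hamiltonian w lam ε Λ n))).trace.re

/-- `Tr e^{-λ dΓ(Ph)}` over the `n`-particle sector. -/
def sectorFreeZ (lam Λ : ℝ) (n : ℕ) : ℝ :=
  (NormedSpace.exp (-((lam : ℂ) • sectorMatrix Λ n (dGammaH Λ)))).trace.re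

/-- `Z_P(λ)`, the trace over the Fock space of `P𝔥`. -/
def quantumZ (w : EuclideanSpace ℝ (Fin 2) → ℝ) (lam ε Λ : ℝ) : ℝ :=
  ∑' n : ℕ, sectorZ w lam ε Λ n

/-- `Z_{0,P}(λ)`, the trace over the Fock space of `P𝔥`. -/
def quantumFreeZ (lam Λ : ℝ) : ℝ := ∑' n : ℕ, sectorFreeZ lam Λ n

/-- All the traces and integrals that enter the partition functions converge. -/
def WellDefined (w : EuclideanSpace ℝ (Fin 2) → ℝ) (lam ε Λ : ℝ) : Prop :=
  Summable (sectorZ w lam ε Λ) ∧ Summable (sectorFreeZ lam Λ) ∧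
    0 < quantumZ w lam ε Λ ∧ 0 < quantumFreeZ lam Λ ∧
    Integrable (fun u : Field Λ => Real.exp (-interaction w ε u)) (gaussian Λ) ∧
    Integrable (fun u : Field Λ => mass u * Real.exp (-interaction w ε u)) (gaussian Λ) ∧
    0 < classicalZ w ε Λ

/-- The error terms, with `Λ^{1+δ}`, `Λ^{2+δ}` in place of `Λ^{1+}`, `Λ^{2+}`. -/
def semiclassicalError (w : EuclideanSpace ℝ (Fin 2) → ℝ) (lam ε Λ δ : ℝ) : ℝ :=
  lam * (ε ^ 2)⁻¹ * Λ ^ (1 + δ) * meanMass w ε Λ + lam * (ε ^ 2)⁻¹ * Λ ^ (2 + δ)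
    - lam * Λ ^ (1 + δ) * |Real.log ε| + lam * Λ ^ (2 + δ)

end Phi42

end

/-! The bound is a Berezin–Lieb inequality. On the Fock space of P𝔥 take the normalised coherent
states ξ(u) with amplitude u/√λ. They resolve the identity, ∫ |ξ(u)⟩⟨ξ(u)| du = (πλ)^K
(`integral_qform_coherentVec`), and convexity of the exponential gives ⟨ξ, e^{-λH} ξ⟩ ≥ e^{-⟨ξ, λH
ξ⟩}. Hence (πλ)^K Z_P ≥ ∫ exp(-⟨ξ(u), λH ξ(u)⟩) du (`integral_exp_neg_lowerSymbol_le`).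

The exponent is computed exactly in `hasSum_qform_smul_hamiltonian`. It is the Gaussian weight ∑ λ_k
|α_k|² plus the lower symbol, which differs from the classical interaction, written in Fourier modes
by `interaction_eq`, in two ways. The mean density is λ times a sum of Bose functions instead of ∑
1/λ_k, a difference lying in [0, λK]; and normal ordering adds (λ/2) ∑ ŵ(εk) ‖P e_k u‖², which is at
most λK ‖w‖₁ ‖u‖². With τ^ε ≥ 0 this yields `lowerSymbol_le`: the excess is at most λK(1 + ‖w‖₁)‖u‖²
+ (λK)². Convexity once more (`exp_mean_le_integral_exp`) replaces ‖u‖² by its mean in the classical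
Gibbs measure.

For the free gas, Z₀ ∏ λλ_k ≤ exp(λ Tr Ph) (`quantumFreeZ_mul_prod_le`). Together these give
`neg_log_quantumZ_div_le`. Since K ≤ 9Λ, its error is of order λΛ⟨‖u‖²⟩ + λΛ², a factor Λ^δ better
than required; that spare factor makes the constant 1 for small λ.

Finiteness rests on the k = 0 term: ŵ(0) = 1 makes it quadratic in the mass or particle number, so
it dominates the linear counterterm. Summability of ŵ(εk), given only at ε = 1, is deduced from ŵ ≥
0 in `IsPotential.summable_coeff`. -/

noncomputable section

namespace Phi42

/-! ### Exponentials of Hermitian matrices and the Peierls–Bogoliubov inequality. -/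

section MatrixExponential

variable {n : Type*} [Fintype n]

/-- The real quadratic form `Re ⟨ξ, B ξ⟩`. -/
def qform (B : Matrix n n ℂ) (ξ : n → ℂ) : ℝ := (star ξ ⬝ᵥ B *ᵥ ξ).re

variable [DecidableEq n]

lemma qform_conj_diagonal (U : Matrix n n ℂ) (b : n → ℝ) (ξ : n → ℂ) :
    qform (U * Matrix.diagonal (fun i => (b i : ℂ)) * Uᴴ) ξ
      = ∑ i, b i * ‖(Uᴴ *ᵥ ξ) i‖ ^ 2 := by
  have h : star ξ ⬝ᵥ (U * Matrix.diagonal (fun i => (b i : ℂ)) * Uᴴ) *ᵥ ξ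
      = star (Uᴴ *ᵥ ξ) ⬝ᵥ (Matrix.diagonal (fun i => (b i : ℂ)) *ᵥ (Uᴴ *ᵥ ξ)) := by
    rw [Matrix.star_mulVec, Matrix.conjTranspose_conjTranspose, ← Matrix.dotProduct_mulVec,
      Matrix.mulVec_mulVec, Matrix.mulVec_mulVec, mul_assoc]
  rw [qform, h, dotProduct, Complex.re_sum]
  refine Finset.sum_congr rfl fun i _ => ?_
  rw [Matrix.mulVec_diagonal, Pi.star_apply]
  have : star ((Uᴴ *ᵥ ξ) i) * ((b i : ℂ) * (Uᴴ *ᵥ ξ) i)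
      = (b i : ℂ) * ((Uᴴ *ᵥ ξ) i * (starRingEnd ℂ) ((Uᴴ *ᵥ ξ) i)) := by
    simp only [RCLike.star_def]; ring
  rw [this, Complex.mul_conj, Complex.normSq_eq_norm_sq, ← Complex.ofReal_mul, Complex.ofReal_re]

/-- One unitary frame diagonalises both `A` and its exponential, so the trace and form inequalities
below reduce to scalar inequalities for the eigenvalues. -/
lemma exists_exp_neg_decomposition {A : Matrix n n ℂ} (hA : A.IsHermitian) :
    ∃ (U : Matrix n n ℂ) (a : n → ℝ), Uᴴ * U = 1 ∧ U * Uᴴ = 1 ∧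
      A = U * Matrix.diagonal (fun i => (a i : ℂ)) * Uᴴ ∧
      NormedSpace.exp (-A) = U * Matrix.diagonal (fun i => ((Real.exp (-a i) : ℝ) : ℂ)) * Uᴴ := by
  have h1 : ((hA.eigenvectorUnitary : Matrix n n ℂ))ᴴ * (hA.eigenvectorUnitary : Matrix n n ℂ) = 1 :=
    Unitary.star_mul_self_of_mem hA.eigenvectorUnitary.2
  have h2 : (hA.eigenvectorUnitary : Matrix n n ℂ) * ((hA.eigenvectorUnitary : Matrix n n ℂ))ᴴ = 1 :=
    Unitary.mul_star_self_of_mem hA.eigenvectorUnitary.2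
  have h3 : A = (hA.eigenvectorUnitary : Matrix n n ℂ) *
      Matrix.diagonal (fun i => ((hA.eigenvalues i : ℝ) : ℂ)) *
      ((hA.eigenvectorUnitary : Matrix n n ℂ))ᴴ := hA.spectral_theorem
  refine ⟨hA.eigenvectorUnitary, hA.eigenvalues, h1, h2, h3, ?_⟩
  have hinv : (hA.eigenvectorUnitary : Matrix n n ℂ)⁻¹
      = ((hA.eigenvectorUnitary : Matrix n n ℂ))ᴴ := Matrix.inv_eq_right_inv h2
  have hU : IsUnit (hA.eigenvectorUnitary : Matrix n n ℂ) := ⟨⟨_, _, h2, h1⟩, rfl⟩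
  have h4 : -A = (hA.eigenvectorUnitary : Matrix n n ℂ) *
      Matrix.diagonal (fun i => ((-hA.eigenvalues i : ℝ) : ℂ)) *
      ((hA.eigenvectorUnitary : Matrix n n ℂ))⁻¹ := by
    rw [hinv]
    nth_rw 1 [h3]
    rw [← neg_mul, ← mul_neg, Matrix.diagonal_neg]
    congr 3
    ext i
    simp
  rw [h4, Matrix.exp_conj _ _ hU, Matrix.exp_diagonal, hinv]
  congr 3
  ext i
  rw [Pi.coe_exp, Complex.ofReal_exp, Complex.exp_eq_exp_ℂ]

lemma trace_conj_diagonal {U : Matrix n n ℂ} (hU : Uᴴ * U = 1) (b : n → ℝ) :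
    (U * Matrix.diagonal (fun i => (b i : ℂ)) * Uᴴ).trace.re = ∑ i, b i := by
  rw [Matrix.trace_mul_comm, ← mul_assoc, hU, one_mul, Matrix.trace_diagonal, Complex.re_sum]
  simp

lemma sum_norm_sq_conjTranspose_mulVec {U : Matrix n n ℂ} (hU : U * Uᴴ = 1) (ξ : n → ℂ) :
    ∑ i, ‖(Uᴴ *ᵥ ξ) i‖ ^ 2 = ∑ i, ‖ξ i‖ ^ 2 := by
  have h1 := qform_conj_diagonal U (fun _ => 1) ξ
  have h2 := qform_conj_diagonal (1 : Matrix n n ℂ) (fun _ => 1) ξ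
  simp only [Complex.ofReal_one, Matrix.diagonal_one, mul_one, one_mul,
    Matrix.conjTranspose_one, Matrix.one_mulVec] at h1 h2
  rw [← h1, ← h2, hU]

lemma qform_one (ξ : n → ℂ) : qform (1 : Matrix n n ℂ) ξ = ∑ i, ‖ξ i‖ ^ 2 := by
  simpa using qform_conj_diagonal (1 : Matrix n n ℂ) (fun _ => 1) ξ

lemma trace_exp_neg_nonneg {A : Matrix n n ℂ} (hA : A.IsHermitian) :
    0 ≤ (NormedSpace.exp (-A)).trace.re := by
  obtain ⟨U, a, h1, -, -, h4⟩ := exists_exp_neg_decomposition hA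
  rw [h4, trace_conj_diagonal h1]
  positivity

lemma trace_exp_neg_pos [Nonempty n] {A : Matrix n n ℂ} (hA : A.IsHermitian) :
    0 < (NormedSpace.exp (-A)).trace.re := by
  obtain ⟨U, a, h1, -, -, h4⟩ := exists_exp_neg_decomposition hA
  rw [h4, trace_conj_diagonal h1]
  positivity

lemma trace_exp_neg_le {A : Matrix n n ℂ} (hA : A.IsHermitian) {c : ℝ}
    (hc : ∀ ξ, c * ∑ i, ‖ξ i‖ ^ 2 ≤ qform A ξ) :
    (NormedSpace.exp (-A)).trace.re ≤ Fintype.card n * Real.exp (-c) := by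
  obtain ⟨U, a, h1, h2, h3, h4⟩ := exists_exp_neg_decomposition hA
  rw [h4, trace_conj_diagonal h1]
  have hle : ∀ i, c ≤ a i := by
    intro i
    -- Testing on the i-th eigenvector turns the form bound into a bound on its eigenvalue.
    have h := hc (U *ᵥ Pi.single i 1)
    rw [← sum_norm_sq_conjTranspose_mulVec h2, h3, qform_conj_diagonal,
      Matrix.mulVec_mulVec, h1, Matrix.one_mulVec] at h
    simpa [Pi.single_apply, apply_ite, Finset.sum_ite_eq'] using h
  calc ∑ i, Real.exp (-a i) ≤ ∑ _i : n, Real.exp (-c) :=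
        Finset.sum_le_sum fun i _ => Real.exp_le_exp.mpr (neg_le_neg (hle i))
    _ = _ := by simp

lemma qform_exp_neg_nonneg {A : Matrix n n ℂ} (hA : A.IsHermitian) (ξ : n → ℂ) :
    0 ≤ qform (NormedSpace.exp (-A)) ξ := by
  obtain ⟨U, a, -, -, -, h4⟩ := exists_exp_neg_decomposition hA
  rw [h4, qform_conj_diagonal]
  positivity

/-- The convex function e^{-a} lies above its tangent at s. This replaces Jensen's inequality both
for spectral measures and for the classical Gibbs average; s stays free, so no normalisation is
needed. -/
lemma exp_neg_tangent (s a : ℝ) : Real.exp (-s) * (1 + s - a) ≤ Real.exp (-a) := by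
  have h : Real.exp (-a) = Real.exp (-s) * Real.exp (s - a) := by
    rw [← Real.exp_add]; ring_nf
  rw [h]
  gcongr
  linarith [Real.add_one_le_exp (s - a)]

/-- Peierls–Bogoliubov in tangent-line form. -/
lemma qform_exp_neg_ge {A : Matrix n n ℂ} (hA : A.IsHermitian) (ξ : n → ℂ) (s : ℝ) :
    Real.exp (-s) * ((1 + s) * ∑ i, ‖ξ i‖ ^ 2 - qform A ξ) ≤ qform (NormedSpace.exp (-A)) ξ := by
  obtain ⟨U, a, -, h2, h3, h4⟩ := exists_exp_neg_decomposition hA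
  rw [h4, qform_conj_diagonal, ← sum_norm_sq_conjTranspose_mulVec h2]
  conv_lhs => rw [h3, qform_conj_diagonal]
  rw [Finset.mul_sum, ← Finset.sum_sub_distrib, Finset.mul_sum]
  refine Finset.sum_le_sum fun i _ => ?_
  have := mul_le_mul_of_nonneg_right (exp_neg_tangent s (a i)) (sq_nonneg ‖(Uᴴ *ᵥ ξ) i‖)
  linarith

end MatrixExponential

/-! ### Complex Gaussian moments in one and several variables. -/

section GaussianMoments

open scoped Nat

lemma integrable_complex_moment {r : ℝ} (hr : 0 < r) (a b : ℕ) :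
    Integrable fun z : ℂ =>
      (starRingEnd ℂ) z ^ a * z ^ b * (Real.exp (-(r * ‖z‖ ^ 2)) : ℂ) := by
  have h0 : Integrable fun z : ℂ => ‖z‖ ^ ((a + b : ℕ) : ℝ) * Real.exp (-r * ‖z‖ ^ (2 : ℝ)) := by
    -- A nonintegrable function has Bochner integral 0, while the closed formula for this one is
    -- positive; integrability thus follows from the value.
    by_contra hcon
    have h1 := Complex.integral_rpow_mul_exp_neg_mul_rpow (p := 2) (q := ((a + b : ℕ) : ℝ))
      (by norm_num) (by have : (0 : ℝ) ≤ ((a + b : ℕ) : ℝ) := by positivity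
                        linarith) hr
    rw [integral_undef hcon] at h1
    have : 0 < (2 * Real.pi / 2) * r ^ (-(((a + b : ℕ) : ℝ) + 2) / 2) *
        Real.Gamma ((((a + b : ℕ) : ℝ) + 2) / 2) := by
      have := Real.Gamma_pos_of_pos (s := (((a + b : ℕ) : ℝ) + 2) / 2) (by positivity)
      positivity
    linarith
  refine h0.mono' (by fun_prop) (ae_of_all _ fun z => ?_)
  rw [norm_mul, norm_mul, norm_pow, norm_pow, RCLike.norm_conj, ← pow_add, Real.rpow_natCast,
    Complex.norm_real, Real.norm_of_nonneg (Real.exp_pos _).le, Real.rpow_two, neg_mul]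

lemma integral_complex_moment {r : ℝ} (hr : 0 < r) (a b : ℕ) :
    ∫ z : ℂ, (starRingEnd ℂ) z ^ a * z ^ b * (Real.exp (-(r * ‖z‖ ^ 2)) : ℂ)
      = if a = b then ((Real.pi * a ! / r ^ (a + 1) : ℝ) : ℂ) else 0 := by
  split_ifs with hab
  · subst hab
    have h1 := Complex.integral_rpow_mul_exp_neg_mul_rpow (p := 2) (q := ((2 * a : ℕ) : ℝ))
      (by norm_num) (by have : (0 : ℝ) ≤ ((2 * a : ℕ) : ℝ) := by positivity
                        linarith) hr
    have h2 : ∀ z : ℂ, (starRingEnd ℂ) z ^ a * z ^ a * (Real.exp (-(r * ‖z‖ ^ 2)) : ℂ)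
        = ((‖z‖ ^ ((2 * a : ℕ) : ℝ) * Real.exp (-r * ‖z‖ ^ (2 : ℝ)) : ℝ) : ℂ) := by
      intro z
      rw [← mul_pow, mul_comm ((starRingEnd ℂ) z), Complex.mul_conj, Complex.normSq_eq_norm_sq,
        Real.rpow_natCast, Real.rpow_two, pow_mul]
      push_cast
      ring_nf
    simp_rw [h2]
    rw [integral_complex_ofReal, h1]
    congr 1
    have e1 : (((2 * a : ℕ) : ℝ) + 2) / 2 = (a : ℝ) + 1 := by push_cast; ring
    have e2 : -(((2 * a : ℕ) : ℝ) + 2) / 2 = -((a + 1 : ℕ) : ℝ) := by push_cast; ring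
    rw [e1, e2, Real.Gamma_nat_eq_factorial, Real.rpow_neg hr.le, Real.rpow_natCast]
    field_simp
  -- Rotation by the angle π/(b - a) preserves the measure and the Gaussian factor but flips the
  -- sign of the monomial, so the integral equals its own negative.
  · obtain ⟨c, hc⟩ : ∃ c : Circle, ((c : ℂ)⁻¹) ^ a * (c : ℂ) ^ b = -1 := by
      have hd : ((b : ℝ) - a) ≠ 0 := sub_ne_zero.mpr (by exact_mod_cast Ne.symm hab)
      refine ⟨Circle.exp (Real.pi / ((b : ℝ) - a)), ?_⟩
      rw [Circle.coe_exp, ← Complex.exp_neg, ← Complex.exp_nat_mul, ← Complex.exp_nat_mul,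
        ← Complex.exp_add, ← Complex.exp_pi_mul_I]
      congr 1
      have hd' : ((b : ℂ) - a) ≠ 0 := by exact_mod_cast hd
      push_cast
      field_simp
      ring
    set I := ∫ z : ℂ, (starRingEnd ℂ) z ^ a * z ^ b * (Real.exp (-(r * ‖z‖ ^ 2)) : ℂ) with hI
    have h1 : I = -I := by
      have h2 := (rotation c).measurePreserving.integral_comp
        (rotation c).toHomeomorph.measurableEmbedding
        (fun z : ℂ => (starRingEnd ℂ) z ^ a * z ^ b * (Real.exp (-(r * ‖z‖ ^ 2)) : ℂ))
      refine h2.symm.trans ?_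
      rw [hI, ← integral_neg]
      refine integral_congr_ae (ae_of_all _ fun z => ?_)
      simp only [rotation_apply, map_mul, norm_mul, Circle.norm_coe, one_mul, mul_pow,
        ← Circle.coe_inv_eq_conj, Circle.coe_inv]
      linear_combination ((starRingEnd ℂ) z ^ a * z ^ b * (Real.exp (-(r * ‖z‖ ^ 2)) : ℂ)) * hc
    linear_combination h1 / 2

lemma integrable_field_moment {ι : Type*} [Fintype ι] {r : ι → ℝ} (hr : ∀ k, 0 < r k)
    (a b : ι → ℕ) :
    Integrable fun u : ι → ℂ => ∏ k, ((starRingEnd ℂ) (u k) ^ a k * u k ^ b k *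
      (Real.exp (-(r k * ‖u k‖ ^ 2)) : ℂ)) :=
  Integrable.fintype_prod fun k => integrable_complex_moment (hr k) (a k) (b k)

lemma integral_field_moment {ι : Type*} [Fintype ι] {r : ι → ℝ} (hr : ∀ k, 0 < r k)
    (a b : ι → ℕ) :
    ∫ u : ι → ℂ, ∏ k, ((starRingEnd ℂ) (u k) ^ a k * u k ^ b k *
      (Real.exp (-(r k * ‖u k‖ ^ 2)) : ℂ))
      = if a = b then ∏ k, ((Real.pi * (a k) ! / r k ^ (a k + 1) : ℝ) : ℂ) else 0 := by
  rw [integral_fintype_prod_volume_eq_prod (fun k (z : ℂ) => (starRingEnd ℂ) z ^ a k * z ^ b k *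
      (Real.exp (-(r k * ‖z‖ ^ 2)) : ℂ))]
  simp_rw [integral_complex_moment (hr _)]
  split_ifs with h
  · simp [h]
  · obtain ⟨k, hk⟩ := Function.ne_iff.mp h
    exact Finset.prod_eq_zero (Finset.mem_univ k) (if_neg hk)

end GaussianMoments

/-! ### Plane waves on the torus and Fourier coefficients of |u|². -/

section PlaneWaves

lemma continuous_planeWave (n : Mode) : Continuous (planeWave n) :=
  (UnitAddTorus.mFourier n).continuous

@[fun_prop]
lemma Continuous.planeWave {X : Type*} [TopologicalSpace X] (n : Mode) {g : X → Torus}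
    (hg : Continuous g) : Continuous fun x => Phi42.planeWave n (g x) :=
  (continuous_planeWave n).comp hg

lemma norm_planeWave (n : Mode) (x : Torus) : ‖planeWave n x‖ = 1 := by
  simp only [planeWave, UnitAddTorus.mFourier, ContinuousMap.coe_mk, norm_prod, fourier_apply,
    Circle.norm_coe, Finset.prod_const_one]

lemma planeWave_add (m n : Mode) (x : Torus) :
    planeWave (m + n) x = planeWave m x * planeWave n x := UnitAddTorus.mFourier_add

lemma conj_planeWave (n : Mode) (x : Torus) :
    (starRingEnd ℂ) (planeWave n x) = planeWave (-n) x := UnitAddTorus.mFourier_neg.symm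

lemma planeWave_zero (x : Torus) : planeWave 0 x = 1 := by
  simp [planeWave, UnitAddTorus.mFourier_zero]

lemma planeWave_apply_sub (n : Mode) (x y : Torus) :
    planeWave n (x - y) = planeWave n x * (starRingEnd ℂ) (planeWave n y) := by
  simp only [planeWave, UnitAddTorus.mFourier, ContinuousMap.coe_mk, Pi.sub_apply, map_prod,
    ← Finset.prod_mul_distrib]
  refine Finset.prod_congr rfl fun i _ => ?_
  simp only [sub_eq_add_neg, fourier_apply, smul_add, smul_neg, AddCircle.toCircle_add,
    AddCircle.toCircle_neg, Circle.coe_mul, Circle.coe_inv_eq_conj]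

lemma integrable_of_continuous {E : Type*} [NormedAddCommGroup E] {f : Torus → E}
    (hf : Continuous f) : Integrable f dx :=
  hf.integrable_of_hasCompactSupport (HasCompactSupport.of_compactSpace f)

lemma integral_planeWave (n : Mode) : ∫ x, planeWave n x ∂dx = if n = 0 then 1 else 0 := by
  have h := orthonormal_iff_ite.mp (UnitAddTorus.orthonormal_mFourier (d := Fin 2)) 0 n
  rw [ContinuousMap.inner_toLp] at h
  simp only [UnitAddTorus.mFourier_zero, ContinuousMap.one_apply, map_one, mul_one] at h
  simp only [eq_comm (a := n)]
  exact h

lemma mulEntry_eq (k p q : Mode) : mulEntry k p q = if p = k + q then 1 else 0 := by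
  simp only [mulEntry, conj_planeWave, ← planeWave_add, integral_planeWave]
  congr 1
  rw [neg_add_eq_zero]

variable {Λ : ℝ}

@[fun_prop]
lemma continuous_evalField (u : Field Λ) : Continuous (evalField u) := by
  unfold evalField
  fun_prop

/-- The matrix element `⟨u, e_k u⟩`. -/
def rho (k : Mode) (u : Field Λ) : ℂ :=
  ∑ p : modes Λ, ∑ q : modes Λ, mulEntry k p q * ((starRingEnd ℂ) (u p) * u q)

lemma norm_sq_evalField (u : Field Λ) (x : Torus) :
    ((‖evalField u x‖ ^ 2 : ℝ) : ℂ) = ∑ p : modes Λ, ∑ q : modes Λ,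
      (starRingEnd ℂ) (u p) * u q * ((starRingEnd ℂ) (planeWave p x) * planeWave q x) := by
  rw [← Complex.normSq_eq_norm_sq, Complex.normSq_eq_conj_mul_self, evalField, map_sum,
    Finset.sum_mul_sum]
  refine Finset.sum_congr rfl fun p _ => Finset.sum_congr rfl fun q _ => ?_
  rw [map_mul]; ring

/-- The Fourier coefficients of the density are the quadratic forms of the e_k, the classical
counterparts of dΓ(e_k⁻); the two interactions can therefore be compared mode by mode. -/
lemma integral_planeWave_mul_norm_sq (k : Mode) (u : Field Λ) :
    ∫ x, planeWave k x * ((‖evalField u x‖ ^ 2 : ℝ) : ℂ) ∂dx = rho k u := by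
  simp_rw [norm_sq_evalField, Finset.mul_sum]
  rw [integral_finsetSum _ fun p _ => integrable_of_continuous (by
    refine continuous_finsetSum _ fun q _ => ?_
    simp only [conj_planeWave]
    fun_prop)]
  refine Finset.sum_congr rfl fun p _ => ?_
  rw [integral_finsetSum _ fun p _ => integrable_of_continuous (by
    simp only [conj_planeWave]
    fun_prop)]
  refine Finset.sum_congr rfl fun q _ => ?_
  rw [mulEntry, ← integral_mul_const]
  refine integral_congr_ae (ae_of_all _ fun x => ?_)
  simp only
  ring

lemma rho_zero (u : Field Λ) : rho 0 u = ((∑ p : modes Λ, ‖u p‖ ^ 2 : ℝ) : ℂ) := by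
  simp only [rho, mulEntry_eq, zero_add, Subtype.coe_inj, ite_mul, one_mul, zero_mul,
    Finset.sum_ite_eq, Finset.mem_univ, if_true, ← Complex.normSq_eq_conj_mul_self,
    Complex.normSq_eq_norm_sq]
  push_cast
  rfl

lemma mass_eq (u : Field Λ) : mass u = ∑ p : modes Λ, ‖u p‖ ^ 2 := by
  have h := integral_planeWave_mul_norm_sq 0 u
  simp only [planeWave_zero, one_mul, rho_zero, integral_complex_ofReal] at h
  exact_mod_cast h

end PlaneWaves

/-! ### Absolutely convergent Fourier series, the kernel form and the sign of τ^ε. -/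

section FourierSeries

lemma continuous_tsum_planeWave {d : Mode → ℂ} (hd : Summable d) :
    Continuous fun x => ∑' n, d n * planeWave n x :=
  continuous_tsum (fun n => by fun_prop) hd.norm fun n x => by simp [norm_planeWave]

/-- Integration of a function against an absolutely convergent Fourier series. -/
lemma hasSum_integral_mul_planeWave {f : Torus → ℂ} (hf : Integrable f dx) {d : Mode → ℂ}
    (hd : Summable d) :
    HasSum (fun n => d n * ∫ x, planeWave n x * f x ∂dx)
      (∫ x, (∑' n, d n * planeWave n x) * f x ∂dx) := by
  have h := hasSum_integral_of_summable_integral_norm (μ := dx)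
    (F := fun n x => d n * (planeWave n x * f x)) ?_ ?_
  · simp_rw [integral_const_mul] at h
    have h2 : ∀ x, (∑' n, d n * planeWave n x) * f x = ∑' n, d n * (planeWave n x * f x) := by
      intro x
      rw [← tsum_mul_right]
      simp only [mul_assoc]
    simpa only [h2] using h
  · intro n
    refine (hf.bdd_mul (c := 1) (by fun_prop) (ae_of_all _ fun x => ?_)).const_mul _
    rw [norm_planeWave]
  · simp_rw [norm_mul, norm_planeWave, one_mul, integral_const_mul]
    exact hd.norm.mul_right _

lemma integral_mul_tsum_re {f : Torus → ℝ} (hf : Continuous f) {d : Mode → ℂ}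
    (hd : Summable d) :
    ∫ x, (∑' n, d n * planeWave n x).re * f x ∂dx
      = (∑' n, d n * ∫ x, planeWave n x * (f x : ℂ) ∂dx).re := by
  have hi : Integrable (fun x => (∑' n, d n * planeWave n x) * (f x : ℂ)) dx :=
    integrable_of_continuous ((continuous_tsum_planeWave hd).mul
      (Complex.continuous_ofReal.comp hf))
  rw [(hasSum_integral_mul_planeWave (f := fun x => (f x : ℂ)) (integrable_of_continuous
    (Complex.continuous_ofReal.comp hf)) hd).tsum_eq]
  have := integral_re hi
  simp only [RCLike.re_eq_complex_re] at this
  rw [← this]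
  simp

lemma norm_integral_planeWave_mul_le {f : Torus → ℂ} (n : Mode) :
    ‖∫ x, planeWave n x * f x ∂dx‖ ≤ ∫ x, ‖f x‖ ∂dx := by
  refine (norm_integral_le_integral_norm _).trans_eq ?_
  simp [norm_planeWave]

/-- The quadratic form of a positive-type kernel in Fourier variables. -/
lemma integral_integral_kernel {f : Torus → ℝ} (hf : Continuous f) {c : Mode → ℝ}
    (hc : Summable c) :
    ∫ x, ∫ y, (∑' n, (c n : ℂ) * planeWave n (x - y)).re * f x * f y ∂dx ∂dx
      = ∑' n, c n * ‖∫ x, planeWave n x * (f x : ℂ) ∂dx‖ ^ 2 := by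
  have hc' : Summable fun n => (c n : ℂ) := Complex.ofRealCLM.summable hc
  set F : Mode → ℂ := fun n => ∫ x, planeWave n x * (f x : ℂ) ∂dx with hF
  have hd : Summable fun n => (c n : ℂ) * (starRingEnd ℂ) (F n) := by
    refine .of_norm_bounded (hc'.norm.mul_right (∫ x, ‖(f x : ℂ)‖ ∂dx)) fun n => ?_
    rw [norm_mul, RCLike.norm_conj]
    gcongr
    exact norm_integral_planeWave_mul_le n
  -- Integrating out y leaves a Fourier series in x whose coefficients are those of the kernel times
  -- the conjugate coefficients of f. Conjugating under the real part puts e_n(y), rather than its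
  -- conjugate, in the inner integral.
  have inner_eq : ∀ x, ∫ y, (∑' n, (c n : ℂ) * planeWave n (x - y)).re * f x * f y ∂dx
      = (∑' n, ((c n : ℂ) * (starRingEnd ℂ) (F n)) * planeWave n x).re * f x := by
    intro x
    have hx : Summable fun n => (c n : ℂ) * (starRingEnd ℂ) (planeWave n x) :=
      .of_norm (by simpa [norm_planeWave] using hc'.norm)
    have h1 : ∀ y, (∑' n, (c n : ℂ) * planeWave n (x - y)).re
        = (∑' n, ((c n : ℂ) * (starRingEnd ℂ) (planeWave n x)) * planeWave n y).re := by
      intro y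
      rw [← Complex.conj_re, Complex.conj_tsum]
      congr 2
      ext n
      rw [planeWave_apply_sub]
      simp only [map_mul, Complex.conj_ofReal, Complex.conj_conj, mul_assoc]
    calc ∫ y, (∑' n, (c n : ℂ) * planeWave n (x - y)).re * f x * f y ∂dx
        = f x * ∫ y, (∑' n, ((c n : ℂ) * (starRingEnd ℂ) (planeWave n x)) * planeWave n y).re
            * f y ∂dx := by
          rw [← integral_const_mul]
          refine integral_congr_ae (ae_of_all _ fun y => ?_)
          simp only [h1]; ring
      _ = _ := by
          rw [integral_mul_tsum_re hf hx, mul_comm]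
          congr 1
          rw [← Complex.conj_re, Complex.conj_tsum]
          congr 2
          ext n
          simp only [map_mul, Complex.conj_ofReal, Complex.conj_conj, hF]
          ring
  simp_rw [inner_eq]
  rw [integral_mul_tsum_re hf hd, ← Complex.ofReal_re (∑' n, c n * ‖F n‖ ^ 2), Complex.ofReal_tsum]
  congr 2
  ext n
  rw [mul_assoc, ← Complex.normSq_eq_conj_mul_self, Complex.normSq_eq_norm_sq]
  push_cast
  rfl

lemma inner_mFourierLp_green_re_nonneg (n : Mode) :
    0 ≤ (inner ℂ (UnitAddTorus.mFourierLp 2 n) green).re := by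
  -- If the series failed to be summable, `green` would be 0 by convention and the claim trivial, so
  -- convergence need not be established.
  by_cases hs : Summable fun m : Mode => ((eigen m)⁻¹ : ℂ) • UnitAddTorus.mFourierLp 2 m
  · have h := (innerSL ℂ (UnitAddTorus.mFourierLp 2 n)).hasSum hs.hasSum
    have h2 := Complex.reCLM.hasSum h
    refine h2.nonneg fun m => ?_
    have h3 := orthonormal_iff_ite.mp (UnitAddTorus.orthonormal_mFourier (d := Fin 2)) n m
    simp only [innerSL_apply_apply, Complex.reCLM_apply, inner_smul_right]
    rw [h3, ← Complex.ofReal_inv]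
    have : 0 < eigen m := by unfold eigen; positivity
    split_ifs
    · simp [this.le]
    · simp
  · rw [green, tsum_eq_zero_of_not_summable hs, inner_zero_right, Complex.zero_re]

lemma integrable_green : Integrable green dx :=
  (Lp.memLp green).integrable (by norm_num)

lemma integral_conj_planeWave_mul_green (n : Mode) :
    ∫ z, (starRingEnd ℂ) (planeWave n z) * green z ∂dx
      = inner ℂ (UnitAddTorus.mFourierLp 2 n) green := by
  rw [L2.inner_def]
  refine integral_congr_ae ?_
  filter_upwards [UnitAddTorus.coeFn_mFourierLp 2 n] with z hz
  rw [hz, RCLike.inner_apply, mul_comm]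
  rfl

/-- The product of real parts is the average of Re(e_n G) and Re(e_{-n} G), and each of these
integrates to a nonnegative Fourier coefficient of G. -/
lemma integral_planeWave_re_mul_green_re_nonneg (n : Mode) :
    0 ≤ ∫ z, (planeWave n z).re * (green z).re ∂dx := by
  have hi : ∀ m, Integrable (fun z => planeWave m z * green z) dx := fun m =>
    integrable_green.bdd_mul (c := 1) (by fun_prop) (ae_of_all _ fun x => by rw [norm_planeWave])
  have hre : ∀ m, 0 ≤ ∫ z, (planeWave m z * green z).re ∂dx := by
    intro m
    have h1 := integral_re (hi m)
    simp only [RCLike.re_eq_complex_re] at h1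
    rw [h1]
    have h2 := integral_conj_planeWave_mul_green (-m)
    simp only [conj_planeWave, neg_neg] at h2
    rw [h2]
    exact inner_mFourierLp_green_re_nonneg _
  have h : ∀ z, (planeWave n z).re * (green z).re
      = 1 / 2 * ((planeWave n z * green z).re + (planeWave (-n) z * green z).re) := by
    intro z
    rw [← conj_planeWave]
    simp only [Complex.mul_re, Complex.conj_re, Complex.conj_im]
    ring
  simp_rw [h]
  have hadd := integral_add (hi n).re (hi (-n)).re
  simp only [RCLike.re_eq_complex_re] at hadd
  rw [integral_const_mul, hadd]
  have h1 := hre n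
  have h2 := hre (-n)
  positivity

/-- Termwise integration leaves a series of nonnegative terms. The sign is used in `lowerSymbol_le`,
where passing to the smaller quantum mean density then only lowers the counterterm. -/
lemma tauEps_nonneg {w : EuclideanSpace ℝ (Fin 2) → ℝ} {ε : ℝ} (hc : Summable (coeff w ε))
    (h0 : ∀ n, 0 ≤ coeff w ε n) : 0 ≤ tauEps w ε := by
  have hc' : Summable fun n => (coeff w ε n : ℂ) := Complex.ofRealCLM.summable hc
  have h := (Complex.reCLM.hasSum (hasSum_integral_mul_planeWave
    (f := fun z => ((green z).re : ℂ)) integrable_green.re.ofReal hc'))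
  have hi : Integrable (fun z => (∑' n, (coeff w ε n : ℂ) * planeWave n z) * ((green z).re : ℂ))
      dx := by
    refine integrable_green.re.ofReal.bdd_mul (c := ∑' n, coeff w ε n)
      (continuous_tsum_planeWave hc').aestronglyMeasurable (ae_of_all _ fun z => ?_)
    refine tsum_of_norm_bounded hc.hasSum fun n => ?_
    rw [norm_mul, norm_planeWave, mul_one, Complex.norm_real, Real.norm_of_nonneg (h0 n)]
  have h3 : tauEps w ε = (∫ z, (∑' n, (coeff w ε n : ℂ) * planeWave n z) *
      ((green z).re : ℂ) ∂dx).re := by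
    have := integral_re hi
    simp only [RCLike.re_eq_complex_re] at this
    rw [← this]
    simp [tauEps, wEps]
  rw [h3]
  refine h.nonneg fun n => ?_
  simp only [Complex.reCLM_apply, Complex.re_ofReal_mul]
  refine mul_nonneg (h0 n) ?_
  have hi2 : Integrable (fun z => planeWave n z * ((green z).re : ℂ)) dx :=
    integrable_green.re.ofReal.bdd_mul (c := 1) (by fun_prop)
      (ae_of_all _ fun x => by rw [norm_planeWave])
  have := integral_re hi2
  simp only [RCLike.re_eq_complex_re, Complex.mul_re, Complex.ofReal_re, Complex.ofReal_im,
    mul_zero, sub_zero] at this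
  rw [← this]
  exact integral_planeWave_re_mul_green_re_nonneg n

end FourierSeries

/-! ### Uniqueness of Fourier coefficients of integrable functions. -/

section Uniqueness

/-- An integrable function on the torus whose Fourier coefficients vanish is orthogonal to all
continuous functions. -/
lemma integral_mul_eq_zero_of_fourier_zero {d : Torus → ℂ} (hd : Integrable d dx)
    (h : ∀ n, ∫ t, planeWave n t * d t ∂dx = 0) (φ : C(Torus, ℂ)) :
    ∫ t, φ t * d t ∂dx = 0 := by
  have hint : ∀ φ : C(Torus, ℂ), Integrable (fun t => φ t * d t) dx := fun φ =>
    hd.bdd_mul (c := ‖φ‖) φ.continuous.aestronglyMeasurable (ae_of_all _ φ.norm_coe_le_norm)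
  let T : C(Torus, ℂ) →ₗ[ℂ] ℂ :=
    { toFun := fun φ => ∫ t, φ t * d t ∂dx
      map_add' := fun φ ψ => by
        simp only [ContinuousMap.add_apply, add_mul]
        exact integral_add (hint φ) (hint ψ)
      map_smul' := fun c φ => by
        simp only [ContinuousMap.smul_apply, smul_eq_mul, mul_assoc, RingHom.id_apply]
        exact integral_const_mul _ _ }
  have hT : ∀ φ, ‖T φ‖ ≤ (∫ t, ‖d t‖ ∂dx) * ‖φ‖ := by
    intro φ
    refine (norm_integral_le_integral_norm _).trans ?_
    rw [← integral_mul_const]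
    refine integral_mono (hint φ).norm (hd.norm.mul_const _) fun t => ?_
    simp only [norm_mul]
    rw [mul_comm]
    gcongr
    exact φ.norm_coe_le_norm t
  have hdense : Dense (Submodule.span ℂ (Set.range (UnitAddTorus.mFourier (d := Fin 2))) :
      Set C(Torus, ℂ)) :=
    Submodule.dense_iff_topologicalClosure_eq_top.mpr UnitAddTorus.span_mFourier_closure_eq_top
  have h0 : T.mkContinuous _ hT = 0 := by
    refine ContinuousLinearMap.ext_on hdense ?_
    rintro _ ⟨n, rfl⟩
    exact h n
  exact DFunLike.congr_fun h0 φ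

/-- The positive and negative parts of d are densities of two finite measures that agree on
continuous functions, hence coincide; so the two parts are equal a.e. -/
lemma ae_eq_zero_of_integral_continuous_eq_zero {d : Torus → ℝ} (hd : Integrable d dx)
    (h : ∀ f : C(Torus, ℝ), ∫ t, f t * d t ∂dx = 0) : d =ᵐ[dx] 0 := by
  have hm : AEMeasurable (fun t => ENNReal.ofReal (d t)) dx := hd.aemeasurable.ennreal_ofReal
  have hm' : AEMeasurable (fun t => ENNReal.ofReal (-d t)) dx := hd.neg.aemeasurable.ennreal_ofReal
  have : IsFiniteMeasure (dx.withDensity fun t => ENNReal.ofReal (d t)) :=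
    isFiniteMeasure_withDensity_ofReal hd.2
  have : IsFiniteMeasure (dx.withDensity fun t => ENNReal.ofReal (-d t)) :=
    isFiniteMeasure_withDensity_ofReal hd.neg.2
  have heq : (dx.withDensity fun t => ENNReal.ofReal (d t))
      = dx.withDensity fun t => ENNReal.ofReal (-d t) := by
    refine ext_of_forall_integral_eq_of_IsFiniteMeasure fun f => ?_
    rw [integral_withDensity_eq_integral_toReal_smul₀ hm (by simp),
      integral_withDensity_eq_integral_toReal_smul₀ hm' (by simp), ← sub_eq_zero,
      ← integral_sub]
    · rw [← h f.toContinuousMap]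
      refine integral_congr_ae (ae_of_all _ fun t => ?_)
      simp only [smul_eq_mul, ENNReal.toReal_ofReal', BoundedContinuousFunction.coe_toContinuousMap]
      rw [← sub_mul, mul_comm]
      congr 1
      rcases le_total 0 (d t) with h0 | h0
      · rw [max_eq_left h0, max_eq_right (by linarith), sub_zero]
      · rw [max_eq_right h0, max_eq_left (by linarith), zero_sub, neg_neg]
    · simp only [smul_eq_mul, ENNReal.toReal_ofReal']
      exact hd.pos_part.mul_bdd (c := ‖f‖) f.continuous.aestronglyMeasurable
        (ae_of_all _ f.norm_coe_le_norm)
    · simp only [smul_eq_mul, ENNReal.toReal_ofReal']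
      exact hd.neg_part.mul_bdd (c := ‖f‖) f.continuous.aestronglyMeasurable
        (ae_of_all _ f.norm_coe_le_norm)
  rw [withDensity_eq_iff hm hm' hd.lintegral_lt_top.ne] at heq
  filter_upwards [heq] with t ht
  have h1 := congrArg ENNReal.toReal ht
  simp only [ENNReal.toReal_ofReal'] at h1
  rcases le_total 0 (d t) with h0 | h0
  · rw [max_eq_left h0, max_eq_right (by linarith)] at h1
    exact h1
  · rw [max_eq_right h0, max_eq_left (by linarith)] at h1
    simp only [Pi.zero_apply]
    linarith

lemma re_ae_eq_zero_of_fourier_zero {d : Torus → ℂ} (hd : Integrable d dx)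
    (h : ∀ n, ∫ t, planeWave n t * d t ∂dx = 0) : (fun t => (d t).re) =ᵐ[dx] 0 := by
  refine ae_eq_zero_of_integral_continuous_eq_zero hd.re fun f => ?_
  have h1 := integral_mul_eq_zero_of_fourier_zero hd h
    ⟨fun t => (f t : ℂ), Complex.continuous_ofReal.comp f.continuous⟩
  simp only [ContinuousMap.coe_mk] at h1
  have hi : Integrable (fun t => (f t : ℂ) * d t) dx :=
    hd.bdd_mul (c := ‖f‖) (Complex.continuous_ofReal.comp f.continuous).aestronglyMeasurable
      (ae_of_all _ fun t => by
        rw [Complex.norm_real]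
        exact f.norm_coe_le_norm t)
  have h2 := integral_re hi
  simp only [RCLike.re_eq_complex_re] at h2
  rw [h1, Complex.zero_re] at h2
  rw [← h2]
  simp

end Uniqueness

/-! ### The fundamental cell and integration over it. -/

section Cell

/-- The cell `(-1/2, 1/2]²`. -/
def cell : Set (Fin 2 → ℝ) := {x | ∀ i, x i ∈ Set.Ioc (-1 / 2 : ℝ) (-1 / 2 + 1)}

/-- The representative in the cell of a point of the torus. -/
def rep (t : Torus) : Fin 2 → ℝ := (UnitAddTorus.measurableEquivPiIoc (fun _ => -1 / 2) t).1

lemma measurableSet_cell : MeasurableSet cell :=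
  MeasurableSet.univ_pi' fun _ => measurableSet_Ioc

lemma measurable_rep : Measurable rep :=
  measurable_subtype_coe.comp (MeasurableEquiv.measurable _)

lemma measurePreserving_equivCell :
    MeasurePreserving (UnitAddTorus.measurableEquivPiIoc (ι := Fin 2) (fun _ => -1 / 2)) dx
      (Measure.comap Subtype.val volume) :=
  UnitAddTorus.measurePreserving_equivPiIoc _

lemma integral_comp_rep {E : Type*} [NormedAddCommGroup E] [NormedSpace ℝ E]
    (f : (Fin 2 → ℝ) → E) : ∫ t, f (rep t) ∂dx = ∫ x in cell, f x :=
  (measurePreserving_equivCell.integral_comp' fun y => f y.1).trans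
    (integral_subtype_comap measurableSet_cell f)

lemma integrable_comp_rep {E : Type*} [NormedAddCommGroup E] {f : (Fin 2 → ℝ) → E}
    (hf : IntegrableOn f cell) : Integrable (fun t => f (rep t)) dx := by
  have h := (integrableOn_iff_comap_subtypeVal measurableSet_cell).mp hf
  exact (measurePreserving_equivCell.integrable_comp_emb
    (MeasurableEquiv.measurableEmbedding _)).mpr h

/-- The phase `k·x`, `k = 2πn`. -/
def phase (n : Mode) (x : Fin 2 → ℝ) : ℝ := ∑ i, 2 * Real.pi * (n i : ℝ) * x i

@[fun_prop]
lemma continuous_phase (n : Mode) : Continuous (phase n) := by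
  unfold phase
  fun_prop

/-- The function `exp(-i k·x)` on `ℝ²`. -/
def wave (n : Mode) (x : Fin 2 → ℝ) : ℂ := Complex.exp (-(Complex.I * (phase n x : ℂ)))

@[fun_prop]
lemma continuous_wave (n : Mode) : Continuous (wave n) := by
  unfold wave
  fun_prop

lemma norm_wave (n : Mode) (x : Fin 2 → ℝ) : ‖wave n x‖ = 1 := by
  rw [wave, ← mul_neg, ← Complex.ofReal_neg, mul_comm, Complex.norm_exp_ofReal_mul_I]

lemma wave_rep (n : Mode) (t : Torus) : wave n (rep t) = planeWave (-n) t := by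
  have ht : ∀ i, ((rep t i : ℝ) : UnitAddCircle) = t i := fun i => AddCircle.coe_equivIoc
  rw [planeWave, UnitAddTorus.mFourier, ContinuousMap.coe_mk]
  simp_rw [← ht, fourier_coe_apply]
  rw [← Complex.exp_sum, wave, phase]
  congr 1
  simp only [Fin.sum_univ_two, Pi.neg_apply]
  push_cast
  ring

lemma wave_sub (m n : Mode) (x : Fin 2 → ℝ) :
    wave (m - n) x = wave m x * (starRingEnd ℂ) (wave n x) := by
  rw [wave, wave, wave, ← Complex.exp_conj, ← Complex.exp_add]
  congr 1
  simp only [phase, Fin.sum_univ_two, Pi.sub_apply, map_neg, map_mul, Complex.conj_I,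
    Complex.conj_ofReal]
  push_cast
  ring

lemma smul_mem_cell {ε : ℝ} (h0 : 0 < ε) (h1 : ε ≤ 1) {x : Fin 2 → ℝ} (hx : x ∈ cell) :
    ε • x ∈ cell := by
  intro i
  have := hx i
  simp only [Set.mem_Ioc, Pi.smul_apply, smul_eq_mul] at this ⊢
  constructor <;> nlinarith

lemma continuous_integrableOn_cell {E : Type*} [NormedAddCommGroup E] {f : (Fin 2 → ℝ) → E}
    (hf : Continuous f) : IntegrableOn f cell := by
  refine (hf.integrableOn_Icc (a := fun _ => -1 / 2) (b := fun _ => -1 / 2 + 1)).mono_set ?_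
  exact fun x hx => ⟨fun i => (hx i).1.le, fun i => (hx i).2⟩

/-- The change of variables produces ε⁻² and the integral over ε · cell; as ε ≤ 1 this set lies in
the cell, and F ≥ 0 allows enlarging it. -/
lemma setIntegral_cell_comp_smul_le {F : (Fin 2 → ℝ) → ℝ} (hF : Continuous F) (h : ∀ x, 0 ≤ F x)
    {ε : ℝ} (h0 : 0 < ε) (h1 : ε ≤ 1) :
    ∫ x in cell, F (ε • x) ≤ (ε ^ 2)⁻¹ * ∫ x in cell, F x := by
  have hint : Integrable (cell.indicator F) :=
    (continuous_integrableOn_cell hF).integrable_indicator measurableSet_cell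
  have h2 : (ε ^ 2)⁻¹ * ∫ x in cell, F x = ∫ x, cell.indicator F (ε • x) := by
    rw [Measure.integral_comp_smul, integral_indicator measurableSet_cell]
    simp [abs_of_pos h0]
  rw [h2, ← integral_indicator measurableSet_cell]
  refine integral_mono ((continuous_integrableOn_cell (by fun_prop)).integrable_indicator
    measurableSet_cell) (hint.comp_smul h0.ne') fun x => ?_
  by_cases hx : x ∈ cell
  · simp [hx, smul_mem_cell h0 h1 hx]
  · simp only [hx, not_false_eq_true, Set.indicator_of_notMem]
    exact Set.indicator_nonneg (fun _ _ => h _) _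

lemma integral_norm_sq_sum_planeWave (B : Finset Mode) :
    ∫ t, ‖∑ n ∈ B, planeWave (-n) t‖ ^ 2 ∂dx = B.card := by
  have h : ∀ t, ((‖∑ n ∈ B, planeWave (-n) t‖ ^ 2 : ℝ) : ℂ)
      = ∑ m ∈ B, ∑ n ∈ B, planeWave (m - n) t := by
    intro t
    rw [← Complex.normSq_eq_norm_sq, Complex.normSq_eq_conj_mul_self, map_sum,
      Finset.sum_mul_sum]
    simp only [conj_planeWave, neg_neg, ← planeWave_add, ← sub_eq_add_neg]
  have h2 : ((∫ t, ‖∑ n ∈ B, planeWave (-n) t‖ ^ 2 ∂dx : ℝ) : ℂ) = B.card := by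
    rw [← integral_complex_ofReal]
    simp_rw [h]
    rw [integral_finsetSum _ fun m _ => integrable_of_continuous (by fun_prop)]
    simp_rw [integral_finsetSum B fun n _ => integrable_of_continuous (continuous_planeWave _),
      integral_planeWave, sub_eq_zero]
    simp
  exact_mod_cast h2

end Cell

/-! ### Bounds on the potential and summability of ŵ(εk). -/

section Potential

variable {w : EuclideanSpace ℝ (Fin 2) → ℝ}

/-- The potential as a function on the torus. -/
def onTorus (w : EuclideanSpace ℝ (Fin 2) → ℝ) (t : Torus) : ℝ := w (WithLp.toLp 2 (rep t))

lemma integral_euclidean {E : Type*} [NormedAddCommGroup E] [NormedSpace ℝ E]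
    (f : EuclideanSpace ℝ (Fin 2) → E) : ∫ x, f x = ∫ x : Fin 2 → ℝ, f (WithLp.toLp 2 x) :=
  ((EuclideanSpace.volume_preserving_symm_measurableEquiv_toLp (Fin 2)).symm.integral_comp'
    f).symm

lemma IsPotential.integrable_pi (hw : IsPotential w) :
    Integrable fun x : Fin 2 → ℝ => w (WithLp.toLp 2 x) :=
  ((EuclideanSpace.volume_preserving_symm_measurableEquiv_toLp (Fin 2)).symm.integrable_comp_emb
    (MeasurableEquiv.measurableEmbedding _)).mpr hw.integrable

lemma IsPotential.integrable_onTorus (hw : IsPotential w) : Integrable (onTorus w) dx :=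
  integrable_comp_rep hw.integrable_pi.integrableOn

/-- The closed cell exceeds the half-open one only by edges x_i = -1/2, which are null sets. -/
lemma IsPotential.ae_eq_zero_off_cell (hw : IsPotential w) :
    ∀ᵐ x : Fin 2 → ℝ, x ∉ cell → w (WithLp.toLp 2 x) = 0 := by
  have h : ∀ i : Fin 2, ∀ᵐ x : Fin 2 → ℝ, x i ≠ -1 / 2 := fun i => by
    rw [ae_iff]
    simp only [ne_eq, not_not]
    exact Measure.pi_hyperplane (fun _ : Fin 2 => (volume : Measure ℝ)) i (-1 / 2)
  filter_upwards [ae_all_iff.mpr h] with x hx hxc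
  apply hw.eq_zero_off_cell
  by_contra hcon
  push Not at hcon
  refine hxc fun i => ?_
  have h1 := abs_le.mp (hcon i)
  simp only at h1
  refine ⟨lt_of_le_of_ne (by linarith [h1.1]) (Ne.symm (hx i)), by linarith [h1.2]⟩

lemma IsPotential.hatw_smul_momentum (hw : IsPotential w) (ε : ℝ) (n : Mode) :
    hatw w (ε • momentum n) = ∫ t, (onTorus w t : ℂ) * wave n (ε • rep t) ∂dx := by
  have h := integral_comp_rep fun x => (w (WithLp.toLp 2 x) : ℂ) * wave n (ε • x)
  refine Eq.trans ?_ h.symm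
  rw [setIntegral_eq_integral_of_ae_compl_eq_zero, hatw, integral_euclidean]
  · refine integral_congr_ae (ae_of_all _ fun x => ?_)
    simp only [wave, phase, momentum, PiLp.inner_apply, Fin.sum_univ_two, PiLp.smul_apply,
      Pi.smul_apply, smul_eq_mul, RCLike.inner_apply, conj_trivial]
    congr 6 <;> ring
  · filter_upwards [hw.ae_eq_zero_off_cell] with x hx hxc
    rw [hx hxc, Complex.ofReal_zero, zero_mul]

lemma IsPotential.hatw_eq_coeff (hw : IsPotential w) (ε : ℝ) (n : Mode) :
    hatw w (ε • momentum n) = (coeff w ε n : ℂ) :=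
  Complex.ext rfl (by simp [hw.hat_im])

lemma IsPotential.coeff_nonneg (hw : IsPotential w) (ε : ℝ) (n : Mode) : 0 ≤ coeff w ε n :=
  hw.hat_nonneg _

lemma coeff_le (w : EuclideanSpace ℝ (Fin 2) → ℝ) (ε : ℝ) (n : Mode) :
    coeff w ε n ≤ ∫ x, ‖w x‖ := by
  refine (Complex.re_le_norm _).trans ((norm_integral_le_integral_norm _).trans_eq ?_)
  refine integral_congr_ae (ae_of_all _ fun x => ?_)
  simp only [norm_mul, Complex.norm_real]
  rw [← mul_neg, ← Complex.ofReal_neg, mul_comm Complex.I, Complex.norm_exp_ofReal_mul_I, mul_one]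

lemma IsPotential.coeff_zero (hw : IsPotential w) (ε : ℝ) : coeff w ε 0 = 1 := by
  have : ε • momentum 0 = 0 := by
    ext i
    simp [momentum]
  rw [coeff, this, hw.hat_zero, Complex.one_re]

lemma IsPotential.summable_coeff_one (hw : IsPotential w) : Summable (coeff w 1) := by
  refine Summable.of_nonneg_of_le (fun n => hw.coeff_nonneg 1 n) (fun n => ?_) hw.summable
  rw [coeff, one_smul]
  nlinarith [hw.hat_nonneg (momentum n), sq_nonneg ‖momentum n‖]

/-- An admissible potential is essentially bounded by the sum of its Fourier coefficients. -/
lemma IsPotential.abs_onTorus_le (hw : IsPotential w) :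
    ∀ᵐ t ∂dx, |onTorus w t| ≤ ∑' n, coeff w 1 n := by
  have hc : Summable fun n => (coeff w 1 n : ℂ) := Complex.ofRealCLM.summable hw.summable_coeff_one
  have hcont := continuous_tsum_planeWave hc
  -- Subtracting the absolutely convergent Fourier series leaves a function with vanishing Fourier
  -- coefficients, so w agrees a.e. with the real part of a series bounded by its coefficient sum.
  have h := re_ae_eq_zero_of_fourier_zero
    (d := fun t => (onTorus w t : ℂ) - ∑' n, (coeff w 1 n : ℂ) * planeWave n t)
    (hw.integrable_onTorus.ofReal.sub (integrable_of_continuous hcont)) fun n => by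
      simp only [mul_sub]
      have h1 : ∫ t, planeWave n t * (onTorus w t : ℂ) ∂dx = coeff w 1 (-n) := by
        rw [← hw.hatw_eq_coeff, hw.hatw_smul_momentum]
        simp only [one_smul, wave_rep, neg_neg, mul_comm]
      have h2 : ∫ t, planeWave n t * ∑' m, (coeff w 1 m : ℂ) * planeWave m t ∂dx
          = coeff w 1 (-n) := by
        have := hasSum_integral_mul_planeWave (f := planeWave n)
          (integrable_of_continuous (continuous_planeWave n)) hc
        simp only [← planeWave_add, integral_planeWave, mul_ite, mul_one, mul_zero] at this
        simp only [mul_comm (planeWave n _)]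
        rw [← this.tsum_eq, tsum_eq_single (-n)]
        · simp
        · intro m hm
          rw [if_neg]
          intro h0
          exact hm (eq_neg_of_add_eq_zero_left h0)
      rw [integral_sub, h1, h2, sub_self]
      · exact hw.integrable_onTorus.ofReal.bdd_mul (c := 1) (by fun_prop)
          (ae_of_all _ fun x => by rw [norm_planeWave])
      · exact integrable_of_continuous ((continuous_planeWave n).mul hcont)
  filter_upwards [h] with t ht
  simp only [Complex.sub_re, Complex.ofReal_re, Pi.zero_apply, sub_eq_zero] at ht
  rw [ht]
  refine (Complex.abs_re_le_norm _).trans ?_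
  refine tsum_of_norm_bounded hw.summable_coeff_one.hasSum fun n => ?_
  rw [norm_mul, norm_planeWave, mul_one, Complex.norm_real,
    Real.norm_of_nonneg (hw.coeff_nonneg 1 n)]

/-- The double sum equals ∫ w(x) |∑_{n ∈ B} e^{-iεn·x}|² dx, up to the factor 2π in the phase. Bound
w by its essential supremum, rescale at the cost of ε⁻², and use orthonormality: the trigonometric
sum has squared norm |B|. -/
lemma IsPotential.sum_coeff_sub_le (hw : IsPotential w) {ε : ℝ} (h0 : 0 < ε) (h1 : ε ≤ 1)
    (B : Finset Mode) :
    ∑ m ∈ B, ∑ n ∈ B, coeff w ε (m - n) ≤ (∑' n, coeff w 1 n) * ((ε ^ 2)⁻¹ * B.card) := by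
  set F : (Fin 2 → ℝ) → ℝ := fun x => ‖∑ n ∈ B, wave n x‖ ^ 2 with hF
  have hFc : Continuous F := by fun_prop
  have hFb : ∀ x, F x ≤ (B.card : ℝ) ^ 2 := by
    intro x
    have : ‖∑ n ∈ B, wave n x‖ ≤ B.card := by
      refine (norm_sum_le _ _).trans ?_
      simp [norm_wave]
    exact pow_le_pow_left₀ (norm_nonneg _) this 2
  have hmeas : Measurable fun t => F (ε • rep t) :=
    hFc.measurable.comp (measurable_rep.const_smul ε)
  have hFi : Integrable (fun t => F (ε • rep t)) dx :=
    Integrable.of_bound hmeas.aestronglyMeasurable ((B.card : ℝ) ^ 2) (ae_of_all _ fun t => by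
      rw [Real.norm_of_nonneg (by positivity)]
      exact hFb _)
  have hI : ∀ n, Integrable (fun t => (onTorus w t : ℂ) * wave n (ε • rep t)) dx := fun n =>
    hw.integrable_onTorus.ofReal.mul_bdd (c := 1)
      ((continuous_wave n).measurable.comp (measurable_rep.const_smul ε)).aestronglyMeasurable
      (ae_of_all _ fun x => by rw [norm_wave])
  have hsum : ∑ m ∈ B, ∑ n ∈ B, coeff w ε (m - n) = ∫ t, onTorus w t * F (ε • rep t) ∂dx := by
    apply Complex.ofReal_injective
    push_cast
    rw [← integral_complex_ofReal]
    simp_rw [← hw.hatw_eq_coeff, hw.hatw_smul_momentum]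
    simp_rw [← integral_finsetSum B fun n _ => hI (_ - n)]
    rw [← integral_finsetSum B fun m _ => integrable_finsetSum B fun n _ => hI (m - n)]
    refine integral_congr_ae (ae_of_all _ fun t => ?_)
    simp only [hF, wave_sub, ← Finset.mul_sum]
    rw [← Complex.normSq_eq_norm_sq, Complex.ofReal_mul, ← Complex.mul_conj, map_sum,
      Finset.sum_mul_sum]
    simp only [← Finset.mul_sum]
  rw [hsum]
  calc ∫ t, onTorus w t * F (ε • rep t) ∂dx
      ≤ ∫ t, (∑' n, coeff w 1 n) * F (ε • rep t) ∂dx := by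
        refine integral_mono_ae ?_ (hFi.const_mul _) ?_
        · refine hw.integrable_onTorus.mul_bdd (c := (B.card : ℝ) ^ 2)
            hmeas.aestronglyMeasurable (ae_of_all _ fun t => ?_)
          rw [Real.norm_of_nonneg (by positivity)]
          exact hFb _
        · filter_upwards [hw.abs_onTorus_le] with t ht
          exact mul_le_mul_of_nonneg_right ((le_abs_self _).trans ht) (by positivity)
    _ = (∑' n, coeff w 1 n) * ∫ x in cell, F (ε • x) := by
        rw [integral_const_mul, integral_comp_rep fun x => F (ε • x)]
    _ ≤ _ := by
        refine mul_le_mul_of_nonneg_left ?_ (tsum_nonneg fun n => hw.coeff_nonneg 1 n)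
        refine (setIntegral_cell_comp_smul_le hFc (fun x => by positivity) h0 h1).trans_eq ?_
        rw [← integral_comp_rep]
        simp only [hF, wave_rep, integral_norm_sq_sum_planeWave]

lemma exists_box (F : Finset Mode) : ∃ L : ℕ, ∀ k ∈ F, ∀ i, |k i| ≤ L := by
  refine ⟨∑ k ∈ F, ∑ i, (k i).natAbs, fun k hk i => ?_⟩
  rw [Int.abs_eq_natAbs]
  have h1 : (k i).natAbs ≤ ∑ i, (k i).natAbs :=
    Finset.single_le_sum (f := fun i => (k i).natAbs) (fun _ _ => Nat.zero_le _) (Finset.mem_univ i)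
  have h2 : ∑ i, (k i).natAbs ≤ ∑ k ∈ F, ∑ i, (k i).natAbs :=
    Finset.single_le_sum (f := fun k : Mode => ∑ i, (k i).natAbs) (fun _ _ => Nat.zero_le _) hk
  exact_mod_cast h1.trans h2

/-- The lattice sums of `ŵ` at scale `ε` converge. -/
lemma IsPotential.summable_coeff (hw : IsPotential w) {ε : ℝ} (h0 : 0 < ε) (h1 : ε ≤ 1) :
    Summable (coeff w ε) := by
  -- The factor 4 bounds (4L+1)²/(2L+1)², the ratio of the sizes of the boxes B and B'.
  refine summable_of_sum_le (c := 4 * ((∑' n, coeff w 1 n) * (ε ^ 2)⁻¹))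
    (fun n => hw.coeff_nonneg ε n) fun F => ?_
  obtain ⟨L, hL⟩ := exists_box F
  set B : Finset Mode := Finset.Icc (fun _ => -(2 * L : ℤ)) (fun _ => (2 * L : ℤ)) with hB
  set B' : Finset Mode := Finset.Icc (fun _ => -(L : ℤ)) (fun _ => (L : ℤ)) with hB'
  have hcard : (B.card : ℝ) = (4 * L + 1) ^ 2 := by
    rw [hB, Pi.card_Icc]
    simp only [Int.card_Icc, Finset.prod_const, Finset.card_univ, Fintype.card_fin]
    have : (2 * (L : ℤ) + 1 - -(2 * L)).toNat = 4 * L + 1 := by omega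
    rw [this]
    push_cast
    ring
  have hcard' : (B'.card : ℝ) = (2 * L + 1) ^ 2 := by
    rw [hB', Pi.card_Icc]
    simp only [Int.card_Icc, Finset.prod_const, Finset.card_univ, Fintype.card_fin]
    have : ((L : ℤ) + 1 - -L).toNat = 2 * L + 1 := by omega
    rw [this]
    push_cast
    ring
  -- For each n in the small box, every k in F is a difference m - n with m in the large box. So k
  -- is counted at least |B'| times, and the other terms are nonnegative.
  have hsub : (B'.card : ℝ) * ∑ k ∈ F, coeff w ε k
      ≤ ∑ m ∈ B, ∑ n ∈ B, coeff w ε (m - n) := by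
    rw [Finset.sum_comm]
    calc (B'.card : ℝ) * ∑ k ∈ F, coeff w ε k
        = ∑ n ∈ B', ∑ k ∈ F, coeff w ε k := by simp
      _ ≤ ∑ n ∈ B', ∑ m ∈ B, coeff w ε (m - n) := by
          refine Finset.sum_le_sum fun n hn => ?_
          have hn' := Finset.mem_Icc.mp hn
          calc ∑ k ∈ F, coeff w ε k = ∑ m ∈ F.map (addRightEmbedding n), coeff w ε (m - n) := by
                simp
            _ ≤ _ := by
                refine Finset.sum_le_sum_of_subset_of_nonneg ?_ fun _ _ _ => hw.coeff_nonneg _ _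
                intro m hm
                obtain ⟨k, hk, rfl⟩ := Finset.mem_map.mp hm
                refine Finset.mem_Icc.mpr ⟨fun i => ?_, fun i => ?_⟩
                all_goals
                  have h2 := abs_le.mp (hL k hk i)
                  have h3 := hn'.1 i
                  have h4 := hn'.2 i
                  simp only [addRightEmbedding_apply, Pi.add_apply] at *
                  omega
      _ ≤ _ := by
          refine Finset.sum_le_sum_of_subset_of_nonneg ?_ fun n _ _ =>
            Finset.sum_nonneg fun m _ => hw.coeff_nonneg _ _
          refine Finset.Icc_subset_Icc (fun i => ?_) (fun i => ?_) <;> simp only <;> omega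
  have hle := hsub.trans (hw.sum_coeff_sub_le h0 h1 B)
  rw [hcard, hcard'] at hle
  have hS : 0 ≤ (∑' n, coeff w 1 n) * (ε ^ 2)⁻¹ :=
    mul_nonneg (tsum_nonneg fun n => hw.coeff_nonneg 1 n) (by positivity)
  have hL0 : (0 : ℝ) ≤ L := Nat.cast_nonneg L
  have hpos : (0 : ℝ) < (2 * L + 1) ^ 2 := by positivity
  refine le_of_mul_le_mul_left (hle.trans ?_) hpos
  calc (∑' n, coeff w 1 n) * ((ε ^ 2)⁻¹ * (4 * L + 1) ^ 2)
      = ((∑' n, coeff w 1 n) * (ε ^ 2)⁻¹) * (4 * L + 1) ^ 2 := by ring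
    _ ≤ ((∑' n, coeff w 1 n) * (ε ^ 2)⁻¹) * (4 * (2 * L + 1) ^ 2) := by
        gcongr
        nlinarith
    _ = _ := by ring

end Potential

/-! ### The Gaussian measure and its covariance. -/

section GaussianMeasure

lemma one_le_eigen (n : Mode) : 1 ≤ eigen n := by
  unfold eigen
  nlinarith [sq_nonneg ‖momentum n‖]

lemma eigen_pos (n : Mode) : 0 < eigen n := zero_lt_one.trans_le (one_le_eigen n)

variable {Λ : ℝ}

/-- The density of the Gaussian measure. -/
def gaussianDensity (u : Field Λ) : ℝ :=
  ∏ k : modes Λ, eigen k / Real.pi * Real.exp (-(eigen k * ‖u k‖ ^ 2))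

lemma gaussian_eq :
    gaussian Λ = volume.withDensity fun u => ENNReal.ofReal (gaussianDensity u) := rfl

lemma gaussianDensity_nonneg (u : Field Λ) : 0 ≤ gaussianDensity u :=
  Finset.prod_nonneg fun k _ => by have := eigen_pos k; positivity

lemma continuous_gaussianDensity : Continuous (gaussianDensity (Λ := Λ)) := by
  unfold gaussianDensity
  fun_prop

lemma gaussianDensity_eq (u : Field Λ) :
    gaussianDensity u = (∏ k : modes Λ, eigen k / Real.pi) *
      Real.exp (-∑ k : modes Λ, eigen k * ‖u k‖ ^ 2) := by
  rw [gaussianDensity, Finset.prod_mul_distrib, ← Finset.sum_neg_distrib, Real.exp_sum]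

lemma integral_gaussian {E : Type*} [NormedAddCommGroup E] [NormedSpace ℝ E] (f : Field Λ → E) :
    ∫ u, f u ∂(gaussian Λ) = ∫ u, gaussianDensity u • f u := by
  rw [gaussian_eq, integral_withDensity_eq_integral_toReal_smul₀
    continuous_gaussianDensity.measurable.ennreal_ofReal.aemeasurable (by simp)]
  simp_rw [ENNReal.toReal_ofReal (gaussianDensity_nonneg _)]

lemma integrable_gaussian_iff {E : Type*} [NormedAddCommGroup E] [NormedSpace ℝ E]
    {f : Field Λ → E} :
    Integrable f (gaussian Λ) ↔ Integrable fun u => gaussianDensity u • f u := by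
  rw [gaussian_eq, integrable_withDensity_iff_integrable_smul'
    continuous_gaussianDensity.measurable.ennreal_ofReal (by simp)]
  simp_rw [ENNReal.toReal_ofReal (gaussianDensity_nonneg _)]

lemma integrable_gaussianDensity : Integrable (gaussianDensity (Λ := Λ)) := by
  have h := (integrable_field_moment (ι := modes Λ) (r := fun k => eigen k)
    (fun k => eigen_pos k) 0 0).re.const_mul (∏ k : modes Λ, eigen k / Real.pi)
  refine h.congr (ae_of_all _ fun u => ?_)
  simp only [Pi.zero_apply, pow_zero, one_mul, ← Complex.ofReal_prod, RCLike.re_eq_complex_re,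
    Complex.ofReal_re]
  rw [gaussianDensity, Finset.prod_mul_distrib]

lemma integral_gaussianDensity : ∫ u, gaussianDensity (Λ := Λ) u = 1 := by
  have h := integral_field_moment (ι := modes Λ) (r := fun k => eigen k)
    (fun k => eigen_pos k) 0 0
  simp only [Pi.zero_apply, pow_zero, one_mul, ← Complex.ofReal_prod, if_true,
    integral_complex_ofReal, Complex.ofReal_inj, zero_add, pow_one, Nat.factorial_zero,
    Nat.cast_one, mul_one] at h
  simp only [gaussianDensity, Finset.prod_mul_distrib]
  rw [integral_const_mul, h, ← Finset.prod_mul_distrib]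
  refine Finset.prod_eq_one fun k _ => ?_
  have := (eigen_pos k).ne'
  field_simp

instance : IsProbabilityMeasure (gaussian Λ) := by
  refine ⟨?_⟩
  rw [gaussian_eq, withDensity_apply _ MeasurableSet.univ, setLIntegral_univ]
  rw [← ofReal_integral_eq_lintegral_ofReal integrable_gaussianDensity
    (ae_of_all _ gaussianDensity_nonneg), integral_gaussianDensity, ENNReal.ofReal_one]

lemma prod_pow_single {ι M : Type*} [Fintype ι] [DecidableEq ι] [CommMonoid M] (f : ι → M)
    (p : ι) : ∏ k, f k ^ (Pi.single p 1 : ι → ℕ) k = f p := by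
  rw [Finset.prod_eq_single p]
  · simp
  · intro k _ hk
    simp [Pi.single_eq_of_ne hk]
  · simp

lemma gaussianDensity_smul_eq (p q : modes Λ) (u : Field Λ) :
    gaussianDensity u • ((starRingEnd ℂ) (u p) * u q)
      = ((∏ k : modes Λ, eigen k / Real.pi : ℝ) : ℂ) *
        ∏ k : modes Λ, ((starRingEnd ℂ) (u k) ^ (Pi.single p 1 : modes Λ → ℕ) k *
          u k ^ (Pi.single q 1 : modes Λ → ℕ) k *
          (Real.exp (-(eigen k * ‖u k‖ ^ 2)) : ℂ)) := by
  rw [Finset.prod_mul_distrib, Finset.prod_mul_distrib, prod_pow_single, prod_pow_single,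
    gaussianDensity, Finset.prod_mul_distrib, Complex.real_smul]
  push_cast
  ring

lemma integrable_gaussian_conj_mul (p q : modes Λ) :
    Integrable (fun u : Field Λ => (starRingEnd ℂ) (u p) * u q) (gaussian Λ) := by
  rw [integrable_gaussian_iff]
  simp_rw [gaussianDensity_smul_eq]
  exact (integrable_field_moment (r := fun k : modes Λ => eigen k) (fun k => eigen_pos k) _ _).const_mul _

lemma integral_gaussian_conj_mul (p q : modes Λ) :
    ∫ u : Field Λ, (starRingEnd ℂ) (u p) * u q ∂(gaussian Λ)
      = if p = q then (((eigen p)⁻¹ : ℝ) : ℂ) else 0 := by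
  rw [integral_gaussian]
  simp_rw [gaussianDensity_smul_eq]
  rw [integral_const_mul, integral_field_moment (r := fun k : modes Λ => eigen k)
    (fun k => eigen_pos k)]
  by_cases h : p = q
  · subst h
    rw [if_pos rfl, if_pos rfl, ← Complex.ofReal_prod, ← Complex.ofReal_mul,
      ← Finset.prod_mul_distrib, Finset.prod_eq_single p]
    · have := (eigen_pos p).ne'
      simp only [Pi.single_eq_same, Nat.factorial_one, Nat.cast_one]
      congr 1
      field_simp
    · intro k _ hk
      have := (eigen_pos k).ne'
      simp only [Pi.single_eq_of_ne hk, Nat.factorial_zero, Nat.cast_one, zero_add,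
        pow_one]
      field_simp
    · simp
  · rw [if_neg h, if_neg, mul_zero]
    intro h2
    have := congrFun h2 p
    rw [Pi.single_eq_same, Pi.single_eq_of_ne h] at this
    exact one_ne_zero this

lemma integrable_mass : Integrable (mass (Λ := Λ)) (gaussian Λ) := by
  have h : (mass (Λ := Λ)) = fun u => ∑ p : modes Λ, ((starRingEnd ℂ) (u p) * u p).re := by
    ext u
    rw [mass_eq]
    refine Finset.sum_congr rfl fun p _ => ?_
    rw [← Complex.normSq_eq_conj_mul_self, Complex.ofReal_re, Complex.normSq_eq_norm_sq]
  rw [h]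
  exact integrable_finsetSum _ fun p _ => (integrable_gaussian_conj_mul p p).re

lemma continuous_mass : Continuous (mass (Λ := Λ)) := by
  have h : (mass (Λ := Λ)) = fun u => ∑ p : modes Λ, ‖u p‖ ^ 2 := funext mass_eq
  rw [h]
  fun_prop

lemma mass_nonneg (u : Field Λ) : 0 ≤ mass u := by
  rw [mass_eq]
  positivity

/-- The expected density `∑_k λ_k⁻¹` of the truncated Gaussian field. -/
def density (Λ : ℝ) : ℝ := ∑ k : modes Λ, (eigen k)⁻¹

lemma integral_norm_sq_evalField (x : Torus) :
    ∫ v : Field Λ, ‖evalField v x‖ ^ 2 ∂(gaussian Λ) = density Λ := by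
  apply Complex.ofReal_injective
  rw [← integral_complex_ofReal]
  simp_rw [norm_sq_evalField]
  rw [integral_finsetSum _ fun p _ => integrable_finsetSum _ fun q _ =>
    (integrable_gaussian_conj_mul p q).mul_const _]
  simp_rw [integral_finsetSum _ fun q _ => (integrable_gaussian_conj_mul _ q).mul_const _,
    integral_mul_const, integral_gaussian_conj_mul, ite_mul, zero_mul, Finset.sum_ite_eq,
    Finset.mem_univ, if_true, ← Complex.normSq_eq_conj_mul_self, Complex.normSq_eq_norm_sq,
    norm_planeWave]
  simp [density]

lemma wick_eq (u : Field Λ) (x : Torus) : wick u x = ‖evalField u x‖ ^ 2 - density Λ := by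
  rw [wick, integral_norm_sq_evalField]

end GaussianMeasure

/-! ### The classical interaction in Fourier modes. -/

section ClassicalInteraction

variable {Λ : ℝ} {w : EuclideanSpace ℝ (Fin 2) → ℝ} {ε : ℝ}

/-- The momenta `k` for which `P e_k P` can be nonzero, and `0`. -/
def shifts (Λ : ℝ) : Finset Mode :=
  insert 0 ((modes Λ ×ˢ modes Λ).image fun pq => pq.1 - pq.2)

lemma zero_mem_shifts : 0 ∈ shifts Λ := Finset.mem_insert_self _ _

lemma mulEntry_eq_zero_of_notMem {k p q : Mode} (hk : k ∉ shifts Λ) (hp : p ∈ modes Λ)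
    (hq : q ∈ modes Λ) : mulEntry k p q = 0 := by
  rw [mulEntry_eq, if_neg]
  rintro rfl
  refine hk (Finset.mem_insert_of_mem (Finset.mem_image.mpr ⟨(k + q, q), ?_, by simp⟩))
  exact Finset.mem_product.mpr ⟨hp, hq⟩

lemma rho_eq_zero_of_notMem {k : Mode} (hk : k ∉ shifts Λ) (u : Field Λ) : rho k u = 0 :=
  Finset.sum_eq_zero fun p _ => Finset.sum_eq_zero fun q _ => by
    rw [mulEntry_eq_zero_of_notMem hk p.2 q.2, zero_mul]

@[fun_prop]
lemma continuous_rho (k : Mode) : Continuous (rho (Λ := Λ) k) := by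
  unfold rho
  fun_prop

/-- Interaction energy of mode-space form, with the mean `c` subtracted from the density and
counterterms `τ`, `E`. -/
def modeInteraction (w : EuclideanSpace ℝ (Fin 2) → ℝ) (ε c : ℝ) (u : Field Λ) : ℝ :=
  1 / 2 * ∑ k ∈ shifts Λ, coeff w ε k * ‖rho k u - (if k = 0 then (c : ℂ) else 0)‖ ^ 2
    - tauEps w ε * (mass u - c) - energyEps w ε

lemma continuous_modeInteraction (c : ℝ) :
    Continuous (modeInteraction (Λ := Λ) w ε c) := by
  unfold modeInteraction
  have := continuous_mass (Λ := Λ)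
  fun_prop

lemma rho_zero_eq_mass (u : Field Λ) : rho 0 u = (mass u : ℂ) := by
  rw [rho_zero, mass_eq]

lemma norm_rho_zero_sub (u : Field Λ) (c : ℝ) :
    ‖rho 0 u - (c : ℂ)‖ ^ 2 = (mass u - c) ^ 2 := by
  rw [rho_zero_eq_mass, ← Complex.ofReal_sub, Complex.norm_real, Real.norm_eq_abs, sq_abs]

lemma interaction_eq (hc : Summable (coeff w ε)) (u : Field Λ) :
    interaction w ε u = modeInteraction w ε (density Λ) u := by
  have hcont : Continuous (wick u) := by
    have : wick u = fun x => ‖evalField u x‖ ^ 2 - density Λ := funext (wick_eq u)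
    rw [this]
    fun_prop
  have hF : ∀ n, ∫ x, planeWave n x * (wick u x : ℂ) ∂dx
      = rho n u - (if n = 0 then (density Λ : ℂ) else 0) := by
    intro n
    simp_rw [wick_eq, Complex.ofReal_sub, mul_sub]
    rw [integral_sub, integral_planeWave_mul_norm_sq, integral_mul_const, integral_planeWave]
    · simp
    · exact integrable_of_continuous (by fun_prop)
    · exact integrable_of_continuous (by fun_prop)
  have h0 : ∫ x, wick u x ∂dx = mass u - density Λ := by
    have := hF 0
    simp only [planeWave_zero, one_mul, if_true, rho_zero_eq_mass, integral_complex_ofReal] at this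
    exact_mod_cast this
  have h2 : ∫ x, ∫ y, wEps w ε (x - y) * wick u x * wick u y ∂dx ∂dx
      = ∑ k ∈ shifts Λ, coeff w ε k *
        ‖rho k u - (if k = 0 then (density Λ : ℂ) else 0)‖ ^ 2 := by
    simp only [wEps]
    rw [integral_integral_kernel hcont hc]
    simp_rw [hF]
    refine tsum_eq_sum fun k hk => ?_
    rw [rho_eq_zero_of_notMem hk, if_neg]
    · simp
    · rintro rfl
      exact hk zero_mem_shifts
  rw [interaction, h0, h2, modeInteraction]

/-- Keeping only the mode k = 0, where ŵ(0) = 1, leaves ½(‖u‖² - c)² - τ(‖u‖² - c) - E; completing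
the square bounds it below. -/
lemma modeInteraction_ge (hw : IsPotential w) (c : ℝ) (u : Field Λ) :
    -(tauEps w ε ^ 2 / 2 + energyEps w ε) ≤ modeInteraction w ε c u := by
  have h : (mass u - c) ^ 2 ≤ ∑ k ∈ shifts Λ, coeff w ε k *
      ‖rho k u - (if k = 0 then (c : ℂ) else 0)‖ ^ 2 := by
    refine le_trans (le_of_eq ?_) (Finset.single_le_sum (f := fun k => coeff w ε k *
      ‖rho k u - (if k = 0 then (c : ℂ) else 0)‖ ^ 2)
      (fun k _ => mul_nonneg (hw.coeff_nonneg ε k) (by positivity)) zero_mem_shifts)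
    rw [if_pos rfl, hw.coeff_zero, one_mul, norm_rho_zero_sub]
  unfold modeInteraction
  nlinarith [sq_nonneg (mass u - c - tauEps w ε)]

lemma integrable_exp_neg_of_le {V : Field Λ → ℝ} (hV : Continuous V) {B : ℝ}
    (hB : ∀ u, -B ≤ V u) : Integrable (fun u => Real.exp (-V u)) (gaussian Λ) := by
  refine Integrable.of_bound (Continuous.aestronglyMeasurable (by fun_prop)) (Real.exp B)
    (ae_of_all _ fun u => ?_)
  rw [Real.norm_of_nonneg (Real.exp_pos _).le]
  exact Real.exp_le_exp.mpr (by linarith [hB u])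

lemma integrable_mass_mul_exp_neg_of_le {V : Field Λ → ℝ} (hV : Continuous V) {B : ℝ}
    (hB : ∀ u, -B ≤ V u) : Integrable (fun u => mass u * Real.exp (-V u)) (gaussian Λ) := by
  refine integrable_mass.mul_bdd (c := Real.exp B)
    (Continuous.aestronglyMeasurable (by fun_prop)) (ae_of_all _ fun u => ?_)
  rw [Real.norm_of_nonneg (Real.exp_pos _).le]
  exact Real.exp_le_exp.mpr (by linarith [hB u])

/-- The free-energy cost of perturbing a potential by at most `a ‖u‖² + b`. -/
lemma exp_mean_le_integral_exp {V V' : Field Λ → ℝ} (hV : Continuous V) (hV' : Continuous V')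
    {B : ℝ} (hB : ∀ u, -B ≤ V u) (hB' : ∀ u, -B ≤ V' u) {a b : ℝ}
    (hab : ∀ u, V' u ≤ V u + (a * mass u + b)) {m : ℝ}
    (hm : (∫ u, Real.exp (-V u) ∂(gaussian Λ)) * m = ∫ u, mass u * Real.exp (-V u) ∂(gaussian Λ)) :
    Real.exp (-(a * m + b)) * ∫ u, Real.exp (-V u) ∂(gaussian Λ)
      ≤ ∫ u, Real.exp (-V' u) ∂(gaussian Λ) := by
  have h1 := integrable_exp_neg_of_le hV hB
  have h2 := integrable_mass_mul_exp_neg_of_le hV hB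
  have h3 := integrable_exp_neg_of_le hV' hB'
  -- The tangent point is the Gibbs mean of the perturbation a‖u‖² + b, so the linear term
  -- integrates to zero.
  set s := a * m + b with hs
  have hpt : ∀ u, Real.exp (-s) * ((1 + s - b) * Real.exp (-V u)
      - a * (mass u * Real.exp (-V u))) ≤ Real.exp (-V' u) := by
    intro u
    calc Real.exp (-s) * ((1 + s - b) * Real.exp (-V u) - a * (mass u * Real.exp (-V u)))
        = Real.exp (-V u) * (Real.exp (-s) * (1 + s - (a * mass u + b))) := by ring
      _ ≤ Real.exp (-V u) * Real.exp (-(a * mass u + b)) :=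
          mul_le_mul_of_nonneg_left (exp_neg_tangent _ _) (Real.exp_pos _).le
      _ = Real.exp (-(V u + (a * mass u + b))) := by
          rw [← Real.exp_add]; ring_nf
      _ ≤ _ := Real.exp_le_exp.mpr (neg_le_neg (hab u))
  have h4 := integral_mono (((h1.const_mul (1 + s - b)).sub (h2.const_mul a)).const_mul
    (Real.exp (-s))) h3 hpt
  refine le_trans (le_of_eq ?_) h4
  simp only [Pi.sub_apply]
  rw [integral_const_mul, integral_sub (h1.const_mul _) (h2.const_mul _), integral_const_mul,
    integral_const_mul, ← hm, hs]
  ring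

end ClassicalInteraction

/-! ### Matrix elements of creation, annihilation and second quantisation. -/

section FockOperators

lemma annihilate_apply (q : Mode) (φ : Fock) (m : Occ) :
    annihilate q φ m = (Real.sqrt (m q + 1) : ℂ) * φ (m + Finsupp.single q 1) := by
  induction φ using Finsupp.induction_linear with
  | zero => simp
  | add f g hf hg => rw [map_add, Finsupp.add_apply, hf, hg, Finsupp.add_apply, mul_add]
  | single m₀ c =>
    rw [annihilate, Finsupp.linearCombination_single, ket, Finsupp.smul_apply, Finsupp.smul_apply,
      Finsupp.single_apply, Finsupp.single_apply]
    by_cases h0 : m₀ q = 0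
    · have : m₀ ≠ m + Finsupp.single q 1 := by
        rintro rfl
        simp at h0
      simp [h0, this]
    · have hle : Finsupp.single q 1 ≤ m₀ := Finsupp.single_le_iff.mpr (Nat.one_le_iff_ne_zero.mpr h0)
      by_cases h : m₀ = m + Finsupp.single q 1
      · subst h
        simp [mul_comm]
      · have : m₀ - Finsupp.single q 1 ≠ m := by
          rintro rfl
          exact h (tsub_add_cancel_of_le hle).symm
        simp [h, this]

/-- When `m p = 0` the truncated subtraction leaves `m` unchanged, but the factor √(m p) then
vanishes. -/
lemma create_apply (p : Mode) (φ : Fock) (m : Occ) :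
    create p φ m = (Real.sqrt (m p) : ℂ) * φ (m - Finsupp.single p 1) := by
  induction φ using Finsupp.induction_linear with
  | zero => simp
  | add f g hf hg => rw [map_add, Finsupp.add_apply, hf, hg, Finsupp.add_apply, mul_add]
  | single m₀ c =>
    rw [create, Finsupp.linearCombination_single, ket, Finsupp.smul_apply, Finsupp.smul_apply,
      Finsupp.single_apply, Finsupp.single_apply]
    by_cases h0 : m p = 0
    · have : m₀ + Finsupp.single p 1 ≠ m := by
        rintro rfl
        simp at h0
      simp [h0, this]
    · have hle : Finsupp.single p 1 ≤ m := Finsupp.single_le_iff.mpr (Nat.one_le_iff_ne_zero.mpr h0)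
      by_cases h : m₀ + Finsupp.single p 1 = m
      · subst h
        simp [mul_comm]
      · have : m₀ ≠ m - Finsupp.single p 1 := by
          rintro rfl
          exact h (tsub_add_cancel_of_le hle)
        simp [h, this]

lemma dGamma_apply (Λ : ℝ) (A : Mode → Mode → ℂ) (φ : Fock) (m : Occ) :
    dGamma Λ A φ m = ∑ p ∈ modes Λ, ∑ q ∈ modes Λ, A p q * ((Real.sqrt (m p) : ℂ) *
      ((Real.sqrt (((m - Finsupp.single p 1 : Occ) q + 1 : ℕ)) : ℂ) *
        φ (m - Finsupp.single p 1 + Finsupp.single q 1))) := by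
  simp only [dGamma, LinearMap.sum_apply, LinearMap.smul_apply, LinearMap.comp_apply,
    Finsupp.finsetSum_apply, Finsupp.smul_apply, smul_eq_mul, create_apply, annihilate_apply,
    Nat.cast_add, Nat.cast_one]

lemma dGamma_diagonal_ket (Λ : ℝ) (a : Mode → ℂ) (m : Occ) :
    dGamma Λ (fun p q => if p = q then a p else 0) (ket m)
      = (∑ p ∈ modes Λ, a p * m p) • ket m := by
  ext m'
  rw [dGamma_apply, Finsupp.smul_apply, smul_eq_mul, Finset.sum_mul]
  refine Finset.sum_congr rfl fun p hp => ?_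
  rw [Finset.sum_eq_single_of_mem p hp fun q _ hq => by rw [if_neg (Ne.symm hq), zero_mul],
    if_pos rfl]
  by_cases h0 : m' p = 0
  · by_cases h : m = m'
    · subst h; simp [h0]
    · simp [h0, ket, Finsupp.single_apply, h]
  · have hle : Finsupp.single p 1 ≤ m' := Finsupp.single_le_iff.mpr (Nat.one_le_iff_ne_zero.mpr h0)
    have h1 : (m' - Finsupp.single p 1 : Occ) p + 1 = m' p := by
      simp only [Finsupp.coe_tsub, Pi.sub_apply, Finsupp.single_eq_same]
      omega
    rw [tsub_add_cancel_of_le hle, h1]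
    by_cases h : m = m'
    · subst h
      rw [ket, Finsupp.single_eq_same, mul_one, mul_one, ← Complex.ofReal_mul,
        Real.mul_self_sqrt (Nat.cast_nonneg _), Complex.ofReal_natCast]
    · simp [ket, h]

lemma dGammaE_zero (Λ : ℝ) : dGammaE Λ 0 = dGammaP Λ := by
  have : mulEntry 0 = fun p q => if p = q then 1 else 0 := by
    funext p q
    rw [mulEntry_eq, zero_add]
  rw [dGammaE, dGammaP, this]

/-- Multiplication by e_k moves a particle to a different mode, so its free Gibbs mean is zero and
only k = 0 is recentred. -/
lemma dGammaE_ket_diagonal {Λ : ℝ} {k : Mode} (hk : k ≠ 0) (m : Occ) :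
    dGammaE Λ k (ket m) m = 0 := by
  rw [dGammaE, dGamma_apply]
  refine Finset.sum_eq_zero fun p _ => Finset.sum_eq_zero fun q _ => ?_
  by_cases h0 : m p = 0
  · simp [h0]
  have hle : Finsupp.single p 1 ≤ m := Finsupp.single_le_iff.mpr (Nat.one_le_iff_ne_zero.mpr h0)
  by_cases hpq : p = q
  · subst hpq
    rw [mulEntry_eq, if_neg, zero_mul]
    intro h
    exact hk (by simpa using h)
  · rw [ket, Finsupp.single_apply, if_neg, mul_zero, mul_zero, mul_zero]
    intro h
    have h2 := DFunLike.congr_fun h q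
    simp only [Finsupp.add_apply, Finsupp.coe_tsub, Pi.sub_apply, Finsupp.single_eq_same] at h2
    rw [Finsupp.single_eq_of_ne (Ne.symm hpq)] at h2
    omega

lemma dGammaE_eq_zero_of_notMem {Λ : ℝ} {k : Mode} (hk : k ∉ shifts Λ) : dGammaE Λ k = 0 :=
  Finset.sum_eq_zero fun p hp => Finset.sum_eq_zero fun q hq => by
    rw [mulEntry_eq_zero_of_notMem hk hp hq, zero_smul]

end FockOperators

/-! ### Coherent states: algebra, Poisson weights, expectations of dΓ. -/

section CoherentStates

open scoped Nat

variable {Λ : ℝ}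

/-- The coefficients of the normalised coherent state with amplitude `v`. -/
def coherent (v : Field Λ) (m : Occ) : ℂ :=
  (Real.exp (-(∑ k : modes Λ, ‖v k‖ ^ 2) / 2) : ℂ) *
    ∏ k : modes Λ, (v k ^ m k / (Real.sqrt ((m k)! : ℝ) : ℂ))

/-- In coefficients this is the eigenvalue equation a(e_q) ξ = v_q ξ, from which the later
expectations are derived. -/
lemma coherent_add_single (v : Field Λ) (m : Occ) (q : modes Λ) :
    (Real.sqrt (m q + 1) : ℂ) * coherent v (m + Finsupp.single (q : Mode) 1)
      = v q * coherent v m := by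
  rw [coherent, coherent, ← Finset.mul_prod_erase _ _ (Finset.mem_univ q),
    ← Finset.mul_prod_erase _ _ (Finset.mem_univ q)]
  have h1 : ∀ k ∈ Finset.univ.erase q, v k ^ (m + Finsupp.single (q : Mode) 1 : Occ) k /
      (Real.sqrt (((m + Finsupp.single (q : Mode) 1 : Occ) k)! : ℝ) : ℂ)
      = v k ^ m k / (Real.sqrt ((m k)! : ℝ) : ℂ) := by
    intro k hk
    have : (k : Mode) ≠ q := fun h => Finset.ne_of_mem_erase hk (Subtype.ext h)
    rw [Finsupp.add_apply, Finsupp.single_eq_of_ne this, add_zero]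
  rw [Finset.prod_congr rfl h1, Finsupp.add_apply, Finsupp.single_eq_same, Nat.factorial_succ]
  have h2 : Real.sqrt ((((m q + 1) * (m q)! : ℕ)) : ℝ)
      = Real.sqrt (m q + 1) * Real.sqrt ((m q)! : ℝ) := by
    push_cast
    exact Real.sqrt_mul (by positivity) _
  have h3 : (Real.sqrt ((m q : ℝ) + 1) : ℂ) ≠ 0 := by
    rw [Complex.ofReal_ne_zero]; positivity
  have h4 : (Real.sqrt ((m q)! : ℝ) : ℂ) ≠ 0 := by
    rw [Complex.ofReal_ne_zero]; positivity
  rw [h2, Complex.ofReal_mul, pow_succ]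
  field_simp

/-- The coefficients of `a†(e_p) ξ`. -/
def raised (v : Field Λ) (p : modes Λ) (m : Occ) : ℂ :=
  (Real.sqrt (m p) : ℂ) * coherent v (m - Finsupp.single (p : Mode) 1)

lemma raised_eq_zero (v : Field Λ) {p : modes Λ} {m : Occ} (h : m p = 0) : raised v p m = 0 := by
  simp [raised, h]

lemma raised_add_single (v : Field Λ) (p : modes Λ) (m : Occ) :
    raised v p (m + Finsupp.single (p : Mode) 1)
      = (Real.sqrt (m p + 1) : ℂ) * coherent v m := by
  simp [raised]

/-- The number operator on the coherent state: a†(e_p) a(e_p) ξ = v_p a†(e_p) ξ. -/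
lemma natCast_mul_coherent (v : Field Λ) (p : modes Λ) (m : Occ) :
    (m p : ℂ) * coherent v m = v p * raised v p m := by
  by_cases h0 : m p = 0
  · simp [h0, raised]
  · have hle : Finsupp.single (p : Mode) 1 ≤ m :=
      Finsupp.single_le_iff.mpr (Nat.one_le_iff_ne_zero.mpr h0)
    obtain ⟨m, rfl⟩ := exists_add_of_le hle
    rw [add_comm (Finsupp.single (p : Mode) 1) m, raised_add_single, mul_left_comm,
      ← coherent_add_single, ← mul_assoc, ← Complex.ofReal_mul,
      Real.mul_self_sqrt (by positivity)]
    simp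

/-- The canonical commutation relation on the coherent state. -/
lemma sqrt_mul_raised_add_single (v : Field Λ) (p p' : modes Λ) (m : Occ) :
    (Real.sqrt (m p + 1) : ℂ) * raised v p' (m + Finsupp.single (p : Mode) 1)
      = (if p = p' then coherent v m else 0) + v p * raised v p' m := by
  by_cases h : p = p'
  · subst h
    rw [raised_add_single, if_pos rfl, ← natCast_mul_coherent, ← mul_assoc, ← Complex.ofReal_mul,
      Real.mul_self_sqrt (by positivity)]
    push_cast
    ring
  · have hne : (p' : Mode) ≠ p := fun h2 => h (Subtype.ext h2.symm)
    rw [if_neg h, zero_add]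
    by_cases h0 : m p' = 0
    · rw [raised_eq_zero v h0, raised_eq_zero, mul_zero, mul_zero]
      rw [Finsupp.add_apply, h0, Finsupp.single_eq_of_ne hne, add_zero]
    · have hle : Finsupp.single (p' : Mode) 1 ≤ m :=
        Finsupp.single_le_iff.mpr (Nat.one_le_iff_ne_zero.mpr h0)
      have h1 : (m - Finsupp.single (p' : Mode) 1 : Occ) p = m p := by
        rw [Finsupp.coe_tsub, Pi.sub_apply, Finsupp.single_eq_of_ne hne.symm, Nat.sub_zero]
      have h2 := coherent_add_single v (m - Finsupp.single (p' : Mode) 1) p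
      rw [h1] at h2
      rw [raised, raised, ← tsub_add_eq_add_tsub hle, mul_left_comm, Finsupp.add_apply,
        Finsupp.single_eq_of_ne hne, add_zero, ← mul_left_comm, mul_left_comm (v p), ← h2]
      ring

/-- The shift `0, f 0, f 1, …` of a sequence. -/
def prev (f : ℕ → ℝ) : ℕ → ℝ
  | 0 => 0
  | n + 1 => f n

lemma hasSum_prev {f : ℕ → ℝ} {a : ℝ} (hf : HasSum f a) : HasSum (prev f) a := by
  have := (hasSum_nat_add_iff (f := prev f) 1).mp hf
  simpa [prev] using this

/-- The weight of the coherent state in the `n`-particle sector. -/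
def weight (v : Field Λ) (n : ℕ) : ℝ :=
  ∑ m ∈ (modes Λ).finsuppAntidiag n, ‖coherent v m‖ ^ 2

/-- Adding a particle in p is a bijection from the n-particle states onto the (n+1)-particle states
with p occupied; F vanishes on the rest. -/
lemma sum_finsuppAntidiag_succ {M : Type*} [AddCommMonoid M] {p : Mode} (hp : p ∈ modes Λ)
    (n : ℕ) {F : Occ → M} (hF : ∀ m, m p = 0 → F m = 0) :
    ∑ m ∈ (modes Λ).finsuppAntidiag (n + 1), F m
      = ∑ m ∈ (modes Λ).finsuppAntidiag n, F (m + Finsupp.single p 1) := by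
  symm
  refine (Finset.sum_map _ (addRightEmbedding (Finsupp.single p 1)) F).symm.trans ?_
  refine Finset.sum_subset ?_ ?_
  · intro m' hm'
    obtain ⟨m, hm, rfl⟩ := Finset.mem_map.mp hm'
    rw [Finset.mem_finsuppAntidiag] at hm ⊢
    refine ⟨?_, ?_⟩
    · simp only [addRightEmbedding_apply, Finsupp.add_apply, Finset.sum_add_distrib, hm.1,
        Finsupp.single_apply, Finset.sum_ite_eq, hp, if_true]
    · refine Finsupp.support_add.trans (Finset.union_subset hm.2 ?_)
      refine Finsupp.support_single_subset.trans (Finset.singleton_subset_iff.mpr hp)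
  · intro m' hm' hn
    refine hF m' ?_
    by_contra h0
    have hle : Finsupp.single p 1 ≤ m' :=
      Finsupp.single_le_iff.mpr (Nat.one_le_iff_ne_zero.mpr h0)
    obtain ⟨m, rfl⟩ := exists_add_of_le hle
    refine hn (Finset.mem_map.mpr ⟨m, ?_, by simp [add_comm]⟩)
    rw [Finset.mem_finsuppAntidiag] at hm' ⊢
    refine ⟨?_, ?_⟩
    · have := hm'.1
      simp only [Finsupp.coe_add, Pi.add_apply, Finset.sum_add_distrib, Finsupp.single_apply,
        Finset.sum_ite_eq, hp, if_true] at this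
      change ∑ x ∈ modes Λ, m x = n
      omega
    · exact (Finsupp.support_mono (le_add_of_nonneg_left zero_le)).trans hm'.2

lemma sum_finsuppAntidiag_zero {M : Type*} [AddCommMonoid M] (F : Occ → M) :
    ∑ m ∈ (modes Λ).finsuppAntidiag 0, F m = F 0 := by
  rw [Finset.finsuppAntidiag_zero, Finset.sum_singleton]

lemma conj_mul_self_eq (z : ℂ) : (starRingEnd ℂ) z * z = ((‖z‖ ^ 2 : ℝ) : ℂ) := by
  rw [← Complex.normSq_eq_conj_mul_self, Complex.normSq_eq_norm_sq]

/-- Moving a†(e_p) to the other side of the product gives the factor conj v_p. Creation adds a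
particle, so sector n sees the weight of sector n - 1, whence `prev`. -/
lemma sum_conj_coherent_mul_raised (v : Field Λ) (p : modes Λ) (n : ℕ) :
    ∑ m ∈ (modes Λ).finsuppAntidiag n, (starRingEnd ℂ) (coherent v m) * raised v p m
      = (starRingEnd ℂ) (v p) * (prev (weight v) n : ℂ) := by
  cases n with
  | zero => rw [sum_finsuppAntidiag_zero, raised_eq_zero v (by simp)]; simp [prev]
  | succ n =>
    rw [sum_finsuppAntidiag_succ p.2 n fun m hm => by rw [raised_eq_zero v hm, mul_zero], prev,
      weight, Complex.ofReal_sum, Finset.mul_sum]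
    refine Finset.sum_congr rfl fun m _ => ?_
    rw [raised_add_single, ← conj_mul_self_eq, ← mul_assoc, ← mul_assoc, ← map_mul,
      ← coherent_add_single, map_mul, Complex.conj_ofReal]
    ring

/-- By the commutation relation, a(e_p) a†(e_p') = δ + a†(e_p') a(e_p); the δ is the origin of the
normal-ordering correction. -/
lemma sum_conj_raised_mul_raised (v : Field Λ) (p p' : modes Λ) (n : ℕ) :
    ∑ m ∈ (modes Λ).finsuppAntidiag n, (starRingEnd ℂ) (raised v p m) * raised v p' m
      = (if p = p' then (prev (weight v) n : ℂ) else 0)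
        + v p * (starRingEnd ℂ) (v p') * (prev (prev (weight v)) n : ℂ) := by
  cases n with
  | zero => rw [sum_finsuppAntidiag_zero, raised_eq_zero v (by simp)]; simp [prev]
  | succ n =>
    rw [sum_finsuppAntidiag_succ p.2 n fun m hm => by
      rw [raised_eq_zero v hm, map_zero, zero_mul]]
    have h : ∀ m, (starRingEnd ℂ) (raised v p (m + Finsupp.single (p : Mode) 1)) *
        raised v p' (m + Finsupp.single (p : Mode) 1)
        = (if p = p' then ((‖coherent v m‖ ^ 2 : ℝ) : ℂ) else 0)
          + v p * ((starRingEnd ℂ) (coherent v m) * raised v p' m) := by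
      intro m
      rw [raised_add_single, map_mul, Complex.conj_ofReal, mul_right_comm, mul_comm,
        sqrt_mul_raised_add_single, mul_add, ← conj_mul_self_eq]
      split_ifs <;> ring
    simp_rw [h]
    rw [Finset.sum_add_distrib, ← Finset.mul_sum, sum_conj_coherent_mul_raised]
    simp only [prev, weight, Complex.ofReal_sum]
    split_ifs
    · ring
    · simp only [Finset.sum_const_zero]; ring

/-- Evaluating the number operator on sector n + 1 in two ways, by counting and through the
eigenvalue equation, gives the recursion of a Poisson law. -/
lemma succ_mul_weight_succ (v : Field Λ) (n : ℕ) :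
    ((n : ℝ) + 1) * weight v (n + 1) = (∑ k : modes Λ, ‖v k‖ ^ 2) * weight v n := by
  apply Complex.ofReal_injective
  have h : ∀ p : modes Λ, ∑ m ∈ (modes Λ).finsuppAntidiag (n + 1),
      (m p : ℂ) * ((‖coherent v m‖ ^ 2 : ℝ) : ℂ) = ((‖v p‖ ^ 2 * weight v n : ℝ) : ℂ) := by
    intro p
    have h1 := sum_conj_coherent_mul_raised v p (n + 1)
    simp only [prev] at h1
    rw [Complex.ofReal_mul, ← conj_mul_self_eq, mul_comm ((starRingEnd ℂ) (v p)), mul_assoc, ← h1,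
      Finset.mul_sum]
    refine Finset.sum_congr rfl fun m _ => ?_
    rw [← conj_mul_self_eq, mul_left_comm, natCast_mul_coherent]
    ring
  rw [Finset.sum_mul, Complex.ofReal_sum]
  simp_rw [← h]
  rw [Finset.sum_comm, Complex.ofReal_mul, weight, Complex.ofReal_sum, Finset.mul_sum]
  refine Finset.sum_congr rfl fun m hm => ?_
  rw [← Finset.sum_mul]
  congr 1
  rw [Finset.mem_finsuppAntidiag] at hm
  rw [Finset.sum_coe_sort (modes Λ) fun k => ((m k : ℕ) : ℂ), ← Nat.cast_sum, hm.1]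
  push_cast
  rfl

lemma weight_eq (v : Field Λ) (n : ℕ) :
    weight v n = Real.exp (-∑ k : modes Λ, ‖v k‖ ^ 2) *
      ((∑ k : modes Λ, ‖v k‖ ^ 2) ^ n / n !) := by
  induction n with
  | zero =>
    rw [weight, sum_finsuppAntidiag_zero, coherent, norm_mul, Complex.norm_real,
      Real.norm_of_nonneg (Real.exp_pos _).le, mul_pow, ← Real.exp_nat_mul]
    simp
    ring_nf
  | succ n ih =>
    have h := succ_mul_weight_succ v n
    have hn : (n : ℝ) + 1 ≠ 0 := by positivity
    rw [ih] at h
    apply mul_left_cancel₀ hn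
    rw [h, Nat.factorial_succ, pow_succ]
    push_cast
    field_simp

lemma hasSum_weight (v : Field Λ) : HasSum (weight v) 1 := by
  have h := (NormedSpace.expSeries_div_hasSum_exp (𝔸 := ℝ) (∑ k : modes Λ, ‖v k‖ ^ 2)).mul_left
    (Real.exp (-∑ k : modes Λ, ‖v k‖ ^ 2))
  rw [← Real.exp_eq_exp_ℝ, ← Real.exp_add, neg_add_cancel, Real.exp_zero] at h
  exact h.congr_fun (weight_eq v)

/-- The component of the coherent state in the `n`-particle sector. -/
def coherentVec (v : Field Λ) (n : ℕ) : Sector Λ n → ℂ := fun m => coherent v m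

lemma sum_norm_sq_coherentVec (v : Field Λ) (n : ℕ) :
    ∑ m, ‖coherentVec v n m‖ ^ 2 = weight v n :=
  Finset.sum_coe_sort ((modes Λ).finsuppAntidiag n) fun m => ‖coherent v m‖ ^ 2

/-- The one-body vector `A v`. -/
def oneBody (A : Mode → Mode → ℂ) (v : Field Λ) : Field Λ := fun p => ∑ q : modes Λ, A p q * v q

lemma sectorMatrix_mulVec (T : Fock →ₗ[ℂ] Fock) {n : ℕ} (ξ : Sector Λ n → ℂ) (m' : Sector Λ n) :
    (sectorMatrix Λ n T *ᵥ ξ) m' = T (∑ m, ξ m • ket m) m' := by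
  rw [map_sum, Finsupp.finsetSum_apply]
  refine Finset.sum_congr rfl fun m _ => ?_
  rw [map_smul, Finsupp.smul_apply, smul_eq_mul, mul_comm]
  rfl

lemma sum_smul_ket_apply {n : ℕ} (f : Occ → ℂ) {m' : Occ} (hm' : m' ∈ (modes Λ).finsuppAntidiag n) :
    (∑ m : Sector Λ n, f m • ket m) m' = f m' := by
  rw [Finsupp.finsetSum_apply, Finset.sum_eq_single ⟨m', hm'⟩]
  · simp [ket]
  · intro m _ hm
    have : (m : Occ) ≠ m' := fun h => hm (Subtype.ext h)
    simp [ket, this]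
  · simp

/-- Since a(e_q) ξ = v_q ξ, dΓ(A) ξ is the sum of (Av)_p a†(e_p) ξ. Restricting to one sector loses
nothing because dΓ(A) conserves the particle number. -/
lemma sectorMatrix_dGamma_mulVec_coherentVec (A : Mode → Mode → ℂ) (v : Field Λ) {n : ℕ}
    (m : Sector Λ n) :
    (sectorMatrix Λ n (dGamma Λ A) *ᵥ coherentVec v n) m
      = ∑ p, oneBody A v p * raised v p m := by
  rw [sectorMatrix_mulVec, dGamma_apply, ← Finset.sum_coe_sort]
  refine Finset.sum_congr rfl fun p _ => ?_
  rw [oneBody, Finset.sum_mul, ← Finset.sum_coe_sort]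
  refine Finset.sum_congr rfl fun q _ => ?_
  rw [mul_assoc]
  congr 1
  by_cases h0 : (m : Occ) p = 0
  · simp [h0, raised]
  · have hle : Finsupp.single (p : Mode) 1 ≤ (m : Occ) :=
      Finsupp.single_le_iff.mpr (Nat.one_le_iff_ne_zero.mpr h0)
    have hmem : (m : Occ) - Finsupp.single (p : Mode) 1 + Finsupp.single (q : Mode) 1
        ∈ (modes Λ).finsuppAntidiag n := by
      have hm := Finset.mem_finsuppAntidiag.mp m.2
      rw [Finset.mem_finsuppAntidiag]
      refine ⟨?_, ?_⟩
      · have h2 : ∑ k ∈ modes Λ, ((m : Occ) - Finsupp.single (p : Mode) 1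
            + Finsupp.single (p : Mode) 1 : Occ) k = n := by
          rw [tsub_add_cancel_of_le hle, hm.1]
        simp only [Finsupp.coe_add, Pi.add_apply, Finset.sum_add_distrib, Finsupp.single_apply,
          Finset.sum_ite_eq, p.2, q.2, if_true] at h2 ⊢
        exact h2
      · refine Finsupp.support_add.trans (Finset.union_subset ?_ ?_)
        · exact (Finsupp.support_mono tsub_le_self).trans hm.2
        · exact Finsupp.support_single_subset.trans (Finset.singleton_subset_iff.mpr q.2)
    have h3 := sum_smul_ket_apply (coherent v) hmem
    simp only [coherentVec]
    rw [h3]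
    rw [Nat.cast_add, Nat.cast_one, coherent_add_single, raised]
    ring

/-- `⟨v, A v⟩`. -/
def oneBodyMean (A : Mode → Mode → ℂ) (v : Field Λ) : ℂ :=
  ∑ p, (starRingEnd ℂ) (v p) * oneBody A v p

lemma hasSum_qform_dGamma (A : Mode → Mode → ℂ) (v : Field Λ) :
    HasSum (fun n => qform (sectorMatrix Λ n (dGamma Λ A)) (coherentVec v n))
      (oneBodyMean A v).re := by
  have h : ∀ n, qform (sectorMatrix Λ n (dGamma Λ A)) (coherentVec v n)
      = (oneBodyMean A v).re * prev (weight v) n := by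
    intro n
    rw [← Complex.re_mul_ofReal, qform]
    congr 1
    simp only [dotProduct, Pi.star_apply, sectorMatrix_dGamma_mulVec_coherentVec, Finset.mul_sum]
    rw [Finset.sum_comm, oneBodyMean, Finset.sum_mul]
    refine Finset.sum_congr rfl fun p _ => ?_
    rw [mul_right_comm, ← sum_conj_coherent_mul_raised, Finset.sum_mul,
      ← Finset.sum_coe_sort ((modes Λ).finsuppAntidiag n)]
    refine Finset.sum_congr rfl fun m _ => ?_
    simp only [coherentVec, RCLike.star_def]
    ring
  simp_rw [h]
  simpa using (hasSum_prev (hasSum_weight v)).mul_left (oneBodyMean A v).re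

lemma qform_conjTranspose_mul_self {n : Type*} [Fintype n] (B : Matrix n n ℂ) (ξ : n → ℂ) :
    qform (Bᴴ * B) ξ = ∑ i, ‖(B *ᵥ ξ) i‖ ^ 2 := by
  rw [qform, ← Matrix.mulVec_mulVec, Matrix.dotProduct_mulVec, ← Matrix.star_mulVec, dotProduct,
    Complex.re_sum]
  refine Finset.sum_congr rfl fun i _ => ?_
  rw [Pi.star_apply, RCLike.star_def, conj_mul_self_eq, Complex.ofReal_re]

/-- Normal ordering the square gives the classical value |⟨v, Av⟩ - z|² plus ‖Av‖², the price of
noncommutativity. Shifting the sequence of weights by `prev` does not change its total, 1. -/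
lemma hasSum_qform_abs_sq_dGamma (A : Mode → Mode → ℂ) (z : ℂ) (v : Field Λ) :
    HasSum (fun n => qform ((sectorMatrix Λ n (dGamma Λ A) - z • 1)ᴴ *
        (sectorMatrix Λ n (dGamma Λ A) - z • 1)) (coherentVec v n))
      (‖oneBodyMean A v - z‖ ^ 2 + ∑ p, ‖oneBody A v p‖ ^ 2) := by
  set c := oneBody A v with hc
  set s := oneBodyMean A v with hs
  have h : ∀ n, qform ((sectorMatrix Λ n (dGamma Λ A) - z • 1)ᴴ *
        (sectorMatrix Λ n (dGamma Λ A) - z • 1)) (coherentVec v n)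
      = (∑ p, ‖c p‖ ^ 2) * prev (weight v) n + ‖s‖ ^ 2 * prev (prev (weight v)) n
        - 2 * ((starRingEnd ℂ) z * s).re * prev (weight v) n + ‖z‖ ^ 2 * weight v n := by
    intro n
    rw [qform_conjTranspose_mul_self]
    simp only [Matrix.sub_mulVec, Pi.sub_apply, sectorMatrix_dGamma_mulVec_coherentVec,
      Matrix.smul_mulVec, Matrix.one_mulVec, Pi.smul_apply, smul_eq_mul, coherentVec]
    rw [Finset.sum_coe_sort ((modes Λ).finsuppAntidiag n)
      fun m => ‖∑ p, c p * raised v p m - z * coherent v m‖ ^ 2]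
    have h1 : ∑ m ∈ (modes Λ).finsuppAntidiag n, (starRingEnd ℂ) (∑ p, c p * raised v p m) *
        (∑ p, c p * raised v p m) = (((∑ p, ‖c p‖ ^ 2) * prev (weight v) n
          + ‖s‖ ^ 2 * prev (prev (weight v)) n : ℝ) : ℂ) := by
      simp_rw [map_sum, Finset.sum_mul_sum]
      rw [Finset.sum_comm]
      simp_rw [Finset.sum_comm (s := (modes Λ).finsuppAntidiag n)]
      have h2 : ∀ p p', ∑ m ∈ (modes Λ).finsuppAntidiag n,
          (starRingEnd ℂ) (c p * raised v p m) * (c p' * raised v p' m)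
          = (if p = p' then (starRingEnd ℂ) (c p) * c p' * (prev (weight v) n : ℂ) else 0)
            + ((starRingEnd ℂ) (c p) * v p) * ((starRingEnd ℂ) (v p') * c p') *
              (prev (prev (weight v)) n : ℂ) := by
        intro p p'
        have h3 := sum_conj_raised_mul_raised v p p' n
        calc _ = (starRingEnd ℂ) (c p) * c p' * ∑ m ∈ (modes Λ).finsuppAntidiag n,
              (starRingEnd ℂ) (raised v p m) * raised v p' m := by
              rw [Finset.mul_sum]
              refine Finset.sum_congr rfl fun m _ => ?_
              rw [map_mul]; ring
          _ = _ := by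
              rw [h3]
              split_ifs <;> ring
      simp_rw [h2, Finset.sum_add_distrib, Finset.sum_ite_eq, Finset.mem_univ, if_true,
        ← Finset.sum_mul, conj_mul_self_eq]
      rw [← Finset.sum_mul_sum]
      have h4 : ∑ p, (starRingEnd ℂ) (c p) * v p = (starRingEnd ℂ) s := by
        rw [hs, oneBodyMean, map_sum]
        refine Finset.sum_congr rfl fun p _ => ?_
        rw [map_mul, Complex.conj_conj, mul_comm]
      have h5 : ∑ p, (starRingEnd ℂ) (v p) * c p = s := rfl
      rw [h4, h5, conj_mul_self_eq]
      push_cast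
      rfl
    have h6 : ∑ m ∈ (modes Λ).finsuppAntidiag n, (starRingEnd ℂ) (coherent v m) *
        (∑ p, c p * raised v p m) = s * (prev (weight v) n : ℂ) := by
      simp_rw [Finset.mul_sum]
      rw [Finset.sum_comm, hs, oneBodyMean, Finset.sum_mul]
      refine Finset.sum_congr rfl fun p _ => ?_
      rw [mul_right_comm, ← sum_conj_coherent_mul_raised, Finset.sum_mul]
      exact Finset.sum_congr rfl fun m _ => by ring
    have h7 : ∀ m, ‖∑ p, c p * raised v p m - z * coherent v m‖ ^ 2
        = ((starRingEnd ℂ) (∑ p, c p * raised v p m) * (∑ p, c p * raised v p m)).re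
          - 2 * ((starRingEnd ℂ) z * ((starRingEnd ℂ) (coherent v m) *
            (∑ p, c p * raised v p m))).re + ‖z‖ ^ 2 * ‖coherent v m‖ ^ 2 := by
      intro m
      generalize ∑ p, c p * raised v p m = x
      rw [← Complex.normSq_eq_norm_sq, ← Complex.normSq_eq_norm_sq, ← Complex.normSq_eq_norm_sq]
      simp only [Complex.normSq_apply, Complex.mul_re, Complex.mul_im, Complex.sub_re,
        Complex.sub_im, Complex.conj_re, Complex.conj_im]
      ring
    simp_rw [h7]
    rw [Finset.sum_add_distrib, Finset.sum_sub_distrib, ← Finset.mul_sum, ← Finset.mul_sum,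
      ← Complex.re_sum, ← Complex.re_sum, ← Finset.mul_sum, h1, h6, ← weight, Complex.ofReal_re,
      ← mul_assoc, Complex.re_mul_ofReal]
    ring
  simp_rw [h]
  have hw := hasSum_weight v
  have h8 := (((hasSum_prev hw).mul_left (∑ p, ‖c p‖ ^ 2)).add
    ((hasSum_prev (hasSum_prev hw)).mul_left (‖s‖ ^ 2))).sub
    ((hasSum_prev hw).mul_left (2 * ((starRingEnd ℂ) z * s).re)) |>.add (hw.mul_left (‖z‖ ^ 2))
  refine (congrArg (HasSum _) ?_).mp h8
  rw [← Complex.normSq_eq_norm_sq, ← Complex.normSq_eq_norm_sq, ← Complex.normSq_eq_norm_sq]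
  simp only [Complex.normSq_apply, Complex.mul_re, Complex.sub_re,
    Complex.sub_im, Complex.conj_re, Complex.conj_im]
  ring

end CoherentStates

/-! ### The ideal Bose gas: traces, mean occupations, comparison with the classical Gaussian. -/

section FreeGas

lemma sum_finsupp_prod {ι R : Type*} [CommSemiring R] (s : Finset ι)
    (t : ι → Finset ℕ) (f : ι → ℕ → R) :
    ∑ m ∈ s.finsupp t, ∏ k ∈ s, f k (m k) = ∏ k ∈ s, ∑ j ∈ t k, f k j := by
  classical
  rw [Finset.prod_sum, Finset.finsupp, Finset.sum_map]
  refine Finset.sum_congr rfl fun p _ => ?_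
  rw [← Finset.prod_attach]
  refine Finset.prod_congr rfl fun x _ => ?_
  simp [Finsupp.indicator_of_mem x.2]

/-- A finite set of states lies in a box of occupation numbers below some N, where the sum
factorises into truncated geometric series. -/
lemma sum_finsupp_prod_pow_le {s : Finset Mode} {y : Mode → ℝ} (h0 : ∀ k, 0 ≤ y k)
    (h1 : ∀ k, y k < 1) (F : Finset Occ) (hF : ∀ m ∈ F, m.support ⊆ s) :
    ∑ m ∈ F, ∏ k ∈ s, y k ^ m k ≤ ∏ k ∈ s, (1 - y k)⁻¹ := by
  classical
  set N := (∑ m ∈ F, ∑ k ∈ s, m k) + 1 with hN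
  have hsub : F ⊆ s.finsupp fun _ => Finset.range N := by
    intro m hm
    rw [Finset.mem_finsupp_iff]
    refine ⟨hF m hm, fun k hk => Finset.mem_range.mpr (Nat.lt_succ_of_le ?_)⟩
    exact (Finset.single_le_sum (f := fun k => m k) (fun _ _ => Nat.zero_le _) hk).trans
      (Finset.single_le_sum (f := fun m : Occ => ∑ k ∈ s, m k) (fun _ _ => Nat.zero_le _) hm)
  calc ∑ m ∈ F, ∏ k ∈ s, y k ^ m k
      ≤ ∑ m ∈ s.finsupp fun _ => Finset.range N, ∏ k ∈ s, y k ^ m k :=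
        Finset.sum_le_sum_of_subset_of_nonneg hsub fun m _ _ =>
          Finset.prod_nonneg fun k _ => pow_nonneg (h0 k) _
    _ = ∏ k ∈ s, ∑ j ∈ Finset.range N, y k ^ j := sum_finsupp_prod s _ fun k j => y k ^ j
    _ ≤ _ := by
        refine Finset.prod_le_prod (fun k _ => Finset.sum_nonneg fun j _ => pow_nonneg (h0 k) _)
          fun k _ => ?_
        rw [← tsum_geometric_of_lt_one (h0 k) (h1 k)]
        exact (summable_geometric_of_lt_one (h0 k) (h1 k)).sum_le_tsum _
          fun j _ => pow_nonneg (h0 k) _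

lemma summable_sum_finsuppAntidiag {s : Finset Mode} {y : Mode → ℝ} (h0 : ∀ k, 0 ≤ y k)
    (h1 : ∀ k, y k < 1) :
    Summable (fun n => ∑ m ∈ s.finsuppAntidiag n, ∏ k ∈ s, y k ^ m k) ∧
      ∑' n, ∑ m ∈ s.finsuppAntidiag n, ∏ k ∈ s, y k ^ m k ≤ ∏ k ∈ s, (1 - y k)⁻¹ := by
  classical
  have hnn : ∀ n, 0 ≤ ∑ m ∈ s.finsuppAntidiag n, ∏ k ∈ s, y k ^ m k := fun n =>
    Finset.sum_nonneg fun m _ => Finset.prod_nonneg fun k _ => pow_nonneg (h0 k) _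
  have hle : ∀ u : Finset ℕ, ∑ n ∈ u, ∑ m ∈ s.finsuppAntidiag n, ∏ k ∈ s, y k ^ m k
      ≤ ∏ k ∈ s, (1 - y k)⁻¹ := by
    intro u
    rw [← Finset.sum_biUnion]
    · refine sum_finsupp_prod_pow_le h0 h1 _ fun m hm => ?_
      obtain ⟨n, -, hn⟩ := Finset.mem_biUnion.mp hm
      exact (Finset.mem_finsuppAntidiag.mp hn).2
    · intro a _ b _ hab
      refine Finset.disjoint_left.mpr fun m ha hb => hab ?_
      rw [← (Finset.mem_finsuppAntidiag.mp ha).1, ← (Finset.mem_finsuppAntidiag.mp hb).1]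
  exact ⟨summable_of_sum_le hnn hle, Real.tsum_le_of_sum_le hnn hle⟩

/-- The Boltzmann factor of a mode. -/
def boltzmann (lam : ℝ) (k : Mode) : ℝ := Real.exp (-(lam * eigen k))

lemma boltzmann_pos (lam : ℝ) (k : Mode) : 0 < boltzmann lam k := Real.exp_pos _

variable {lam : ℝ}

lemma boltzmann_le (h : 0 < lam) (k : Mode) : boltzmann lam k ≤ Real.exp (-lam) :=
  Real.exp_le_exp.mpr (by nlinarith [one_le_eigen k])

lemma boltzmann_lt_one (h : 0 < lam) (k : Mode) : boltzmann lam k < 1 :=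
  (boltzmann_le h k).trans_lt (Real.exp_lt_one_iff.mpr (by linarith))

lemma sq_norm_le_eigen (n : Mode) : ‖n‖ ^ 2 ≤ eigen n := by
  have hπ : (1 : ℝ) ≤ (2 * Real.pi) ^ 2 := by nlinarith [Real.pi_gt_three]
  have h : ∀ i, ‖n‖ = ‖n i‖ → ‖n‖ ^ 2 ≤ eigen n := by
    intro i hi
    rw [hi, Int.norm_eq_abs, sq_abs, eigen_eq]
    have h1 : ((n i : ℝ)) ^ 2 ≤ (n 0 : ℝ) ^ 2 + (n 1 : ℝ) ^ 2 := by
      fin_cases i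
      · simpa using sq_nonneg (n 1 : ℝ)
      · simpa using sq_nonneg (n 0 : ℝ)
    nlinarith [sq_nonneg (n 0 : ℝ), sq_nonneg (n 1 : ℝ)]
  obtain ⟨i, -, hi⟩ := Finset.exists_mem_eq_sup' Finset.univ_nonempty fun i => ‖n i‖₊
  refine h i ?_
  rw [Pi.norm_def, ← Finset.sup'_eq_sup Finset.univ_nonempty, hi]
  rfl

/-- As e^{-x} ≤ 2/x², the terms with n ≠ 0 are dominated by a multiple of ‖n‖⁻⁴, which is summable
over ℤ². -/
lemma summable_boltzmann (h : 0 < lam) : Summable (boltzmann lam) := by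
  have hs := (EisensteinSeries.summable_one_div_norm_rpow (k := 4) (by norm_num)).mul_left
    (2 / lam ^ 2)
  refine Summable.of_norm_bounded_eventually hs ?_
  have hfin : {n : Mode | n ≠ 0} ∈ cofinite := by simp [Set.compl_def]
  filter_upwards [hfin] with n hn
  have hpos : 0 < ‖n‖ := norm_pos_iff.mpr hn
  have hx : 0 < lam * ‖n‖ ^ 2 := by positivity
  have h1 : boltzmann lam n ≤ Real.exp (-(lam * ‖n‖ ^ 2)) :=
    Real.exp_le_exp.mpr (neg_le_neg (mul_le_mul_of_nonneg_left (sq_norm_le_eigen n) h.le))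
  rw [Real.norm_of_nonneg (boltzmann_pos _ _).le]
  refine h1.trans ?_
  have h2 := Real.quadratic_le_exp_of_nonneg hx.le
  have h3 : (lam * ‖n‖ ^ 2) ^ 2 / 2 ≤ Real.exp (lam * ‖n‖ ^ 2) := by linarith
  rw [Real.exp_neg]
  refine (inv_anti₀ (by positivity) h3).trans_eq ?_
  rw [Real.rpow_neg hpos.le, show (4 : ℝ) = (4 : ℕ) by norm_num, Real.rpow_natCast]
  field_simp

lemma freeEnergy_eq {s : Finset Mode} {m : Occ} (hm : m.support ⊆ s) :
    freeEnergy m = ∑ k ∈ s, (m k : ℝ) * eigen k :=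
  Finsupp.sum_of_support_subset m hm _ fun k _ => by simp

lemma exp_freeEnergy_eq {s : Finset Mode} {m : Occ} (hm : m.support ⊆ s) :
    Real.exp (-(lam * freeEnergy m)) = ∏ k ∈ s, boltzmann lam k ^ m k := by
  rw [freeEnergy_eq hm, Finset.mul_sum, ← Finset.sum_neg_distrib, Real.exp_sum]
  refine Finset.prod_congr rfl fun k _ => ?_
  rw [boltzmann, ← Real.exp_nat_mul]
  ring_nf

/-- The free mean runs over infinitely many modes, so an infinite product must be controlled: (1 -
y)⁻¹ ≤ 1 + by ≤ e^{by} for each Boltzmann factor y, with b = (1 - e^{-λ})⁻¹, and the factors are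
summable. -/
lemma summable_exp_freeEnergy (h : 0 < lam) :
    Summable fun m : Occ => Real.exp (-(lam * freeEnergy m)) := by
  classical
  set b := (1 - Real.exp (-lam))⁻¹ with hb
  have hlt : Real.exp (-lam) < 1 := Real.exp_lt_one_iff.mpr (by linarith)
  have hb0 : 0 < b := inv_pos.mpr (by linarith)
  refine summable_of_sum_le (c := Real.exp (∑' k, boltzmann lam k * b))
    (fun m => (Real.exp_pos _).le) fun F => ?_
  set s := F.biUnion Finsupp.support with hs
  have hsub : ∀ m ∈ F, m.support ⊆ s := fun m hm => Finset.subset_biUnion_of_mem _ hm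
  calc ∑ m ∈ F, Real.exp (-(lam * freeEnergy m))
      = ∑ m ∈ F, ∏ k ∈ s, boltzmann lam k ^ m k :=
        Finset.sum_congr rfl fun m hm => exp_freeEnergy_eq (hsub m hm)
    _ ≤ ∏ k ∈ s, (1 - boltzmann lam k)⁻¹ :=
        sum_finsupp_prod_pow_le (fun k => (boltzmann_pos _ k).le) (boltzmann_lt_one h) F hsub
    _ ≤ ∏ k ∈ s, Real.exp (boltzmann lam k * b) := by
        refine Finset.prod_le_prod (fun k _ => inv_nonneg.mpr
          (by linarith [boltzmann_lt_one h k])) fun k _ => ?_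
        have h1 := boltzmann_lt_one h k
        have h2 : (1 - boltzmann lam k)⁻¹ = boltzmann lam k * (1 - boltzmann lam k)⁻¹ + 1 := by
          have : 1 - boltzmann lam k ≠ 0 := by linarith
          field_simp
          ring
        have h3 : (1 - boltzmann lam k)⁻¹ ≤ b :=
          inv_anti₀ (by linarith) (by linarith [boltzmann_le h k])
        rw [h2]
        refine le_trans ?_ (Real.add_one_le_exp _)
        gcongr
        exact (boltzmann_pos _ k).le
    _ = Real.exp (∑ k ∈ s, boltzmann lam k * b) := (Real.exp_sum _ _).symm
    _ ≤ _ := Real.exp_le_exp.mpr (((summable_boltzmann h).mul_right b).sum_le_tsum _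
        fun k _ => mul_nonneg (boltzmann_pos _ k).le hb0.le)

lemma natCast_le_freeEnergy (m : Occ) (p : Mode) : (m p : ℝ) ≤ freeEnergy m := by
  classical
  rw [freeEnergy_eq (s := insert p m.support) (Finset.subset_insert _ _)]
  refine le_trans ?_ (Finset.single_le_sum (f := fun k => (m k : ℝ) * eigen k)
    (fun k _ => mul_nonneg (Nat.cast_nonneg _) (eigen_pos k).le) (Finset.mem_insert_self _ _))
  exact le_mul_of_one_le_right (Nat.cast_nonneg _) (one_le_eigen p)

lemma summable_natCast_mul_exp_freeEnergy (h : 0 < lam) (p : Mode) :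
    Summable fun m : Occ => (m p : ℝ) * Real.exp (-(lam * freeEnergy m)) := by
  refine Summable.of_nonneg_of_le (fun m => by positivity) (fun m => ?_)
    ((summable_exp_freeEnergy (half_pos h)).mul_left (2 / lam))
  have h1 := natCast_le_freeEnergy m p
  have h2 : Real.exp (-(lam * freeEnergy m)) = Real.exp (-(lam / 2 * freeEnergy m)) *
      Real.exp (-(lam / 2 * freeEnergy m)) := by
    rw [← Real.exp_add]; ring_nf
  have h3 : lam / 2 * freeEnergy m ≤ Real.exp (lam / 2 * freeEnergy m) := by
    linarith [Real.add_one_le_exp (lam / 2 * freeEnergy m)]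
  have h4 : lam / 2 * freeEnergy m * Real.exp (-(lam / 2 * freeEnergy m)) ≤ 1 := by
    rw [Real.exp_neg, ← div_eq_mul_inv, div_le_one (Real.exp_pos _)]
    exact h3
  rw [h2, ← mul_assoc]
  refine mul_le_mul_of_nonneg_right ?_ (Real.exp_pos _).le
  calc (m p : ℝ) * Real.exp (-(lam / 2 * freeEnergy m))
      ≤ freeEnergy m * Real.exp (-(lam / 2 * freeEnergy m)) := by gcongr
    _ = 2 / lam * (lam / 2 * freeEnergy m * Real.exp (-(lam / 2 * freeEnergy m))) := by
        field_simp
    _ ≤ 2 / lam * 1 := by gcongr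
    _ = _ := mul_one _

lemma freeEnergy_add_single (m : Occ) (p : Mode) :
    freeEnergy (m + Finsupp.single p 1) = freeEnergy m + eigen p := by
  rw [freeEnergy, Finsupp.sum_add_index' (by simp) (by intros; push_cast; ring)]
  simp [freeEnergy]

/-- The mean occupation number of a mode is the Bose function. -/
lemma tsum_natCast_mul_exp_freeEnergy (h : 0 < lam) (p : Mode) :
    ∑' m : Occ, (m p : ℝ) * Real.exp (-(lam * freeEnergy m))
      = boltzmann lam p / (1 - boltzmann lam p) *
        ∑' m : Occ, Real.exp (-(lam * freeEnergy m)) := by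
  -- Only states with p occupied contribute; removing one particle gives S = y(S + Z) for the sum S,
  -- which is solved for S.
  have hinj : Function.Injective fun m : Occ => m + Finsupp.single p 1 := add_left_injective _
  have h1 : ∑' m : Occ, (m p : ℝ) * Real.exp (-(lam * freeEnergy m))
      = ∑' m : Occ, ((m + Finsupp.single p 1 : Occ) p : ℝ) *
        Real.exp (-(lam * freeEnergy (m + Finsupp.single p 1))) := by
    refine (hinj.tsum_eq (f := fun m : Occ => (m p : ℝ) * Real.exp (-(lam * freeEnergy m)))
      fun m hm => ?_).symm
    have h0 : m p ≠ 0 := by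
      rintro h0
      simp [h0] at hm
    exact ⟨m - Finsupp.single p 1, tsub_add_cancel_of_le
      (Finsupp.single_le_iff.mpr (Nat.one_le_iff_ne_zero.mpr h0))⟩
  have h2 : ∀ m : Occ, ((m + Finsupp.single p 1 : Occ) p : ℝ) *
        Real.exp (-(lam * freeEnergy (m + Finsupp.single p 1)))
      = boltzmann lam p * ((m p : ℝ) * Real.exp (-(lam * freeEnergy m))
        + Real.exp (-(lam * freeEnergy m))) := by
    intro m
    have h3 : Real.exp (-(lam * freeEnergy (m + Finsupp.single p 1)))
        = boltzmann lam p * Real.exp (-(lam * freeEnergy m)) := by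
      rw [boltzmann, ← Real.exp_add, freeEnergy_add_single]; ring_nf
    rw [h3, Finsupp.add_apply, Finsupp.single_eq_same]
    push_cast
    ring
  simp_rw [h2] at h1
  rw [tsum_mul_left, (summable_natCast_mul_exp_freeEnergy h p).tsum_add
    (summable_exp_freeEnergy h)] at h1
  have h4 : 1 - boltzmann lam p ≠ 0 := by linarith [boltzmann_lt_one h p]
  rw [div_mul_eq_mul_div, eq_div_iff h4]
  linarith

/-- The mean number of particles in the modes below the cutoff. -/
def occupation (lam Λ : ℝ) : ℝ := ∑ p ∈ modes Λ, boltzmann lam p / (1 - boltzmann lam p)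

lemma freeMean_dGammaP (h : 0 < lam) (Λ : ℝ) :
    freeMean lam (dGammaP Λ) = (occupation lam Λ : ℂ) := by
  have hZ : 0 < ∑' m : Occ, Real.exp (-(lam * freeEnergy m)) :=
    (summable_exp_freeEnergy h).tsum_pos (fun m => (Real.exp_pos _).le) 0 (Real.exp_pos _)
  have h1 : ∀ m : Occ, (Real.exp (-(lam * freeEnergy m)) : ℂ) * dGammaP Λ (ket m) m
      = ((∑ p ∈ modes Λ, (m p : ℝ) * Real.exp (-(lam * freeEnergy m)) : ℝ) : ℂ) := by
    intro m
    rw [dGammaP, dGamma_diagonal_ket, Finsupp.smul_apply, ket, Finsupp.single_eq_same, smul_eq_mul,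
      ← Finset.sum_mul]
    push_cast
    simp only [one_mul, mul_one]
    ring
  rw [freeMean]
  simp_rw [h1]
  rw [← Complex.ofReal_tsum, ← Complex.ofReal_tsum,
    Summable.tsum_finsetSum fun p _ => summable_natCast_mul_exp_freeEnergy h p,
    ← Complex.ofReal_div]
  simp_rw [tsum_natCast_mul_exp_freeEnergy h]
  rw [← Finset.sum_mul, mul_div_assoc, div_self hZ.ne', mul_one, occupation]

lemma freeMean_dGammaE (h : 0 < lam) (Λ : ℝ) (k : Mode) :
    freeMean lam (dGammaE Λ k) = if k = 0 then (occupation lam Λ : ℂ) else 0 := by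
  split_ifs with hk
  · rw [hk, dGammaE_zero, freeMean_dGammaP h]
  · simp [freeMean, dGammaE_ket_diagonal hk]

/-- With x = λλ_p, this is 1/x - 1 ≤ 1/(e^x - 1) ≤ 1/x multiplied by λ. -/
lemma boltzmann_div_bounds (h : 0 < lam) (p : Mode) :
    lam * (boltzmann lam p / (1 - boltzmann lam p)) ≤ (eigen p)⁻¹ ∧
      (eigen p)⁻¹ ≤ lam * (boltzmann lam p / (1 - boltzmann lam p)) + lam := by
  have hy := boltzmann_lt_one h p
  have hy0 := boltzmann_pos lam p
  have he := eigen_pos p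
  have hx : 0 < lam * eigen p := mul_pos h he
  have h1 : 1 - boltzmann lam p ≤ lam * eigen p := by
    have := Real.add_one_le_exp (-(lam * eigen p))
    rw [boltzmann]; linarith
  have h2 : boltzmann lam p * (lam * eigen p) ≤ 1 - boltzmann lam p := by
    have h3 := Real.add_one_le_exp (lam * eigen p)
    have h4 : boltzmann lam p * Real.exp (lam * eigen p) = 1 := by
      rw [boltzmann, ← Real.exp_add]; simp
    nlinarith
  have hd : 0 < 1 - boltzmann lam p := by linarith
  constructor
  · rw [← mul_div_assoc, div_le_iff₀ hd, inv_mul_eq_div, le_div_iff₀ he]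
    linarith
  · rw [inv_le_iff_one_le_mul₀ he]
    have h3 : lam * (boltzmann lam p / (1 - boltzmann lam p)) + lam
        = lam / (1 - boltzmann lam p) := by
      field_simp
      ring
    rw [h3, div_mul_eq_mul_div, le_div_iff₀ hd]
    linarith

lemma density_sub_occupation_bounds (h : 0 < lam) (Λ : ℝ) :
    0 ≤ density Λ - lam * occupation lam Λ ∧
      density Λ - lam * occupation lam Λ ≤ lam * (modes Λ).card := by
  have h1 : density Λ - lam * occupation lam Λ
      = ∑ p ∈ modes Λ, ((eigen p)⁻¹ - lam * (boltzmann lam p / (1 - boltzmann lam p))) := by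
    rw [density, Finset.sum_coe_sort (modes Λ) fun k => (eigen k)⁻¹, occupation, Finset.mul_sum,
      Finset.sum_sub_distrib]
  rw [h1]
  refine ⟨Finset.sum_nonneg fun p _ => by linarith [(boltzmann_div_bounds h p).1], ?_⟩
  calc _ ≤ ∑ _p ∈ modes Λ, lam :=
        Finset.sum_le_sum fun p _ => by linarith [(boltzmann_div_bounds h p).2]
    _ = _ := by rw [Finset.sum_const, nsmul_eq_mul, mul_comm]

lemma sectorMatrix_diagonal (Λ : ℝ) (n : ℕ) (a : Mode → ℂ) :
    sectorMatrix Λ n (dGamma Λ fun p q => if p = q then a p else 0)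
      = Matrix.diagonal fun m : Sector Λ n => ∑ p ∈ modes Λ, a p * (m : Occ) p := by
  ext m' m
  rw [sectorMatrix, Matrix.of_apply, dGamma_diagonal_ket, Finsupp.smul_apply, ket, smul_eq_mul,
    Finsupp.single_apply, Matrix.diagonal_apply]
  by_cases h : m' = m
  · simp [h]
  · have : ¬(m : Occ) = m' := fun h2 => h (Subtype.ext h2.symm)
    simp [h, this]

lemma sectorMatrix_dGammaH (Λ : ℝ) (n : ℕ) : sectorMatrix Λ n (dGammaH Λ)
    = Matrix.diagonal fun m : Sector Λ n => ((freeEnergy m : ℝ) : ℂ) := by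
  rw [dGammaH, sectorMatrix_diagonal Λ n fun p => (eigen p : ℂ)]
  congr 1
  ext m
  rw [freeEnergy_eq (Finset.mem_finsuppAntidiag.mp m.2).2]
  push_cast
  exact Finset.sum_congr rfl fun p _ => mul_comm _ _

lemma sectorMatrix_dGammaP (Λ : ℝ) (n : ℕ) :
    sectorMatrix Λ n (dGammaP Λ) = (n : ℂ) • 1 := by
  rw [dGammaP, sectorMatrix_diagonal Λ n fun _ => 1, Matrix.smul_one_eq_diagonal]
  congr 1
  ext m
  have := (Finset.mem_finsuppAntidiag.mp m.2).1
  simp only [one_mul, ← Nat.cast_sum, this]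

lemma sectorFreeZ_eq (Λ : ℝ) (n : ℕ) : sectorFreeZ lam Λ n
    = ∑ m ∈ (modes Λ).finsuppAntidiag n, ∏ k ∈ modes Λ, boltzmann lam k ^ m k := by
  have h1 : -((lam : ℂ) • sectorMatrix Λ n (dGammaH Λ))
      = Matrix.diagonal fun m : Sector Λ n => ((-(lam * freeEnergy m) : ℝ) : ℂ) := by
    rw [sectorMatrix_dGammaH, ← Matrix.diagonal_smul, Matrix.diagonal_neg]
    congr 1
    ext m
    simp
  rw [sectorFreeZ, h1, Matrix.exp_diagonal, Matrix.trace_diagonal, Complex.re_sum,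
    ← Finset.sum_coe_sort ((modes Λ).finsuppAntidiag n)
      fun m => ∏ k ∈ modes Λ, boltzmann lam k ^ m k]
  refine Finset.sum_congr rfl fun m _ => ?_
  rw [Pi.coe_exp, ← Complex.exp_eq_exp_ℂ, ← Complex.ofReal_exp, Complex.ofReal_re,
    exp_freeEnergy_eq (Finset.mem_finsuppAntidiag.mp m.2).2]

lemma summable_sectorFreeZ (h : 0 < lam) (Λ : ℝ) : Summable (sectorFreeZ lam Λ) := by
  have := (summable_sum_finsuppAntidiag (s := modes Λ) (fun k => (boltzmann_pos lam k).le)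
    (boltzmann_lt_one h)).1
  exact this.congr fun n => (sectorFreeZ_eq Λ n).symm

lemma quantumFreeZ_pos (h : 0 < lam) (Λ : ℝ) : 0 < quantumFreeZ lam Λ := by
  refine (summable_sectorFreeZ h Λ).tsum_pos (fun n => ?_) 0 ?_
  · rw [sectorFreeZ_eq]
    exact Finset.sum_nonneg fun m _ => Finset.prod_nonneg fun k _ =>
      pow_nonneg (boltzmann_pos lam k).le _
  · rw [sectorFreeZ_eq, sum_finsuppAntidiag_zero]
    simp

/-- Mode by mode, x/(1 - e^{-x}) ≤ e^x with x = λλ_k. The product of the λλ_k comes from the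
Gaussian normalisation and cancels in the final comparison. -/
lemma quantumFreeZ_mul_prod_le (h : 0 < lam) (Λ : ℝ) :
    quantumFreeZ lam Λ * ∏ k ∈ modes Λ, (lam * eigen k)
      ≤ Real.exp (∑ k ∈ modes Λ, lam * eigen k) := by
  have h1 : quantumFreeZ lam Λ ≤ ∏ k ∈ modes Λ, (1 - boltzmann lam k)⁻¹ := by
    have := (summable_sum_finsuppAntidiag (s := modes Λ) (fun k => (boltzmann_pos lam k).le)
      (boltzmann_lt_one h)).2
    refine le_trans (le_of_eq ?_) this
    exact tsum_congr fun n => sectorFreeZ_eq Λ n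
  have hpos : ∀ k, 0 < lam * eigen k := fun k => mul_pos h (eigen_pos k)
  calc _ ≤ (∏ k ∈ modes Λ, (1 - boltzmann lam k)⁻¹) * ∏ k ∈ modes Λ, (lam * eigen k) :=
        mul_le_mul_of_nonneg_right h1 (Finset.prod_nonneg fun k _ => (hpos k).le)
    _ = ∏ k ∈ modes Λ, (1 - boltzmann lam k)⁻¹ * (lam * eigen k) :=
        Finset.prod_mul_distrib.symm
    _ ≤ ∏ k ∈ modes Λ, Real.exp (lam * eigen k) := by
        refine Finset.prod_le_prod (fun k _ => mul_nonneg (inv_nonneg.mpr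
          (by linarith [boltzmann_lt_one h k])) (hpos k).le) fun k _ => ?_
        have hd : 0 < 1 - boltzmann lam k := by linarith [boltzmann_lt_one h k]
        rw [inv_mul_le_iff₀ hd]
        have h3 := Real.add_one_le_exp (lam * eigen k)
        have h4 : boltzmann lam k * Real.exp (lam * eigen k) = 1 := by
          rw [boltzmann, ← Real.exp_add]; simp
        rw [sub_mul, h4]
        linarith
    _ = _ := (Real.exp_sum _ _).symm

/-- The cutoff confines n to a square of side 2⌊√Λ⌋ + 1 lattice points, and (2√Λ + 1)² ≤ 9Λ as Λ ≥
1. -/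
lemma card_modes_le {Λ : ℝ} (hΛ : 1 ≤ Λ) : ((modes Λ).card : ℝ) ≤ 9 * Λ := by
  set L := ⌊Real.sqrt Λ⌋₊ with hL
  have hsub : modes Λ ⊆ Finset.Icc (fun _ => -(L : ℤ)) (fun _ => (L : ℤ)) := by
    intro n hn
    have hn' : eigen n ≤ Λ := by simpa [modes] using hn
    have h1 : ‖n‖ ≤ Real.sqrt Λ := Real.le_sqrt_of_sq_le ((sq_norm_le_eigen n).trans hn')
    have h2 : ∀ i, |n i| ≤ (L : ℤ) := by
      intro i
      have h3 : ((n i).natAbs : ℝ) ≤ Real.sqrt Λ := by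
        refine le_trans ?_ h1
        refine le_trans (le_of_eq ?_) (norm_le_pi_norm n i)
        rw [Int.norm_eq_abs, Nat.cast_natAbs, Int.cast_abs]
      have h4 := Nat.le_floor h3
      rw [Int.abs_eq_natAbs]
      exact_mod_cast h4
    exact Finset.mem_Icc.mpr ⟨fun i => (abs_le.mp (h2 i)).1, fun i => (abs_le.mp (h2 i)).2⟩
  have hcard := Finset.card_le_card hsub
  rw [Pi.card_Icc] at hcard
  simp only [Int.card_Icc, Finset.prod_const, Finset.card_univ, Fintype.card_fin] at hcard
  have h5 : ((L : ℤ) + 1 - -L).toNat = 2 * L + 1 := by omega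
  rw [h5] at hcard
  have h6 : (L : ℝ) ≤ Real.sqrt Λ := Nat.floor_le (Real.sqrt_nonneg _)
  have h7 : 1 ≤ Real.sqrt Λ := Real.one_le_sqrt.mpr hΛ
  have h8 : Real.sqrt Λ ^ 2 = Λ := Real.sq_sqrt (by linarith)
  have hcard' : ((modes Λ).card : ℝ) ≤ (2 * L + 1) ^ 2 := by exact_mod_cast hcard
  have hL0 : (0 : ℝ) ≤ L := Nat.cast_nonneg L
  nlinarith

end FreeGas

/-! ### Linearity of the quadratic form. -/

section QForm

variable {n : Type*} [Fintype n]

lemma qform_add (A B : Matrix n n ℂ) (ξ : n → ℂ) : qform (A + B) ξ = qform A ξ + qform B ξ := by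
  simp [qform, Matrix.add_mulVec, dotProduct_add]

lemma qform_sub (A B : Matrix n n ℂ) (ξ : n → ℂ) : qform (A - B) ξ = qform A ξ - qform B ξ := by
  simp [qform, Matrix.sub_mulVec, dotProduct_sub]

lemma qform_smul (c : ℝ) (A : Matrix n n ℂ) (ξ : n → ℂ) :
    qform ((c : ℂ) • A) ξ = c * qform A ξ := by
  simp [qform, Matrix.smul_mulVec, dotProduct_smul]

lemma qform_sum {ι : Type*} (s : Finset ι) (A : ι → Matrix n n ℂ) (ξ : n → ℂ) :
    qform (∑ i ∈ s, A i) ξ = ∑ i ∈ s, qform (A i) ξ := by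
  simp [qform, Matrix.sum_mulVec, dotProduct_sum]

end QForm

/-! ### The interacting Hamiltonian: self-adjointness, stability, finite trace. -/

section Hamiltonian

variable {w : EuclideanSpace ℝ (Fin 2) → ℝ} {lam ε Λ : ℝ}

lemma squareTerm_eq_zero_of_notMem (h : 0 < lam) {k : Mode} (hk : k ∉ shifts Λ) (n : ℕ) :
    squareTerm lam Λ n k = 0 := by
  have hk0 : k ≠ 0 := by
    rintro rfl
    exact hk zero_mem_shifts
  have : sectorMatrix Λ n (0 : Fock →ₗ[ℂ] Fock) = 0 := by
    ext
    simp [sectorMatrix]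
  rw [squareTerm, freeMean_dGammaE h, if_neg hk0, dGammaE_eq_zero_of_notMem hk, this]
  simp

lemma smul_hamiltonian_eq (h : 0 < lam) (n : ℕ) :
    (lam : ℂ) • hamiltonian w lam ε Λ n
      = (lam : ℂ) • sectorMatrix Λ n (dGammaH Λ) + ((lam ^ 2 : ℝ) : ℂ) •
        (((1 / 2 : ℝ) : ℂ) • (∑ k ∈ shifts Λ, (coeff w ε k : ℂ) • squareTerm lam Λ n k)
          - ((lam⁻¹ * tauEps w ε : ℝ) : ℂ) •
            (sectorMatrix Λ n (dGammaP Λ) - (occupation lam Λ : ℂ) • 1)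
          - ((lam⁻¹ ^ 2 * energyEps w ε : ℝ) : ℂ) • 1) := by
  rw [hamiltonian, quantumInteraction, freeMean_dGammaP h, tsum_eq_sum (s := shifts Λ) fun k hk => by
    rw [squareTerm_eq_zero_of_notMem h hk, smul_zero], smul_add, smul_smul]
  congr 2
  · push_cast; ring
  · push_cast; rfl

lemma qform_smul_hamiltonian (h : 0 < lam) (n : ℕ) (ξ : Sector Λ n → ℂ) :
    qform ((lam : ℂ) • hamiltonian w lam ε Λ n) ξ
      = lam * qform (sectorMatrix Λ n (dGammaH Λ)) ξ + lam ^ 2 *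
        (1 / 2 * ∑ k ∈ shifts Λ, coeff w ε k * qform (squareTerm lam Λ n k) ξ
          - lam⁻¹ * tauEps w ε * (qform (sectorMatrix Λ n (dGammaP Λ)) ξ
            - occupation lam Λ * ∑ m, ‖ξ m‖ ^ 2)
          - lam⁻¹ ^ 2 * energyEps w ε * ∑ m, ‖ξ m‖ ^ 2) := by
  rw [smul_hamiltonian_eq h]
  simp only [qform_add, qform_sub, qform_smul, qform_sum, qform_one]

lemma isHermitian_smul_real {n : Type*} {A : Matrix n n ℂ} (hA : A.IsHermitian) (c : ℝ) :
    ((c : ℂ) • A).IsHermitian := by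
  rw [Matrix.IsHermitian, Matrix.conjTranspose_smul, hA.eq]
  simp

lemma isHermitian_smul_hamiltonian (h : 0 < lam) (n : ℕ) :
    ((lam : ℂ) • hamiltonian w lam ε Λ n).IsHermitian := by
  rw [smul_hamiltonian_eq h]
  have hH : (sectorMatrix Λ n (dGammaH Λ)).IsHermitian := by
    rw [sectorMatrix_dGammaH]
    exact Matrix.isHermitian_diagonal_of_self_adjoint _ (by ext m; simp)
  have hP : (sectorMatrix Λ n (dGammaP Λ)).IsHermitian := by
    rw [sectorMatrix_dGammaP]
    exact isHermitian_smul_real Matrix.isHermitian_one (n : ℝ)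
  have hS : (∑ k ∈ shifts Λ, (coeff w ε k : ℂ) • squareTerm lam Λ n k).IsHermitian := by
    rw [Matrix.IsHermitian, Matrix.conjTranspose_sum]
    exact Finset.sum_congr rfl fun k _ =>
      isHermitian_smul_real (Matrix.isHermitian_conjTranspose_mul_self _) (coeff w ε k)
  exact (isHermitian_smul_real hH _).add (isHermitian_smul_real
    (((isHermitian_smul_real hS _).sub (isHermitian_smul_real
      (hP.sub (isHermitian_smul_real Matrix.isHermitian_one _)) _)).sub
      (isHermitian_smul_real Matrix.isHermitian_one _)) _)

lemma qform_squareTerm_nonneg (n : ℕ) (k : Mode) (ξ : Sector Λ n → ℂ) :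
    0 ≤ qform (squareTerm lam Λ n k) ξ := by
  rw [squareTerm, qform_conjTranspose_mul_self]
  exact Finset.sum_nonneg fun _ _ => sq_nonneg _

lemma qform_squareTerm_zero (h : 0 < lam) (n : ℕ) (ξ : Sector Λ n → ℂ) :
    qform (squareTerm lam Λ n 0) ξ = (n - occupation lam Λ) ^ 2 * ∑ m, ‖ξ m‖ ^ 2 := by
  rw [squareTerm, qform_conjTranspose_mul_self, freeMean_dGammaE h, if_pos rfl, dGammaE_zero,
    sectorMatrix_dGammaP, ← sub_smul, Finset.mul_sum]
  refine Finset.sum_congr rfl fun m _ => ?_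
  rw [Matrix.smul_mulVec, Matrix.one_mulVec, Pi.smul_apply, smul_eq_mul, norm_mul, mul_pow]
  congr 1
  rw [← Complex.ofReal_natCast, ← Complex.ofReal_sub, Complex.norm_real, Real.norm_eq_abs, sq_abs]

lemma qform_dGammaH_nonneg (n : ℕ) (ξ : Sector Λ n → ℂ) :
    0 ≤ qform (sectorMatrix Λ n (dGammaH Λ)) ξ := by
  have h := qform_conj_diagonal (1 : Matrix (Sector Λ n) (Sector Λ n) ℂ)
    (fun m => freeEnergy m) ξ
  simp only [one_mul, Matrix.conjTranspose_one, mul_one, Matrix.one_mulVec] at h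
  rw [sectorMatrix_dGammaH, h]
  refine Finset.sum_nonneg fun m _ => mul_nonneg ?_ (sq_nonneg _)
  rw [freeEnergy_eq (Finset.mem_finsuppAntidiag.mp m.2).2]
  exact Finset.sum_nonneg fun k _ => mul_nonneg (Nat.cast_nonneg _) (eigen_pos k).le

lemma qform_dGammaP (n : ℕ) (ξ : Sector Λ n → ℂ) :
    qform (sectorMatrix Λ n (dGammaP Λ)) ξ = n * ∑ m, ‖ξ m‖ ^ 2 := by
  rw [sectorMatrix_dGammaP, ← Complex.ofReal_natCast, qform_smul, qform_one]

/-- Stability: the interacting Hamiltonian controls the particle number. -/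
lemma qform_smul_hamiltonian_ge (hw : IsPotential w) (h : 0 < lam) (n : ℕ) (ξ : Sector Λ n → ℂ) :
    ((n : ℝ) - (occupation lam Λ + energyEps w ε + (lam * tauEps w ε + 1) ^ 2 / (2 * lam ^ 2))) *
        ∑ m, ‖ξ m‖ ^ 2 ≤ qform ((lam : ℂ) • hamiltonian w lam ε Λ n) ξ := by
  rw [qform_smul_hamiltonian h, qform_dGammaP]
  have h1 := qform_dGammaH_nonneg n ξ
  have h2 : (n - occupation lam Λ) ^ 2 * ∑ m, ‖ξ m‖ ^ 2
      ≤ ∑ k ∈ shifts Λ, coeff w ε k * qform (squareTerm lam Λ n k) ξ := by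
    refine le_trans (le_of_eq ?_) (Finset.single_le_sum
      (f := fun k => coeff w ε k * qform (squareTerm lam Λ n k) ξ)
      (fun k _ => mul_nonneg (hw.coeff_nonneg ε k) (qform_squareTerm_nonneg n k ξ))
      zero_mem_shifts)
    rw [hw.coeff_zero, one_mul, qform_squareTerm_zero h]
  have hS : 0 ≤ ∑ m, ‖ξ m‖ ^ 2 := Finset.sum_nonneg fun _ _ => sq_nonneg _
  generalize ∑ m, ‖ξ m‖ ^ 2 = S at *
  generalize ∑ k ∈ shifts Λ, coeff w ε k * qform (squareTerm lam Λ n k) ξ = T at *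
  generalize qform (sectorMatrix Λ n (dGammaH Λ)) ξ = R at *
  set x : ℝ := n - occupation lam Λ with hx
  have h3 : (n : ℝ) = x + occupation lam Λ := by rw [hx]; ring
  -- Completing the square after setting aside a term x of slope one: the remainder grows linearly
  -- in n, which makes the traces summable.
  have h4 : (x - (lam * tauEps w ε + 1) ^ 2 / (2 * lam ^ 2) - energyEps w ε) * S
      ≤ (lam ^ 2 / 2 * x ^ 2 - lam * tauEps w ε * x - energyEps w ε) * S := by
    refine mul_le_mul_of_nonneg_right ?_ hS
    have h5 : lam ^ 2 / 2 * x ^ 2 - lam * tauEps w ε * x - x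
        + (lam * tauEps w ε + 1) ^ 2 / (2 * lam ^ 2)
        = (lam * x - (lam * tauEps w ε + 1) / lam) ^ 2 / 2 := by
      field_simp
      ring
    have h6 : 0 ≤ (lam * x - (lam * tauEps w ε + 1) / lam) ^ 2 / 2 := by positivity
    linarith
  have h7 : lam * R + lam ^ 2 * (1 / 2 * T - lam⁻¹ * tauEps w ε * (n * S - occupation lam Λ * S)
      - lam⁻¹ ^ 2 * energyEps w ε * S)
      = lam * R + lam ^ 2 / 2 * T - lam * tauEps w ε * x * S - energyEps w ε * S := by
    rw [hx]
    field_simp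
    ring
  rw [h7]
  have h8 : lam ^ 2 / 2 * (x ^ 2 * S) ≤ lam ^ 2 / 2 * T := by gcongr
  have h9 : 0 ≤ lam * R := by positivity
  rw [h3]
  linarith

lemma sectorZ_nonneg (h : 0 < lam) (n : ℕ) : 0 ≤ sectorZ w lam ε Λ n :=
  trace_exp_neg_nonneg (isHermitian_smul_hamiltonian h n)

/-- This recasts the trace bound as an n-particle sum with the same factor e^{-1} for every mode, to
which the geometric series estimate applies. -/
lemma card_sector_mul_exp (n : ℕ) : (Fintype.card (Sector Λ n) : ℝ) * Real.exp (-(n : ℝ))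
    = ∑ m ∈ (modes Λ).finsuppAntidiag n, ∏ k ∈ modes Λ, Real.exp (-1) ^ m k := by
  have h1 : ∀ m ∈ (modes Λ).finsuppAntidiag n, ∏ k ∈ modes Λ, Real.exp (-1) ^ m k
      = Real.exp (-(n : ℝ)) := by
    intro m hm
    rw [Finset.prod_pow_eq_pow_sum, (Finset.mem_finsuppAntidiag.mp hm).1, ← Real.exp_nat_mul]
    simp
  rw [Finset.sum_congr rfl h1, Finset.sum_const, nsmul_eq_mul, Fintype.card_coe]

lemma summable_sectorZ (hw : IsPotential w) (h : 0 < lam) (ε Λ : ℝ) :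
    Summable (sectorZ w lam ε Λ) := by
  set B := occupation lam Λ + energyEps w ε + (lam * tauEps w ε + 1) ^ 2 / (2 * lam ^ 2) with hB
  have hs := (summable_sum_finsuppAntidiag (s := modes Λ) (y := fun _ => Real.exp (-1))
    (fun _ => (Real.exp_pos _).le) (fun _ => Real.exp_lt_one_iff.mpr (by norm_num))).1
  refine Summable.of_nonneg_of_le (sectorZ_nonneg h) (fun n => ?_) (hs.mul_left (Real.exp B))
  rw [← card_sector_mul_exp]
  refine (trace_exp_neg_le (isHermitian_smul_hamiltonian h n)
    (qform_smul_hamiltonian_ge hw h n)).trans_eq ?_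
  rw [neg_sub, sub_eq_add_neg, Real.exp_add]
  ring

lemma quantumZ_pos (hw : IsPotential w) (h : 0 < lam) (ε Λ : ℝ) : 0 < quantumZ w lam ε Λ := by
  refine (summable_sectorZ hw h ε Λ).tsum_pos (sectorZ_nonneg h) 0 ?_
  have : Nonempty (Sector Λ 0) := ⟨⟨0, by simp⟩⟩
  exact trace_exp_neg_pos (isHermitian_smul_hamiltonian h 0)

end Hamiltonian

/-! ### The coherent-state energy and its distance to the classical interaction. -/

section LowerSymbol

variable {w : EuclideanSpace ℝ (Fin 2) → ℝ} {lam ε Λ : ℝ}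

/-- The term produced by normal ordering. -/
def fluctuation (w : EuclideanSpace ℝ (Fin 2) → ℝ) (ε : ℝ) (u : Field Λ) : ℝ :=
  ∑ k ∈ shifts Λ, coeff w ε k * ∑ p, ‖oneBody (mulEntry k) u p‖ ^ 2

/-- The expectation in coherent states of the localised interaction. -/
def lowerSymbol (w : EuclideanSpace ℝ (Fin 2) → ℝ) (lam ε : ℝ) (u : Field Λ) : ℝ :=
  modeInteraction w ε (lam * occupation lam Λ) u + lam / 2 * fluctuation w ε u

lemma continuous_lowerSymbol : Continuous (lowerSymbol (Λ := Λ) w lam ε) := by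
  have := continuous_modeInteraction (Λ := Λ) (w := w) (ε := ε) (lam * occupation lam Λ)
  unfold lowerSymbol fluctuation oneBody
  fun_prop

lemma fluctuation_nonneg (hw : IsPotential w) (u : Field Λ) : 0 ≤ fluctuation w ε u :=
  Finset.sum_nonneg fun k _ => mul_nonneg (hw.coeff_nonneg ε k) (by positivity)

lemma oneBody_smul (A : Mode → Mode → ℂ) (c : ℝ) (u : Field Λ) (p : modes Λ) :
    oneBody A (c • u) p = c * oneBody A u p := by
  simp only [oneBody, Pi.smul_apply, Complex.real_smul, Finset.mul_sum]
  exact Finset.sum_congr rfl fun q _ => by ring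

lemma oneBodyMean_smul (A : Mode → Mode → ℂ) (c : ℝ) (u : Field Λ) :
    oneBodyMean A (c • u) = ((c ^ 2 : ℝ) : ℂ) * oneBodyMean A u := by
  simp only [oneBodyMean, oneBody_smul, Finset.mul_sum, Pi.smul_apply, Complex.real_smul, map_mul,
    Complex.conj_ofReal]
  refine Finset.sum_congr rfl fun p _ => ?_
  push_cast
  ring

lemma oneBodyMean_mulEntry (k : Mode) (u : Field Λ) : oneBodyMean (mulEntry k) u = rho k u := by
  simp only [oneBodyMean, oneBody, rho, Finset.mul_sum]
  exact Finset.sum_congr rfl fun p _ => Finset.sum_congr rfl fun q _ => by ring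

lemma oneBodyMean_diagonal (a : Mode → ℝ) (u : Field Λ) :
    oneBodyMean (fun p q => if p = q then (a p : ℂ) else 0) u
      = ((∑ p : modes Λ, a p * ‖u p‖ ^ 2 : ℝ) : ℂ) := by
  simp only [oneBodyMean, oneBody, Subtype.coe_inj, ite_mul, zero_mul, Finset.sum_ite_eq,
    Finset.mem_univ, if_true]
  rw [Complex.ofReal_sum]
  refine Finset.sum_congr rfl fun p _ => ?_
  rw [mul_left_comm, conj_mul_self_eq, Complex.ofReal_mul]

/-- With amplitude u/√λ each dΓ contributes λ⁻¹, so λ² times the squares becomes classical. The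
normal-ordering term carries a single λ⁻¹ and survives with a factor λ. -/
lemma hasSum_qform_smul_hamiltonian (h : 0 < lam) (u : Field Λ) :
    HasSum (fun n => qform ((lam : ℂ) • hamiltonian w lam ε Λ n)
        (coherentVec ((Real.sqrt lam)⁻¹ • u) n))
      (∑ k : modes Λ, eigen k * ‖u k‖ ^ 2 + lowerSymbol w lam ε u) := by
  set c := (Real.sqrt lam)⁻¹ with hc
  have hc2 : c ^ 2 = lam⁻¹ := by rw [hc, inv_pow, Real.sq_sqrt h.le]
  simp_rw [qform_smul_hamiltonian h, sum_norm_sq_coherentVec]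
  have hH := hasSum_qform_dGamma (fun p q => if p = q then (eigen p : ℂ) else 0) (c • u)
  have hP := hasSum_qform_dGamma (fun p q => if p = q then ((1 : ℝ) : ℂ) else 0) (c • u)
  rw [oneBodyMean_smul, oneBodyMean_diagonal, ← Complex.ofReal_mul, Complex.ofReal_re, hc2] at hH
  rw [oneBodyMean_smul, oneBodyMean_diagonal (fun _ => 1), ← Complex.ofReal_mul,
    Complex.ofReal_re, hc2] at hP
  have hP' : HasSum (fun n => qform (sectorMatrix Λ n (dGammaP Λ)) (coherentVec (c • u) n))
      (lam⁻¹ * mass u) := by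
    simpa only [Complex.ofReal_one, one_mul, mass_eq, dGammaP] using hP
  have hS : HasSum (fun n => ∑ k ∈ shifts Λ, coeff w ε k *
        qform (squareTerm lam Λ n k) (coherentVec (c • u) n))
      (∑ k ∈ shifts Λ, coeff w ε k * (‖oneBodyMean (mulEntry k) (c • u)
        - freeMean lam (dGammaE Λ k)‖ ^ 2 + ∑ p, ‖oneBody (mulEntry k) (c • u) p‖ ^ 2)) :=
    hasSum_sum fun k _ => (hasSum_qform_abs_sq_dGamma (mulEntry k) _ (c • u)).mul_left _
  have hw := hasSum_weight (c • u)
  have htot := (hH.mul_left lam).add (((hS.mul_left (1 / 2)).sub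
    ((hP'.sub (hw.mul_left (occupation lam Λ))).mul_left (lam⁻¹ * tauEps w ε))).sub
    (hw.mul_left (lam⁻¹ ^ 2 * energyEps w ε)) |>.mul_left (lam ^ 2))
  refine (congrArg (HasSum _) ?_).mp htot
  have hk : ∀ k, lam ^ 2 * (‖oneBodyMean (mulEntry k) (c • u)
        - freeMean lam (dGammaE Λ k)‖ ^ 2 + ∑ p, ‖oneBody (mulEntry k) (c • u) p‖ ^ 2)
      = ‖rho k u - (if k = 0 then ((lam * occupation lam Λ : ℝ) : ℂ) else 0)‖ ^ 2
        + lam * ∑ p, ‖oneBody (mulEntry k) u p‖ ^ 2 := by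
    intro k
    have h1 : rho k u - (if k = 0 then ((lam * occupation lam Λ : ℝ) : ℂ) else 0)
        = (lam : ℂ) * (oneBodyMean (mulEntry k) (c • u) - freeMean lam (dGammaE Λ k)) := by
      have hlam : (lam : ℂ) ≠ 0 := Complex.ofReal_ne_zero.mpr h.ne'
      rw [oneBodyMean_smul, oneBodyMean_mulEntry, freeMean_dGammaE h, hc2, mul_sub, ← mul_assoc]
      push_cast
      rw [mul_inv_cancel₀ hlam, one_mul]
      split_ifs <;> simp
    rw [h1, norm_mul, mul_pow, Complex.norm_real, Real.norm_eq_abs, sq_abs, mul_add]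
    congr 1
    simp_rw [oneBody_smul, norm_mul, mul_pow, ← Finset.mul_sum, Complex.norm_real,
      Real.norm_eq_abs, sq_abs, hc2]
    field_simp
  have hsum : lam ^ 2 * (1 / 2 * ∑ k ∈ shifts Λ, coeff w ε k * (‖oneBodyMean (mulEntry k) (c • u)
        - freeMean lam (dGammaE Λ k)‖ ^ 2 + ∑ p, ‖oneBody (mulEntry k) (c • u) p‖ ^ 2))
      = 1 / 2 * (∑ k ∈ shifts Λ, coeff w ε k *
          ‖rho k u - (if k = 0 then ((lam * occupation lam Λ : ℝ) : ℂ) else 0)‖ ^ 2)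
        + lam / 2 * fluctuation w ε u := by
    rw [mul_left_comm, Finset.mul_sum, fluctuation, Finset.sum_congr rfl fun k _ => by
      rw [mul_left_comm, hk, mul_add], Finset.sum_add_distrib, mul_add]
    congr 1
    rw [Finset.mul_sum, Finset.mul_sum]
    exact Finset.sum_congr rfl fun k _ => by ring
  rw [mul_sub, mul_sub, hsum, lowerSymbol, modeInteraction]
  field_simp
  ring

lemma norm_sq_oneBody_mulEntry (k : Mode) (u : Field Λ) (p : modes Λ) :
    ‖oneBody (mulEntry k) u p‖ ^ 2
      = ∑ q : modes Λ, if (p : Mode) = k + q then ‖u q‖ ^ 2 else 0 := by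
  simp only [oneBody, mulEntry_eq, ite_mul, one_mul, zero_mul]
  by_cases hq : ∃ q : modes Λ, (p : Mode) = k + q
  · obtain ⟨q, hq⟩ := hq
    have huniq : ∀ q' : modes Λ, (p : Mode) = k + q' ↔ q' = q := fun q' => by
      rw [hq, add_right_inj, Subtype.coe_inj, eq_comm]
    simp [huniq]
  · push Not at hq
    simp [hq]

/-- Because e_k acts as a shift, the sum is that of |u_q|² ŵ(ε(p - q)) over pairs of modes p, q.
Each coefficient is at most ‖w‖₁ and there are K values of p, so no negative power of ε appears. -/
lemma fluctuation_le (u : Field Λ) :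
    fluctuation w ε u ≤ (modes Λ).card * (∫ x, ‖w x‖) * mass u := by
  have hB : 0 ≤ ∫ x, ‖w x‖ := integral_nonneg fun _ => norm_nonneg _
  have h1 : fluctuation w ε u = ∑ q : modes Λ, ‖u q‖ ^ 2 * ∑ p : modes Λ, ∑ k ∈ shifts Λ,
      if (p : Mode) = k + q then coeff w ε k else 0 := by
    simp only [fluctuation, norm_sq_oneBody_mulEntry, Finset.mul_sum]
    rw [Finset.sum_comm]
    simp_rw [Finset.sum_comm (s := shifts Λ)]
    rw [Finset.sum_comm]
    refine Finset.sum_congr rfl fun q _ => Finset.sum_congr rfl fun p _ =>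
      Finset.sum_congr rfl fun k _ => ?_
    split_ifs <;> ring
  rw [h1, mass_eq, Finset.mul_sum]
  refine Finset.sum_le_sum fun q _ => ?_
  rw [mul_comm]
  refine mul_le_mul_of_nonneg_right ?_ (by positivity)
  calc ∑ p : modes Λ, ∑ k ∈ shifts Λ, (if (p : Mode) = k + q then coeff w ε k else 0)
      ≤ ∑ _p : modes Λ, ∫ x, ‖w x‖ := by
        refine Finset.sum_le_sum fun p _ => ?_
        have h2 : ∀ k : Mode, (p : Mode) = k + q ↔ k = p - q := fun k => by
          rw [eq_sub_iff_add_eq, eq_comm]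
        simp only [h2, Finset.sum_ite_eq']
        split_ifs
        · exact coeff_le w ε _
        · exact hB
    _ = _ := by simp

/-- The lower symbol exceeds the classical interaction by at most a multiple of the mass. -/
lemma lowerSymbol_le (hw : IsPotential w) (h : 0 < lam) (hτ : 0 ≤ tauEps w ε) (u : Field Λ) :
    lowerSymbol w lam ε u ≤ modeInteraction w ε (density Λ) u
      + (lam * (modes Λ).card * (1 + ∫ x, ‖w x‖) * mass u + (lam * (modes Λ).card) ^ 2) := by
  obtain ⟨hD0, hD1⟩ := density_sub_occupation_bounds h Λ
  have hd : 0 ≤ density Λ := Finset.sum_nonneg fun k _ => (inv_pos.mpr (eigen_pos k)).le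
  have hM := mass_nonneg u
  have hB : 0 ≤ ∫ x, ‖w x‖ := integral_nonneg fun _ => norm_nonneg _
  have hF := fluctuation_le (w := w) (ε := ε) u
  have hsplit : ∀ c : ℝ, ∑ k ∈ shifts Λ, coeff w ε k *
      ‖rho k u - (if k = 0 then (c : ℂ) else 0)‖ ^ 2
      = (mass u - c) ^ 2 + ∑ k ∈ (shifts Λ).erase 0, coeff w ε k * ‖rho k u‖ ^ 2 := by
    intro c
    rw [← Finset.add_sum_erase _ _ zero_mem_shifts, if_pos rfl, hw.coeff_zero, one_mul,
      norm_rho_zero_sub]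
    congr 1
    refine Finset.sum_congr rfl fun k hk => ?_
    rw [if_neg (Finset.ne_of_mem_erase hk), sub_zero]
  rw [lowerSymbol, modeInteraction, modeInteraction, hsplit, hsplit]
  -- Here 0 ≤ D ≤ λK. Expanding ½(‖u‖² - density + D)² costs D‖u‖² + D²/2, while -D · density and
  -- -τD have the favourable sign.
  set D := density Λ - lam * occupation lam Λ with hD
  have hocc : lam * occupation lam Λ = density Λ - D := by rw [hD]; ring
  rw [hocc]
  have hF2 : lam / 2 * fluctuation w ε u
      ≤ lam * (modes Λ).card * (∫ x, ‖w x‖) * mass u := by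
    have h1 := mul_le_mul_of_nonneg_left hF (half_pos h).le
    have h2 : 0 ≤ lam * (modes Λ).card * (∫ x, ‖w x‖) * mass u :=
      mul_nonneg (mul_nonneg (mul_nonneg h.le (Nat.cast_nonneg _)) hB) hM
    linarith
  have h1 : D * mass u ≤ lam * (modes Λ).card * mass u := mul_le_mul_of_nonneg_right hD1 hM
  have h2 : 0 ≤ D * density Λ := mul_nonneg hD0 hd
  have h3 : 0 ≤ tauEps w ε * D := mul_nonneg hτ hD0
  have h4 : D ^ 2 ≤ (lam * (modes Λ).card) ^ 2 := pow_le_pow_left₀ hD0 hD1 2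
  have h5 := sq_nonneg D
  linarith

end LowerSymbol

/-! ### Resolution of the identity by coherent states. -/

section Resolution

open scoped Nat

variable {lam Λ : ℝ}

lemma conj_coherent_mul_coherent (h : 0 < lam) (u : Field Λ) (m m' : Occ) :
    (starRingEnd ℂ) (coherent ((Real.sqrt lam)⁻¹ • u) m) * coherent ((Real.sqrt lam)⁻¹ • u) m'
      = ((∏ k : modes Λ, ((Real.sqrt lam)⁻¹ ^ (m k + m' k) /
          (Real.sqrt ((m k)! : ℝ) * Real.sqrt ((m' k)! : ℝ))) : ℝ) : ℂ) *
        ∏ k : modes Λ, ((starRingEnd ℂ) (u k) ^ m k * u k ^ m' k *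
          (Real.exp (-(lam⁻¹ * ‖u k‖ ^ 2)) : ℂ)) := by
  have hc : (Real.sqrt lam)⁻¹ ^ 2 = lam⁻¹ := by rw [inv_pow, Real.sq_sqrt h.le]
  have he : ∀ k : modes Λ, ‖((Real.sqrt lam)⁻¹ • u) k‖ ^ 2 = lam⁻¹ * ‖u k‖ ^ 2 := by
    intro k
    rw [Pi.smul_apply, norm_smul, mul_pow, Real.norm_eq_abs, sq_abs, hc]
  have hexp : (Real.exp (-(∑ k : modes Λ, lam⁻¹ * ‖u k‖ ^ 2) / 2) : ℂ) *
      (Real.exp (-(∑ k : modes Λ, lam⁻¹ * ‖u k‖ ^ 2) / 2) : ℂ)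
      = ∏ k : modes Λ, (Real.exp (-(lam⁻¹ * ‖u k‖ ^ 2)) : ℂ) := by
    rw [← Complex.ofReal_mul, ← Real.exp_add, add_halves, ← Complex.ofReal_prod, ← Real.exp_sum,
      Finset.sum_neg_distrib]
  simp only [coherent, he]
  rw [map_mul, map_prod, Complex.conj_ofReal, mul_mul_mul_comm, hexp, ← Finset.prod_mul_distrib,
    ← Finset.prod_mul_distrib, Complex.ofReal_prod, ← Finset.prod_mul_distrib]
  refine Finset.prod_congr rfl fun k _ => ?_
  simp only [map_div₀, map_pow, Complex.conj_ofReal, Pi.smul_apply, Complex.real_smul, map_mul]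
  push_cast
  rw [mul_pow, mul_pow, pow_add, mul_div_mul_comm]
  ring

lemma integrable_conj_coherent_mul (h : 0 < lam) (m m' : Occ) :
    Integrable fun u : Field Λ => (starRingEnd ℂ) (coherent ((Real.sqrt lam)⁻¹ • u) m) *
      coherent ((Real.sqrt lam)⁻¹ • u) m' := by
  simp_rw [conj_coherent_mul_coherent h]
  exact (integrable_field_moment (r := fun _ : modes Λ => lam⁻¹) (fun _ => inv_pos.mpr h)
    (fun k => m k) (fun k => m' k)).const_mul _

/-- Phases annihilate the off-diagonal moments; on the diagonal the factorials cancel and each mode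
leaves πλ. The support conditions are needed because the coherent coefficients see only the modes
below the cutoff. -/
lemma integral_conj_coherent_mul (h : 0 < lam) {m m' : Occ} (hm : m.support ⊆ modes Λ)
    (hm' : m'.support ⊆ modes Λ) :
    ∫ u : Field Λ, (starRingEnd ℂ) (coherent ((Real.sqrt lam)⁻¹ • u) m) *
      coherent ((Real.sqrt lam)⁻¹ • u) m'
      = if m = m' then (((Real.pi * lam) ^ (modes Λ).card : ℝ) : ℂ) else 0 := by
  simp_rw [conj_coherent_mul_coherent h]
  rw [integral_const_mul, integral_field_moment (r := fun _ : modes Λ => lam⁻¹)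
    (fun _ => inv_pos.mpr h) (fun k => m k) (fun k => m' k)]
  by_cases hmm : m = m'
  · subst hmm
    rw [if_pos rfl, if_pos rfl, ← Complex.ofReal_prod, ← Complex.ofReal_mul,
      ← Finset.prod_mul_distrib]
    have hk : ∀ k : modes Λ, (Real.sqrt lam)⁻¹ ^ (m k + m k) /
        (Real.sqrt ((m k)! : ℝ) * Real.sqrt ((m k)! : ℝ)) *
        (Real.pi * (m k)! / lam⁻¹ ^ (m k + 1)) = Real.pi * lam := by
      intro k
      have hf : ((m k)! : ℝ) ≠ 0 := by positivity
      rw [Real.mul_self_sqrt (by positivity), ← two_mul, pow_mul, inv_pow, Real.sq_sqrt h.le,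
        pow_succ]
      field_simp
    rw [Finset.prod_congr rfl fun k _ => hk k]
    simp
  · rw [if_neg hmm, if_neg, mul_zero]
    intro h2
    refine hmm (Finsupp.ext fun k => ?_)
    by_cases hk : k ∈ modes Λ
    · exact congrFun h2 ⟨k, hk⟩
    · rw [Finsupp.notMem_support_iff.mp fun h3 => hk (hm h3),
        Finsupp.notMem_support_iff.mp fun h3 => hk (hm' h3)]

lemma qform_coherentVec_eq {n : ℕ} (B : Matrix (Sector Λ n) (Sector Λ n) ℂ) (v : Field Λ) :
    qform B (coherentVec v n) = (∑ m : Sector Λ n, ∑ m' : Sector Λ n,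
      B m m' * ((starRingEnd ℂ) (coherent v m) * coherent v m')).re := by
  rw [qform]
  refine congrArg Complex.re (Finset.sum_congr rfl fun m _ => ?_)
  rw [Matrix.mulVec, dotProduct, Finset.mul_sum]
  refine Finset.sum_congr rfl fun m' _ => ?_
  exact mul_left_comm _ _ _

lemma hasIntegral_re_sum_sum {α ι : Type*} [MeasurableSpace α] {μ : Measure α} [Fintype ι]
    {F : ι → ι → α → ℂ} (hF : ∀ i j, Integrable (F i j) μ) :
    Integrable (fun a => (∑ i, ∑ j, F i j a).re) μ ∧
      ∫ a, (∑ i, ∑ j, F i j a).re ∂μ = (∑ i, ∑ j, ∫ a, F i j a ∂μ).re := by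
  have h1 : ∀ i, Integrable (fun a => ∑ j, F i j a) μ := fun i =>
    integrable_finsetSum _ fun j _ => hF i j
  have h2 : Integrable (fun a => ∑ i, ∑ j, F i j a) μ := integrable_finsetSum _ fun i _ => h1 i
  refine ⟨h2.re, (integral_re h2).trans ?_⟩
  rw [RCLike.re_eq_complex_re, integral_finsetSum _ fun i _ => h1 i]
  exact congrArg _ (Finset.sum_congr rfl fun i _ => integral_finsetSum _ fun j _ => hF i j)

lemma integrable_matrix_mul_coherent (h : 0 < lam) {n : ℕ}
    (B : Matrix (Sector Λ n) (Sector Λ n) ℂ) (m m' : Sector Λ n) :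
    Integrable fun u : Field Λ => B m m' * ((starRingEnd ℂ)
      (coherent ((Real.sqrt lam)⁻¹ • u) m) * coherent ((Real.sqrt lam)⁻¹ • u) m') :=
  (integrable_conj_coherent_mul h (m : Occ) (m' : Occ)).const_mul (B m m')

lemma integrable_qform_coherentVec (h : 0 < lam) {n : ℕ}
    (B : Matrix (Sector Λ n) (Sector Λ n) ℂ) :
    Integrable fun u : Field Λ => qform B (coherentVec ((Real.sqrt lam)⁻¹ • u) n) := by
  simp_rw [qform_coherentVec_eq]
  exact (hasIntegral_re_sum_sum (integrable_matrix_mul_coherent h B)).1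

/-- The trace as an average over coherent states. -/
lemma integral_qform_coherentVec (h : 0 < lam) {n : ℕ}
    (B : Matrix (Sector Λ n) (Sector Λ n) ℂ) :
    ∫ u : Field Λ, qform B (coherentVec ((Real.sqrt lam)⁻¹ • u) n)
      = (Real.pi * lam) ^ (modes Λ).card * B.trace.re := by
  simp_rw [qform_coherentVec_eq]
  rw [(hasIntegral_re_sum_sum (integrable_matrix_mul_coherent h B)).2]
  simp_rw [integral_const_mul]
  have hval : ∀ m m' : Sector Λ n, ∫ u : Field Λ,
      (starRingEnd ℂ) (coherent ((Real.sqrt lam)⁻¹ • u) m) * coherent ((Real.sqrt lam)⁻¹ • u) m'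
      = if m = m' then (((Real.pi * lam) ^ (modes Λ).card : ℝ) : ℂ) else 0 := by
    intro m m'
    rw [integral_conj_coherent_mul h (Finset.mem_finsuppAntidiag.mp m.2).2
      (Finset.mem_finsuppAntidiag.mp m'.2).2]
    simp only [Subtype.coe_inj]
  simp_rw [hval, mul_ite, mul_zero, Finset.sum_ite_eq, Finset.mem_univ, if_true, ← Finset.sum_mul]
  rw [mul_comm, Complex.re_ofReal_mul]
  rfl

end Resolution

/-! ### Berezin–Lieb inequality and the explicit free-energy bound. -/

section LowerBound

variable {w : EuclideanSpace ℝ (Fin 2) → ℝ} {lam ε Λ : ℝ}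

/-- The Berezin–Lieb lower bound on the Fock-space trace. -/
lemma integral_exp_neg_lowerSymbol_le (hw : IsPotential w) (h : 0 < lam) :
    ∫ u : Field Λ, Real.exp (-(∑ k : modes Λ, eigen k * ‖u k‖ ^ 2 + lowerSymbol w lam ε u))
      ≤ (Real.pi * lam) ^ (modes Λ).card * quantumZ w lam ε Λ := by
  set s : Field Λ → ℝ := fun u => ∑ k : modes Λ, eigen k * ‖u k‖ ^ 2 + lowerSymbol w lam ε u
    with hs
  set A : (n : ℕ) → Matrix (Sector Λ n) (Sector Λ n) ℂ :=
    fun n => (lam : ℂ) • hamiltonian w lam ε Λ n with hA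
  have hherm : ∀ n, (A n).IsHermitian := fun n => isHermitian_smul_hamiltonian h n
  set f : ℕ → Field Λ → ℝ := fun n u =>
    qform (NormedSpace.exp (-(A n))) (coherentVec ((Real.sqrt lam)⁻¹ • u) n) with hf
  have hf0 : ∀ n u, 0 ≤ f n u := fun n u => qform_exp_neg_nonneg (hherm n) _
  have hfi : ∀ n, Integrable (f n) := fun n => integrable_qform_coherentVec h _
  have hfint : ∀ n, ∫ u, f n u = (Real.pi * lam) ^ (modes Λ).card * sectorZ w lam ε Λ n :=
    fun n => integral_qform_coherentVec h _
  have hpi : 0 < (Real.pi * lam) ^ (modes Λ).card := by positivity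
  -- In [0, ∞] the series of sector contributions needs no convergence proof, and Tonelli exchanges
  -- it with the integral over u.
  have hpt : ∀ u, ENNReal.ofReal (Real.exp (-s u)) ≤ ∑' n, ENNReal.ofReal (f n u) := by
    intro u
    -- The tangent point is the total energy s(u), not that of a single sector. The weights sum to 1
    -- and the energies to s(u), so the tangent bounds add up to exactly e^{-s(u)}.
    have hsum : HasSum (fun n => Real.exp (-s u) * ((1 + s u) * weight ((Real.sqrt lam)⁻¹ • u) n
        - qform (A n) (coherentVec ((Real.sqrt lam)⁻¹ • u) n))) (Real.exp (-s u)) := by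
      have h1 := (((hasSum_weight ((Real.sqrt lam)⁻¹ • u)).mul_left (1 + s u)).sub
        (hasSum_qform_smul_hamiltonian (w := w) (ε := ε) h u)).mul_left (Real.exp (-s u))
      refine (congrArg (HasSum _) ?_).mp h1
      simp only [hs]
      ring
    refine le_of_tendsto' ((ENNReal.continuous_ofReal.tendsto _).comp hsum.tendsto_sum_nat)
      fun N => ?_
    calc ENNReal.ofReal _ ≤ ENNReal.ofReal (∑ n ∈ Finset.range N, f n u) := by
          refine ENNReal.ofReal_le_ofReal (Finset.sum_le_sum fun n _ => ?_)
          rw [← sum_norm_sq_coherentVec]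
          exact qform_exp_neg_ge (hherm n) _ _
      _ = ∑ n ∈ Finset.range N, ENNReal.ofReal (f n u) :=
          ENNReal.ofReal_sum_of_nonneg fun n _ => hf0 n u
      _ ≤ _ := ENNReal.sum_le_tsum _
  have hscont : Continuous fun u => Real.exp (-s u) := by
    have := continuous_lowerSymbol (Λ := Λ) (w := w) (lam := lam) (ε := ε)
    fun_prop
  rw [integral_eq_lintegral_of_nonneg_ae (ae_of_all _ fun u => (Real.exp_pos _).le)
    hscont.aestronglyMeasurable]
  refine ENNReal.toReal_le_of_le_ofReal (mul_nonneg hpi.le (quantumZ_pos hw h ε Λ).le) ?_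
  calc ∫⁻ u, ENNReal.ofReal (Real.exp (-s u)) ≤ ∫⁻ u, ∑' n, ENNReal.ofReal (f n u) :=
        lintegral_mono hpt
    _ = ∑' n, ∫⁻ u, ENNReal.ofReal (f n u) :=
        lintegral_tsum fun n => (hfi n).aemeasurable.ennreal_ofReal
    _ = ∑' n, ENNReal.ofReal ((Real.pi * lam) ^ (modes Λ).card * sectorZ w lam ε Λ n) := by
        refine tsum_congr fun n => ?_
        rw [← hfint, ofReal_integral_eq_lintegral_ofReal (hfi n) (ae_of_all _ (hf0 n))]
    _ ≤ _ := by
        rw [← ENNReal.ofReal_tsum_of_nonneg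
          (fun n => mul_nonneg hpi.le (sectorZ_nonneg h n))
          ((summable_sectorZ hw h ε Λ).mul_left _), tsum_mul_left, quantumZ]

/-- The density prefactor ∏ λ_k/π turns Lebesgue measure into the Gaussian one; multiplied by (πλ)^K
it leaves ∏ λλ_k. -/
lemma integral_gaussian_exp_neg_lowerSymbol_le (hw : IsPotential w) (h : 0 < lam) :
    ∫ u, Real.exp (-lowerSymbol w lam ε u) ∂(gaussian Λ)
      ≤ quantumZ w lam ε Λ * ∏ k ∈ modes Λ, (lam * eigen k) := by
  have h1 := integral_exp_neg_lowerSymbol_le (ε := ε) (Λ := Λ) hw h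
  have hpos : 0 ≤ ∏ k : modes Λ, eigen k / Real.pi :=
    Finset.prod_nonneg fun k _ => div_nonneg (eigen_pos k).le Real.pi_pos.le
  have h2 := mul_le_mul_of_nonneg_left h1 hpos
  rw [integral_gaussian]
  refine (le_of_eq ?_).trans (h2.trans_eq ?_)
  · rw [← integral_const_mul]
    refine integral_congr_ae (ae_of_all _ fun u => ?_)
    simp only [gaussianDensity_eq, smul_eq_mul]
    rw [neg_add, Real.exp_add, mul_assoc]
  · rw [← mul_assoc, mul_comm (quantumZ w lam ε Λ), ← Finset.prod_coe_sort (modes Λ)]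
    congr 1
    have h3 : (Real.pi * lam) ^ (modes Λ).card = ∏ _k : modes Λ, Real.pi * lam := by simp
    rw [h3, ← Finset.prod_mul_distrib]
    refine Finset.prod_congr rfl fun k _ => ?_
    have := Real.pi_pos.ne'
    field_simp

lemma lowerSymbol_ge (hw : IsPotential w) (h : 0 < lam) (u : Field Λ) :
    -(tauEps w ε ^ 2 / 2 + energyEps w ε) ≤ lowerSymbol w lam ε u := by
  have h1 := modeInteraction_ge (ε := ε) hw (lam * occupation lam Λ) u
  have h2 := mul_nonneg (half_pos h).le (fluctuation_nonneg (ε := ε) hw u)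
  unfold lowerSymbol
  linarith

lemma meanMass_nonneg (w : EuclideanSpace ℝ (Fin 2) → ℝ) (ε Λ : ℝ) : 0 ≤ meanMass w ε Λ :=
  mul_nonneg (inv_nonneg.mpr (integral_nonneg fun _ => (Real.exp_pos _).le))
    (integral_nonneg fun u => mul_nonneg (mass_nonneg u) (Real.exp_pos _).le)

lemma wellDefined (hw : IsPotential w) (h : 0 < lam) (hε : 0 < ε) (hε1 : ε ≤ 1) :
    WellDefined w lam ε Λ := by
  have hfun : (fun u : Field Λ => interaction w ε u) = modeInteraction w ε (density Λ) :=
    funext (interaction_eq (hw.summable_coeff hε hε1))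
  have hcont : Continuous fun u : Field Λ => interaction w ε u :=
    hfun ▸ continuous_modeInteraction _
  have hge : ∀ u : Field Λ, -(tauEps w ε ^ 2 / 2 + energyEps w ε) ≤ interaction w ε u := by
    intro u
    rw [interaction_eq (hw.summable_coeff hε hε1)]
    exact modeInteraction_ge hw _ u
  have hint := integrable_exp_neg_of_le hcont hge
  exact ⟨summable_sectorZ hw h ε Λ, summable_sectorFreeZ h Λ, quantumZ_pos hw h ε Λ,
    quantumFreeZ_pos h Λ, hint, integrable_mass_mul_exp_neg_of_le hcont hge,
    integral_exp_pos hint⟩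

/-- The semiclassical upper bound on the relative free energy, with explicit constants. -/
lemma neg_log_quantumZ_div_le (hw : IsPotential w) (h : 0 < lam) (hε : 0 < ε) (hε1 : ε ≤ 1) :
    -Real.log (quantumZ w lam ε Λ / quantumFreeZ lam Λ)
      ≤ -Real.log (classicalZ w ε Λ) + (lam * (modes Λ).card * (1 + ∫ x, ‖w x‖) * meanMass w ε Λ
        + (lam * (modes Λ).card) ^ 2 + lam * (modes Λ).card * Λ) := by
  have hc := hw.summable_coeff hε hε1
  obtain ⟨-, -, hZ, hZ0, -, -, hcl⟩ := wellDefined (Λ := Λ) hw h hε hε1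
  set V : Field Λ → ℝ := modeInteraction w ε (density Λ) with hV
  have hclV : classicalZ w ε Λ = ∫ u, Real.exp (-V u) ∂(gaussian Λ) := by
    simp only [classicalZ, interaction_eq hc, hV]
  set a := lam * (modes Λ).card * (1 + ∫ x, ‖w x‖) with ha
  set b := (lam * (modes Λ).card) ^ 2 with hb
  have hmm : (∫ u, Real.exp (-V u) ∂(gaussian Λ)) * meanMass w ε Λ
      = ∫ u, mass u * Real.exp (-V u) ∂(gaussian Λ) := by
    rw [← hclV, meanMass, mul_inv_cancel_left₀ hcl.ne']
    simp only [interaction_eq hc, hV]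
  have h1 := exp_mean_le_integral_exp (continuous_modeInteraction _) continuous_lowerSymbol
    (modeInteraction_ge (ε := ε) hw (density Λ)) (lowerSymbol_ge hw h)
    (lowerSymbol_le hw h (tauEps_nonneg hc (hw.coeff_nonneg ε))) hmm
  have h2 := h1.trans (integral_gaussian_exp_neg_lowerSymbol_le hw h)
  rw [← hclV] at h2
  have hprod : 0 < ∏ k ∈ modes Λ, (lam * eigen k) :=
    Finset.prod_pos fun k _ => mul_pos h (eigen_pos k)
  have h3 := Real.log_le_log (mul_pos (Real.exp_pos _) hcl) h2
  rw [Real.log_mul (Real.exp_pos _).ne' hcl.ne', Real.log_exp,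
    Real.log_mul hZ.ne' hprod.ne'] at h3
  -- The free gas brings the same product ∏ λλ_k, which cancels, leaving the error λ Tr Ph ≤ λKΛ.
  have h4 := Real.log_le_log (mul_pos hZ0 hprod) (quantumFreeZ_mul_prod_le h Λ)
  rw [Real.log_exp, Real.log_mul hZ0.ne' hprod.ne'] at h4
  have h5 : ∑ k ∈ modes Λ, lam * eigen k ≤ lam * (modes Λ).card * Λ := by
    calc ∑ k ∈ modes Λ, lam * eigen k ≤ ∑ _k ∈ modes Λ, lam * Λ := by
          refine Finset.sum_le_sum fun k hk => mul_le_mul_of_nonneg_left ?_ h.le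
          simpa [modes] using hk
      _ = _ := by rw [Finset.sum_const, nsmul_eq_mul]; ring
  rw [Real.log_div hZ.ne' hZ0.ne']
  linarith

end LowerBound

/-! ### Comparison of the explicit error with the stated one. -/

section Asymptotics

variable {w : EuclideanSpace ℝ (Fin 2) → ℝ} {lam ε Λ δ : ℝ}

lemma abs_log_le_inv_sq (hε : 0 < ε) (hε1 : ε ≤ 1) : |Real.log ε| ≤ 1 / 2 * (ε ^ 2)⁻¹ := by
  rw [abs_of_nonpos (Real.log_nonpos hε.le hε1)]
  have h := Real.log_le_sub_one_of_pos (x := (ε ^ 2)⁻¹) (by positivity)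
  rw [Real.log_inv, Real.log_pow] at h
  push_cast at h
  linarith

/-- The only negative term, with |log ε| ≤ ½ε⁻², is absorbed by half of λε⁻²Λ^{2+δ}; elsewhere ε⁻² ≥
1 suffices. -/
lemma le_semiclassicalError (h : 0 < lam) (hε : 0 < ε) (hε1 : ε ≤ 1) (hΛ : 1 ≤ Λ) :
    1 / 2 * (Λ ^ δ * (lam * Λ * meanMass w ε Λ + lam * Λ ^ 2))
      ≤ semiclassicalError w lam ε Λ δ := by
  have hΛ0 : 0 < Λ := by linarith
  have h1 : Λ ^ (1 + δ) = Λ ^ δ * Λ := by rw [add_comm, Real.rpow_add hΛ0, Real.rpow_one]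
  have h2 : Λ ^ (2 + δ) = Λ ^ δ * Λ ^ 2 := by rw [add_comm, Real.rpow_add hΛ0, Real.rpow_two]
  have hL : 0 < Λ ^ δ := Real.rpow_pos_of_pos hΛ0 δ
  have hM := meanMass_nonneg w ε Λ
  have hi : 1 ≤ (ε ^ 2)⁻¹ := (one_le_inv₀ (by positivity)).mpr (by nlinarith)
  have hlog := abs_log_le_inv_sq hε hε1
  rw [semiclassicalError, h1, h2]
  generalize Λ ^ δ = L at *
  generalize meanMass w ε Λ = M at *
  generalize (ε ^ 2)⁻¹ = e at *
  have h3 : lam * (L * Λ) * |Real.log ε| ≤ lam * (L * Λ ^ 2) * (1 / 2 * e) := by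
    have : L * Λ ≤ L * Λ ^ 2 := by gcongr; nlinarith
    gcongr
  have h4 : 1 * (lam * (L * Λ) * M) ≤ e * (lam * (L * Λ) * M) := by gcongr
  have h5 : 0 ≤ lam * (L * Λ ^ 2) := by positivity
  have h6 : 0 ≤ e * (lam * (L * Λ ^ 2)) := by positivity
  have h7 : 0 ≤ lam * (L * Λ) * M := by positivity
  nlinarith

/-- The error in the explicit bound, in terms of the error functional. -/
lemma explicit_error_le (hlam : 0 < lam) (hlam1 : lam ≤ 1) (hε : 0 < ε) (hε1 : ε ≤ 1)
    (hΛ : 1 ≤ Λ) :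
    Λ ^ δ * (lam * (modes Λ).card * (1 + ∫ x, ‖w x‖) * meanMass w ε Λ
        + (lam * (modes Λ).card) ^ 2 + lam * (modes Λ).card * Λ)
      ≤ 180 * (1 + ∫ x, ‖w x‖) * semiclassicalError w lam ε Λ δ := by
  have hK := card_modes_le hΛ
  have hB : 0 ≤ ∫ x, ‖w x‖ := integral_nonneg fun _ => norm_nonneg _
  have hM := meanMass_nonneg w ε Λ
  have hL : 0 < Λ ^ δ := Real.rpow_pos_of_pos (by linarith) δ
  have hK0 : (0 : ℝ) ≤ (modes Λ).card := Nat.cast_nonneg _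
  have hE := le_semiclassicalError (w := w) (δ := δ) hlam hε hε1 hΛ
  -- Inserting K ≤ 9Λ, the constant is 90 = 81 + 9: the 81 from (λK)², where λ ≤ 1 removes one power
  -- of λ, and the 9 from λKΛ.
  have hmain : lam * (modes Λ).card * (1 + ∫ x, ‖w x‖) * meanMass w ε Λ
        + (lam * (modes Λ).card) ^ 2 + lam * (modes Λ).card * Λ
      ≤ 90 * (1 + ∫ x, ‖w x‖) * (lam * Λ * meanMass w ε Λ + lam * Λ ^ 2) := by
    generalize ∫ x, ‖w x‖ = B at *
    generalize meanMass w ε Λ = M at *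
    generalize ((modes Λ).card : ℝ) = K at *
    have h1 : lam * K * (1 + B) * M ≤ lam * (9 * Λ) * (1 + B) * M := by gcongr
    have h2 : (lam * K) ^ 2 ≤ 81 * (lam * Λ ^ 2) := by
      have h3 : (lam * K) ^ 2 ≤ (lam * (9 * Λ)) ^ 2 := by gcongr
      have h4 : lam * (lam * Λ ^ 2) ≤ 1 * (lam * Λ ^ 2) := by gcongr
      nlinarith
    have h5 : lam * K * Λ ≤ lam * (9 * Λ) * Λ := by gcongr
    have h6 : 0 ≤ B * (lam * Λ ^ 2) := by positivity
    have h7 : 0 ≤ lam * Λ * (1 + B) * M := by positivity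
    nlinarith
  calc _ ≤ Λ ^ δ * (90 * (1 + ∫ x, ‖w x‖) * (lam * Λ * meanMass w ε Λ + lam * Λ ^ 2)) :=
        mul_le_mul_of_nonneg_left hmain hL.le
    _ = 180 * (1 + ∫ x, ‖w x‖) *
          (1 / 2 * (Λ ^ δ * (lam * Λ * meanMass w ε Λ + lam * Λ ^ 2))) := by ring
    _ ≤ _ := mul_le_mul_of_nonneg_left hE (by positivity)

end Asymptotics

end Phi42

end

theorem mainTheorem8 (w : EuclideanSpace ℝ (Fin 2) → ℝ) (hw : Phi42.IsPotential w)
    (η ν : ℝ) (hη : 0 < η) (hν : 0 < ν) :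
    (∀ lam : ℝ, 0 < lam → lam ≤ 1 → Phi42.WellDefined w lam (lam ^ η) (lam ^ (-ν))) ∧
    ∀ δ : ℝ, 0 < δ →
      (∃ C : ℝ, 0 < C ∧ ∀ lam : ℝ, 0 < lam → lam ≤ 1 →
        -Real.log (Phi42.quantumZ w lam (lam ^ η) (lam ^ (-ν)) /
            Phi42.quantumFreeZ lam (lam ^ (-ν)))
          ≤ -Real.log (∫ u : Phi42.Field (lam ^ (-ν)),
                Real.exp (-Phi42.interaction w (lam ^ η) u) ∂(Phi42.gaussian (lam ^ (-ν))))
            + C * Phi42.semiclassicalError w lam (lam ^ η) (lam ^ (-ν)) δ) ∧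
      (∃ lam₀ : ℝ, 0 < lam₀ ∧ ∀ lam : ℝ, 0 < lam → lam ≤ lam₀ →
        -Real.log (Phi42.quantumZ w lam (lam ^ η) (lam ^ (-ν)) /
            Phi42.quantumFreeZ lam (lam ^ (-ν)))
          ≤ -Real.log (∫ u : Phi42.Field (lam ^ (-ν)),
                Real.exp (-Phi42.interaction w (lam ^ η) u) ∂(Phi42.gaussian (lam ^ (-ν))))
            + Phi42.semiclassicalError w lam (lam ^ η) (lam ^ (-ν)) δ) := by
  have hε : ∀ lam : ℝ, 0 < lam → 0 < lam ^ η := fun lam h => Real.rpow_pos_of_pos h η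
  have hε1 : ∀ lam : ℝ, 0 < lam → lam ≤ 1 → lam ^ η ≤ 1 := fun lam h h1 =>
    Real.rpow_le_one h.le h1 hη.le
  have hΛ : ∀ lam : ℝ, 0 < lam → lam ≤ 1 → 1 ≤ lam ^ (-ν) := fun lam h h1 =>
    Real.one_le_rpow_of_pos_of_le_one_of_nonpos h h1 (by linarith)
  have hB : 0 ≤ ∫ x, ‖w x‖ := MeasureTheory.integral_nonneg fun _ => norm_nonneg _
  set C₀ : ℝ := 180 * (1 + ∫ x, ‖w x‖) with hC₀
  have hC₀pos : 0 < C₀ := by positivity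
  refine ⟨fun lam h h1 => Phi42.wellDefined hw h (hε lam h) (hε1 lam h h1), fun δ hδ => ?_⟩
  -- The explicit error lacks the factor Λ^δ, which may be traded for any constant c ≤ Λ^δ: c = 1
  -- gives the uniform constant, c = C₀ gives constant 1.
  have key : ∀ lam : ℝ, 0 < lam → lam ≤ 1 → ∀ c : ℝ, 0 < c → c ≤ (lam ^ (-ν)) ^ δ →
      -Real.log (Phi42.quantumZ w lam (lam ^ η) (lam ^ (-ν)) /
            Phi42.quantumFreeZ lam (lam ^ (-ν)))
          ≤ -Real.log (Phi42.classicalZ w (lam ^ η) (lam ^ (-ν)))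
            + C₀ / c * Phi42.semiclassicalError w lam (lam ^ η) (lam ^ (-ν)) δ := by
    intro lam h h1 c hc hcle
    refine (Phi42.neg_log_quantumZ_div_le hw h (hε lam h) (hε1 lam h h1)).trans ?_
    refine add_le_add le_rfl ?_
    have h2 := Phi42.explicit_error_le (w := w) (δ := δ) h h1 (hε lam h) (hε1 lam h h1)
      (hΛ lam h h1)
    have hM := Phi42.meanMass_nonneg w (lam ^ η) (lam ^ (-ν))
    have hΛ0 : 0 < lam ^ (-ν) := Real.rpow_pos_of_pos h _
    rw [div_mul_eq_mul_div, le_div_iff₀ hc, mul_comm]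
    refine le_trans (mul_le_mul_of_nonneg_right hcle ?_) h2
    have hcard : (0 : ℝ) ≤ (Phi42.modes (lam ^ (-ν))).card := Nat.cast_nonneg _
    positivity
  constructor
  · refine ⟨C₀, hC₀pos, fun lam h h1 => ?_⟩
    have := key lam h h1 1 one_pos (Real.one_le_rpow (hΛ lam h h1) hδ.le)
    rwa [div_one] at this
  -- The condition Λ^δ = λ^{-νδ} ≥ C₀ amounts to λ ≤ C₀^{-1/(νδ)}.
  · refine ⟨min 1 (C₀ ^ (-(ν * δ)⁻¹)), by positivity, fun lam h h1 => ?_⟩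
    have h2 : C₀ ≤ (lam ^ (-ν)) ^ δ := by
      have h3 : lam ≤ C₀ ^ (-(ν * δ)⁻¹) := h1.trans (min_le_right _ _)
      have h4 := Real.rpow_le_rpow_of_nonpos h h3 (z := -(ν * δ)) (by nlinarith)
      rw [← Real.rpow_mul hC₀pos.le, neg_mul_neg, inv_mul_cancel₀ (by positivity),
        Real.rpow_one] at h4
      rwa [← Real.rpow_mul h.le, neg_mul]
    have := key lam h (h1.trans (min_le_left _ _)) C₀ hC₀pos h2
    rwa [div_self hC₀pos.ne', one_mul] at this
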